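/- **Main multiplier estimates.** Work in Minkowski spacetime $\mathbb R^{1+3}$ with coordinates $(t,x)$, $r=|x|$, $\Box=-\partial_t^2+\Delta_x$. For $s>0$ let $\mathcal H_s=\{t>0,\ t^2-r^2=s^2\}$ and let $\|f\|_{L^2(\mathcal H_s)}$ be the $L^2$ norm of $f$ on $\mathcal H_s$ with respect to the flat measure $dx$. Put $\langle z\rangle=(1+z^2)^{1/2}$, $\tau_\pm=\langle t\pm r\rangle$, $\tau_0=\tau_- /\tau_+$. Let $\partial_r=\frac{x^i}{r}\partial_i$, $\partial^B_u=\partial_t$, $\partial^B_r=\partial_t+\partial_r$, $\underline\partial_i=\partial_i+\frac{x^i}{t}\partial_t$, and let $\nabla\!\!\!\!/\,$ be the gradient along the spheres on which $t$ and $r$ are constant. In expressions such as $\partial^B_u(s^2\phi)$ below, $s^2$ stands for the function $t^2-r^2$. For $a\in[0,1]$ define $$\|\phi(s)\|_{E_W}=\Big\|\frac st\partial_t\phi\Big\|_{L^2(\mathcal H_s)}+\|\underline\partial_x\phi\|_{L^2(\mathcal H_s)},$$ $$\mathcal E_r^a(s)=\Big\|\big(1+a\tau_+^a\tau_0^{\max(a,1/2)}\big)\Big(\frac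 st\frac{\partial^B_u(r\phi)}{r},\nabla\!\!\!\!/\,\phi\Big)\Big\|_{L^2(\mathcal H_s)}+\Big\|\tau_+^a\Big(\frac{\partial^B_r(r\phi)}{r},\frac st\nabla\!\!\!\!/\,\phi\Big)\Big\|_{L^2(\mathcal H_s)},$$ $$\mathcal E_{s}^a(s)=\Big\|\big(1+s^{a-1}\tau_-\big)\Big(\frac st\frac{\partial^B_u(s^2\phi)}{s^2},\nabla\!\!\!\!/\,\phi\Big)\Big\|_{L^2(\mathcal H_s)}+\Big\|s^{a-1}\tau_+\Big(\frac{\partial^B_r(s^2\phi)}{s^2},\frac st\nabla\!\!\!\!/\,\phi\Big)\Big\|_{L^2(\mathcal H_s)},$$ $$\|F\|_{N^a_W[s_0,s_1]}=\int_{s_0}^{s_1}\|\tau_+^aF\|_{L^2(\mathcal H_s)}\,ds .$$ There is an absolute constant $C$ such that, for all $1<s_0\le s_1$, all $0\le a\le1$, and every solution $\phi$ of $\Box\phi=F$ in the region $\{t>0,\ s_0^2\le t^2-r^2\le s_1^2\}$ which is $C^2$ near every point of this region and whose support in this region is compact, $$\sup_{s_0\le s\le s_1}\|\phi(s)\|_{E_W}\le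 C\big(\|\phi(s_0)\|_{E_W}+\|F\|_{N^0_W[s_0,s_1]}\big),$$ $$\sup_{s_0\le s\le s_1}\mathcal E_r^a(s)\le C\big(\mathcal E_r^a(s_0)+\|F\|_{N^a_W[s_0,s_1]}\big),$$ $$\sup_{s_0\le s\le s_1}\mathcal E_{s}^a(s)\le C\big(\mathcal E_{s}^a(s_0)+\|F\|_{N^a_W[s_0,s_1]}\big).$$ -/

import Mathlib

open MeasureTheory Set
open scoped ENNReal NNReal

noncomputable section

namespace Hyperboloidal

/-- Physical space `ℝ³` with its Euclidean norm. -/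
abbrev Space : Type := EuclideanSpace ℝ (Fin 3)

/-- Minkowski spacetime `ℝ × ℝ³`; a point is `(t, x)`. -/
abbrev Spacetime : Type := ℝ × Space

/-- The radius `r = |x|`. -/
def radius (p : Spacetime) : ℝ := ‖p.2‖

/-- The region `{t > 0, s₀² ≤ t² - r² ≤ s₁²}` between the hyperboloids `H_{s₀}` and `H_{s₁}`. -/
def slab (s₀ s₁ : ℝ) : Set Spacetime :=
  {p | 0 < p.1 ∧ s₀ ^ 2 ≤ p.1 ^ 2 - radius p ^ 2 ∧ p.1 ^ 2 - radius p ^ 2 ≤ s₁ ^ 2}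

/-! ### Derivatives -/

/-- `∂_t`. -/
def dt (φ : Spacetime → ℝ) (p : Spacetime) : ℝ := fderiv ℝ φ p (1, 0)

/-- `∂_i`, `i = 1, 2, 3`. -/
def dx (i : Fin 3) (φ : Spacetime → ℝ) (p : Spacetime) : ℝ :=
  fderiv ℝ φ p (0, EuclideanSpace.single i 1)

/-- The wave operator `□ = -∂_t² + Δ_x`. -/
def box (φ : Spacetime → ℝ) (p : Spacetime) : ℝ :=
  -dt (dt φ) p + ∑ i, dx i (dx i φ) p

/-- The radial derivative `∂_r = (xⁱ / r) ∂_i` (used only for `r > 0`). -/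
def dr (φ : Spacetime → ℝ) (p : Spacetime) : ℝ :=
  ∑ i, p.2 i / radius p * dx i φ p

/-- The Bondi derivative `∂ᴮ_u = ∂_t`. -/
def bondiU (φ : Spacetime → ℝ) (p : Spacetime) : ℝ := dt φ p

/-- The Bondi derivative `∂ᴮ_r = ∂_t + ∂_r`. -/
def bondiR (φ : Spacetime → ℝ) (p : Spacetime) : ℝ := dt φ p + dr φ p

/-- The derivatives `∂_i + (xⁱ / t) ∂_t`, `i = 1, 2, 3`, tangent to the hyperboloids. -/
def hypGrad (φ : Spacetime → ℝ) (p : Spacetime) : Space :=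
  WithLp.toLp 2 fun i => dx i φ p + p.2 i / p.1 * dt φ p

/-- The angular gradient: the part of `(∂_1 φ, ∂_2 φ, ∂_3 φ)` tangent to the spheres on which
`t` and `r` are constant. -/
def angGrad (φ : Spacetime → ℝ) (p : Spacetime) : Space :=
  WithLp.toLp 2 fun i => dx i φ p - p.2 i / radius p * dr φ p

/-! ### Weights -/

/-- The Japanese bracket `⟨z⟩ = (1 + z²)^{1/2}`. -/
def jap (z : ℝ) : ℝ := √(1 + z ^ 2)

/-- `τ₋ = ⟨t - r⟩`. -/
def tauMinus (p : Spacetime) : ℝ := jap (p.1 - radius p)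

/-- `τ₊ = ⟨t + r⟩`. -/
def tauPlus (p : Spacetime) : ℝ := jap (p.1 + radius p)

/-- `τ₀ = τ₋ / τ₊`. -/
def tauZero (p : Spacetime) : ℝ := tauMinus p / tauPlus p

/-- The conformal weight `Ω_r = r`. -/
def weightR (p : Spacetime) : ℝ := radius p

/-- The conformal weight `Ω_s = s² = t² - r²`, as a function on spacetime. -/
def weightS (p : Spacetime) : ℝ := p.1 ^ 2 - radius p ^ 2

/-! ### Norms -/

/-- The `L²` norm on `H_s = {t = (s² + |x|²)^{1/2}}` with respect to the flat measure `dx`,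
with value `∞` if the integral diverges. -/
def hypL2 {V : Type*} [NormedAddCommGroup V] (s : ℝ) (f : Spacetime → V) : ℝ≥0∞ :=
  eLpNorm (fun x : Space => f (√(s ^ 2 + ‖x‖ ^ 2), x)) 2 volume

/-- The pair of a scalar and a vector, with Euclidean norm `(y² + |v|²)^{1/2}`. -/
def pair (y : ℝ) (v : Space) : WithLp 2 (ℝ × Space) := WithLp.toLp 2 (y, v)

/-- The standard hyperboloidal energy norm `‖φ(s)‖_{E_W}`. -/
def energyW (s : ℝ) (φ : Spacetime → ℝ) : ℝ≥0∞ :=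
  hypL2 s (fun p => s / p.1 * dt φ p) + hypL2 s (hypGrad φ)

/-- The conformal energy norm of `r φ` on `H_s`, with exponent `a`. -/
def energyR (a s : ℝ) (φ : Spacetime → ℝ) : ℝ≥0∞ :=
  hypL2 s (fun p =>
    (1 + a * tauPlus p ^ a * tauZero p ^ max a (1 / 2)) •
      pair (s / p.1 * (bondiU (fun q => weightR q * φ q) p / weightR p)) (angGrad φ p)) +
  hypL2 s (fun p =>
    tauPlus p ^ a •
      pair (bondiR (fun q => weightR q * φ q) p / weightR p) ((s / p.1) • angGrad φ p))

/-- The conformal energy norm of `s² φ` on `H_s`, with exponent `a`. -/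
def energyS (a s : ℝ) (φ : Spacetime → ℝ) : ℝ≥0∞ :=
  hypL2 s (fun p =>
    (1 + s ^ (a - 1) * tauMinus p) •
      pair (s / p.1 * (bondiU (fun q => weightS q * φ q) p / weightS p)) (angGrad φ p)) +
  hypL2 s (fun p =>
    (s ^ (a - 1) * tauPlus p) •
      pair (bondiR (fun q => weightS q * φ q) p / weightS p) ((s / p.1) • angGrad φ p))

/-- The source norm `∫_{s₀}^{s₁} ‖τ₊^a F‖_{L²(H_s)} ds`. -/
def sourceNorm (a s₀ s₁ : ℝ) (F : Spacetime → ℝ) : ℝ≥0∞ :=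
  ∫⁻ s in Icc s₀ s₁, hypL2 s (fun p => tauPlus p ^ a * F p)

end Hyperboloidal

end

open Hyperboloidal

/-! In the coordinates `(s, x)`, `t = √(s² + |x|²)`, write `U(s, x) = φ(t, x)`. Then `∂_s U = (s/t)
∂_t φ`, the gradient `∇U` is the tangential gradient of `φ`, and `□φ = ΔU - ∂_s²U - (2/s) x·∇∂_s U -
(3/s) ∂_s U` (`hypBox_hypPull`).

All three estimates come from one family of multipliers. Put `p = t - r`, `q = t + r`, so `pq = s²`.
Let `Y` and `Z` be the derivatives of `rφ` along `∂_t + ∂_r` and `∂_t - ∂_r`, divided by `r`, and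
let `A` be the squared angular gradient. For weights `f(p, q)` and `g(p, q)` the multiplier
`(s/2t)(fY + gZ)` produces the density `(f(qY² + pA) + g(pZ² + qA))/(2t)` on `H_s`. Its divergence
identity has the bulk term `(s/2t)(2 f_p Y² + 2 g_q Z² + 2 (f_q + g_p - (f - g)/r) A)`. This is
nonpositive exactly under the sign conditions of `Admissible`. The two halves are exchanged by `r ↦
-r`, so only one of them is computed (`Blocks.identity`, `half_divergence_identity`). Cauchy–Schwarz
bounds the source term by `√α |□φ|` times the root of the density, with `α = (pf + qg)/(2t)`
(`Admissible.multiplier_sq_le`).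

Because of the terms `u/r` the density is singular on the axis. A radial cut-off at the scale
`l^(-1/2)` costs `l · l^(-3/2)`, provided that the radial flux is bounded above; this follows from
`0 ≤ g ≤ f` (`Admissible.inner_energyFlux_le`). A Grönwall argument for the root of the energy and
Fatou's lemma then give `Admissible.energy_estimate`.

It remains to choose weights and to compare norms. For `E_W`, take `f = g = 1`; the derivatives
`(x·∇U + U)/r` and `x·∇U/r` have the same `L²` norm (`Regular.eLpNorm_radial`). For `E_r^a`, take `f
= 3 q^(2a)`, with `g = 1 + p^(2a)` if `a ≥ 1/2` and `g = 1 + a² p q^(2a-1)` if `a ≤ 1/2`; these are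
comparable with the squares of the weights in the norm (`exists_admissible`). For `E_s^a`, combine
`f = g = 1` with the conformal choice `f = q²`, `g = p²`, whose source weight is exactly `s²`. The
norm is equivalent to the standard energy plus `‖U/s‖` plus `s^(a-1)` times the conformal energy
(`Regular.conformalNorm_le`, `Regular.le_conformalNorm`), and each of these three is propagated
separately. -/

noncomputable section

namespace Hyperboloidal

/-! ### Derivatives in hyperboloidal coordinates `(s, x)` -/

/-- The time coordinate `t = (s² + |x|²)^{1/2}` of the point with hyperboloidal coordinates
`(s, x)`. -/
def hypTime (z : Spacetime) : ℝ := √(z.1 ^ 2 + ‖z.2‖ ^ 2)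

/-- The spatial gradient of a function on `ℝ × ℝ³`. -/
def grad (U : Spacetime → ℝ) (z : Spacetime) : Space := WithLp.toLp 2 fun i => dx i U z

/-- The spatial Euler derivative `x · ∇U`. -/
def euler (U : Spacetime → ℝ) (z : Spacetime) : ℝ := fderiv ℝ U z (0, z.2)

/-- The second derivative as a bilinear map. -/
def hess (U : Spacetime → ℝ) (z : Spacetime) : Spacetime →L[ℝ] Spacetime →L[ℝ] ℝ :=
  fderiv ℝ (fderiv ℝ U) z

lemma clm_apply_zero_mk (L : Spacetime →L[ℝ] ℝ) (y : Space) :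
    L (0, y) = ∑ i, y i * L (0, EuclideanSpace.single i 1) := by
  have h : ((0 : ℝ), y) = ∑ i, y i • ((0 : ℝ), (EuclideanSpace.single i 1 : Space)) := by
    refine Prod.ext ?_ ?_
    · simp [Prod.fst_sum]
    · ext j
      simp [Prod.snd_sum, Finset.sum_apply, Pi.single_apply]
  conv_lhs => rw [h]
  rw [map_sum]
  exact Finset.sum_congr rfl fun i _ => by rw [map_smul, smul_eq_mul]

lemma fderiv_apply_zero_mk (U : Spacetime → ℝ) (z : Spacetime) (y : Space) :
    fderiv ℝ U z (0, y) = inner ℝ (grad U z) y := by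
  rw [clm_apply_zero_mk]
  simp [PiLp.inner_apply, grad, dx]

lemma euler_eq_inner (U : Spacetime → ℝ) (z : Spacetime) :
    euler U z = inner ℝ (grad U z) z.2 := fderiv_apply_zero_mk U z z.2

lemma norm_grad_sq (U : Spacetime → ℝ) (z : Spacetime) :
    ‖grad U z‖ ^ 2 = ∑ i, dx i U z ^ 2 := by
  rw [EuclideanSpace.norm_sq_eq]; simp [grad]

lemma euler_sq_le (U : Spacetime → ℝ) (z : Spacetime) :
    euler U z ^ 2 ≤ ‖grad U z‖ ^ 2 * ‖z.2‖ ^ 2 := by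
  rw [euler_eq_inner, ← mul_pow]
  exact sq_le_sq' (by linarith [neg_le_of_abs_le (abs_real_inner_le_norm (grad U z) z.2)])
    (real_inner_le_norm _ _)

section Regularity

variable {U : Spacetime → ℝ} {z : Spacetime}

lemma contDiffAt_fderiv (h : ContDiffAt ℝ 2 U z) : ContDiffAt ℝ 1 (fderiv ℝ U) z :=
  h.fderiv_right (by norm_num)

lemma contDiffAt_dt (h : ContDiffAt ℝ 2 U z) : ContDiffAt ℝ 1 (dt U) z :=
  (contDiffAt_fderiv h).clm_apply contDiffAt_const

lemma contDiffAt_dx (i : Fin 3) (h : ContDiffAt ℝ 2 U z) : ContDiffAt ℝ 1 (dx i U) z :=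
  (contDiffAt_fderiv h).clm_apply contDiffAt_const

lemma contDiffAt_euler (h : ContDiffAt ℝ 2 U z) : ContDiffAt ℝ 1 (euler U) z :=
  (contDiffAt_fderiv h).clm_apply (contDiffAt_const.prodMk contDiffAt_snd)

lemma contDiffAt_grad (h : ContDiffAt ℝ 2 U z) : ContDiffAt ℝ 1 (grad U) z := by
  rw [contDiffAt_euclidean]
  exact fun i => contDiffAt_dx i h

lemma contDiffAt_norm_grad_sq (h : ContDiffAt ℝ 2 U z) :
    ContDiffAt ℝ 1 (fun z => ‖grad U z‖ ^ 2) z := (contDiffAt_grad h).norm_sq ℝ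

lemma hypTime_pos (hz : 0 < z.1) : 0 < hypTime z := by
  unfold hypTime; positivity

lemma hypTime_sq (z : Spacetime) : hypTime z ^ 2 = z.1 ^ 2 + ‖z.2‖ ^ 2 :=
  Real.sq_sqrt (by positivity)

lemma contDiffAt_hypTime {n : WithTop ℕ∞} (hz : 0 < z.1) : ContDiffAt ℝ n hypTime z :=
  ((contDiffAt_fst.pow 2).add (contDiffAt_snd.norm_sq ℝ)).sqrt (by positivity)

lemma norm_lt_hypTime (hz : 0 < z.1) : ‖z.2‖ < hypTime z := by
  have := hypTime_sq z
  exact lt_of_pow_lt_pow_left₀ 2 (hypTime_pos hz).le (by rw [this]; nlinarith)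

lemma contDiffAt_radius {n : WithTop ℕ∞} (hz : z.2 ≠ 0) : ContDiffAt ℝ n radius z :=
  contDiffAt_snd.norm ℝ hz

lemma _root_.HasLineDerivAt.congr_value {f : Spacetime → ℝ} {a b : ℝ} {z d : Spacetime}
    (h : HasLineDerivAt ℝ f a z d) (e : a = b) : HasLineDerivAt ℝ f b z d := e ▸ h

/-! Line derivatives of the basic quantities. -/

lemma hasLineDerivAt_self (h : ContDiffAt ℝ 2 U z) (d : Spacetime) :
    HasLineDerivAt ℝ U (d.1 * dt U z + inner ℝ (grad U z) d.2) z d := by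
  have h1 := (h.differentiableAt (by norm_num)).hasFDerivAt.hasLineDerivAt d
  refine h1.congr_value ?_
  have : d = d.1 • ((1 : ℝ), (0 : Space)) + (0, d.2) := by ext <;> simp
  calc fderiv ℝ U z d = fderiv ℝ U z (d.1 • ((1 : ℝ), (0 : Space)) + (0, d.2)) := by rw [← this]
    _ = _ := by rw [map_add, map_smul, fderiv_apply_zero_mk]; rfl

lemma hasFDerivAt_fderiv (h : ContDiffAt ℝ 2 U z) :
    HasFDerivAt (fderiv ℝ U) (hess U z) z :=
  ((contDiffAt_fderiv h).differentiableAt (by norm_num)).hasFDerivAt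

lemma hess_symm (h : ContDiffAt ℝ 2 U z) (d d' : Spacetime) : hess U z d d' = hess U z d' d :=
  (h.isSymmSndFDerivAt (by simp)).eq d d'

lemma hasFDerivAt_fderiv_apply (h : ContDiffAt ℝ 2 U z) (c : Spacetime) :
    HasFDerivAt (fun z => fderiv ℝ U z c) ((hess U z).flip c) z := by
  have := (hasFDerivAt_fderiv h).clm_apply (hasFDerivAt_const c z)
  simpa using this

lemma hasLineDerivAt_dt (h : ContDiffAt ℝ 2 U z) (d : Spacetime) :
    HasLineDerivAt ℝ (dt U) (hess U z d (1, 0)) z d :=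
  (hasFDerivAt_fderiv_apply h (1, 0)).hasLineDerivAt d

lemma hasLineDerivAt_dx (i : Fin 3) (h : ContDiffAt ℝ 2 U z) (d : Spacetime) :
    HasLineDerivAt ℝ (dx i U) (hess U z d (0, EuclideanSpace.single i 1)) z d :=
  (hasFDerivAt_fderiv_apply h (0, EuclideanSpace.single i 1)).hasLineDerivAt d

lemma hasLineDerivAt_euler (h : ContDiffAt ℝ 2 U z) (d : Spacetime) :
    HasLineDerivAt ℝ (euler U) (hess U z d (0, z.2) + inner ℝ (grad U z) d.2) z d := by
  have h2 : HasFDerivAt (fun z : Spacetime => ((0 : ℝ), z.2))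
      ((0 : Spacetime →L[ℝ] ℝ).prod (ContinuousLinearMap.snd ℝ ℝ Space)) z :=
    (hasFDerivAt_const _ _).prodMk hasFDerivAt_snd
  refine ((hasFDerivAt_fderiv h).clm_apply h2).hasLineDerivAt d |>.congr_value ?_
  rw [← fderiv_apply_zero_mk]
  change fderiv ℝ U z (0, d.2) + hess U z d (0, z.2) = _
  ring

lemma hasLineDerivAt_norm_grad_sq (h : ContDiffAt ℝ 2 U z) (d : Spacetime) :
    HasLineDerivAt ℝ (fun z => ‖grad U z‖ ^ 2) (2 * hess U z d (0, grad U z)) z d := by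
  have h1 : ∀ i ∈ Finset.univ, HasDerivAt (fun ε : ℝ => dx i U (z + ε • d) ^ 2)
      (2 * dx i U z * hess U z d (0, EuclideanSpace.single i 1)) 0 := fun i _ => by
    have h0 : HasDerivAt (fun ε : ℝ => dx i U (z + ε • d)) _ 0 := hasLineDerivAt_dx i h d
    have := h0.fun_pow 2
    simpa using this
  have h2 := HasDerivAt.fun_sum h1
  simp only [norm_grad_sq]
  refine HasLineDerivAt.congr_value h2 ?_
  rw [clm_apply_zero_mk, Finset.mul_sum]
  exact Finset.sum_congr rfl fun i _ => by simp only [grad]; ring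

lemma hasLineDerivAt_radius (hz : z.2 ≠ 0) (d : Spacetime) :
    HasLineDerivAt ℝ radius (inner ℝ z.2 d.2 / radius z) z d := by
  have hr : radius z ≠ 0 := norm_ne_zero_iff.2 hz
  have h1 := ((contDiffAt_radius (n := 1) hz).differentiableAt (by norm_num)).hasFDerivAt
  -- The derivative of `r` is read off from that of `r² = |x|²`, computed in two ways.
  have h2 := h1.pow 2
  have h3 : HasFDerivAt (fun z : Spacetime => radius z ^ 2) _ z :=
    (hasFDerivAt_snd (𝕜 := ℝ) (p := z)).norm_sq
  have h4 := DFunLike.congr_fun (h2.unique h3) d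
  refine (h1.hasLineDerivAt d).congr_value ?_
  simp at h4
  rw [eq_div_iff hr]
  linarith

lemma hasLineDerivAt_hypTime (hz : 0 < z.1) (d : Spacetime) :
    HasLineDerivAt ℝ hypTime ((z.1 * d.1 + inner ℝ z.2 d.2) / hypTime z) z d := by
  have hr : hypTime z ≠ 0 := (hypTime_pos hz).ne'
  have h1 := ((contDiffAt_hypTime (n := 1) hz).differentiableAt (by norm_num)).hasFDerivAt
  have h2 := h1.pow 2
  have h3 := HasFDerivAt.fun_add
    (HasFDerivAt.pow (hasFDerivAt_fst (𝕜 := ℝ) (E := ℝ) (F := Space) (p := z)) 2)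
    (hasFDerivAt_snd (𝕜 := ℝ) (p := z)).norm_sq
  simp only [← hypTime_sq] at h3
  have h4 := DFunLike.congr_fun (h2.unique h3) d
  refine (h1.hasLineDerivAt d).congr_value ?_
  simp at h4
  rw [eq_div_iff hr]
  linarith

lemma hasLineDerivAt_fst (z d : Spacetime) :
    HasLineDerivAt ℝ (fun z : Spacetime => z.1) d.1 z d :=
  (hasFDerivAt_fst (𝕜 := ℝ) (p := z)).hasLineDerivAt d

end Regularity

/-! ### Half energy densities

The energy density attached to a pair of null weights is the sum of two expressions, which are
exchanged by the reflection `r ↦ -r`. -/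

/-- The values of the basic quantities at a point: `s`, `t`, `r`, `u`, `∂_s u`, `x · ∇u`, `|∇u|²`
and a weight. -/
structure Blocks where
  s : ℝ
  t : ℝ
  r : ℝ
  u : ℝ
  v : ℝ
  N : ℝ
  G : ℝ
  f : ℝ

namespace Blocks

/-- The null derivative of `r u`, divided by `r`. -/
def Y (b : Blocks) : ℝ := (b.t - b.r) / b.s * b.v + (b.N + b.u) / b.r

/-- The squared norm of the angular gradient. -/
def A (b : Blocks) : ℝ := b.G - b.N ^ 2 / b.r ^ 2

/-- The half energy density. -/
def E (b : Blocks) : ℝ := b.f * ((b.t + b.r) * b.Y ^ 2 + (b.t - b.r) * b.A) / (2 * b.t)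

/-- The half multiplier. -/
def M (b : Blocks) : ℝ := b.s / (2 * b.t) * b.f * b.Y

/-- The radial coefficient of the half flux. -/
def J (b : Blocks) : ℝ :=
  b.s / (2 * b.t * b.r) * b.f * (b.A - b.Y ^ 2) + 2 * b.M * b.N / b.r ^ 2

/-- The variation of `Y`. -/
def dY (b d : Blocks) : ℝ :=
  ((d.t - d.r) / b.s - (b.t - b.r) * d.s / b.s ^ 2) * b.v + (b.t - b.r) / b.s * d.v +
    (d.N + d.u) / b.r - (b.N + b.u) * d.r / b.r ^ 2

/-- The variation of `A`. -/
def dA (b d : Blocks) : ℝ := d.G - 2 * b.N * d.N / b.r ^ 2 + 2 * b.N ^ 2 * d.r / b.r ^ 3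

/-- The variation of `E`. -/
def dE (b d : Blocks) : ℝ :=
  (d.f * ((b.t + b.r) * b.Y ^ 2 + (b.t - b.r) * b.A) +
    b.f * ((d.t + d.r) * b.Y ^ 2 + (b.t + b.r) * (2 * b.Y * b.dY d) + (d.t - d.r) * b.A +
      (b.t - b.r) * b.dA d)) / (2 * b.t) -
    b.f * ((b.t + b.r) * b.Y ^ 2 + (b.t - b.r) * b.A) * d.t / (2 * b.t ^ 2)

/-- The variation of `M`. -/
def dM (b d : Blocks) : ℝ :=
  (d.s / (2 * b.t) - b.s * d.t / (2 * b.t ^ 2)) * (b.f * b.Y) +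
    b.s / (2 * b.t) * (d.f * b.Y + b.f * b.dY d)

/-- The variation of `J`. -/
def dJ (b d : Blocks) : ℝ :=
  (d.s / (2 * b.t * b.r) - b.s * d.t / (2 * b.t ^ 2 * b.r) - b.s * d.r / (2 * b.t * b.r ^ 2)) *
      (b.f * (b.A - b.Y ^ 2)) +
    b.s / (2 * b.t * b.r) * (d.f * (b.A - b.Y ^ 2) + b.f * (b.dA d - 2 * b.Y * b.dY d)) +
    2 * (b.dM d * b.N + b.M * d.N) / b.r ^ 2 - 4 * b.M * b.N * d.r / b.r ^ 3

/-- A curve of blocks has the velocity `d` at the time `0`. -/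
structure HasVelocity (b : ℝ → Blocks) (d : Blocks) : Prop where
  s : HasDerivAt (fun ε => (b ε).s) d.s 0
  t : HasDerivAt (fun ε => (b ε).t) d.t 0
  r : HasDerivAt (fun ε => (b ε).r) d.r 0
  u : HasDerivAt (fun ε => (b ε).u) d.u 0
  v : HasDerivAt (fun ε => (b ε).v) d.v 0
  N : HasDerivAt (fun ε => (b ε).N) d.N 0
  G : HasDerivAt (fun ε => (b ε).G) d.G 0
  f : HasDerivAt (fun ε => (b ε).f) d.f 0

section

variable {b : ℝ → Blocks} {d : Blocks}

lemma hasDerivAt_Y (h : HasVelocity b d) (hs : (b 0).s ≠ 0) (hr : (b 0).r ≠ 0) :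
    HasDerivAt (fun ε => (b ε).Y) ((b 0).dY d) 0 := by
  refine ((((h.t.fun_sub h.r).fun_div h.s hs).fun_mul h.v).fun_add
    ((h.N.fun_add h.u).fun_div h.r hr)).congr_deriv ?_
  simp only [dY]
  field_simp
  ring

lemma hasDerivAt_A (h : HasVelocity b d) (hr : (b 0).r ≠ 0) :
    HasDerivAt (fun ε => (b ε).A) ((b 0).dA d) 0 := by
  refine (h.G.fun_sub ((h.N.fun_pow 2).fun_div (h.r.fun_pow 2) (pow_ne_zero 2 hr))).congr_deriv ?_
  simp only [dA]
  field_simp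
  ring

lemma hasDerivAt_E (h : HasVelocity b d) (hs : (b 0).s ≠ 0) (ht : (b 0).t ≠ 0) (hr : (b 0).r ≠ 0) :
    HasDerivAt (fun ε => (b ε).E) ((b 0).dE d) 0 := by
  have hY := hasDerivAt_Y h hs hr
  have hA := hasDerivAt_A h hr
  refine ((h.f.fun_mul (((h.t.fun_add h.r).fun_mul (hY.fun_pow 2)).fun_add
    ((h.t.fun_sub h.r).fun_mul hA))).fun_div
      (h.t.const_mul 2) (mul_ne_zero two_ne_zero ht)).congr_deriv ?_
  simp only [dE]
  field_simp
  ring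

lemma hasDerivAt_M (h : HasVelocity b d) (hs : (b 0).s ≠ 0) (ht : (b 0).t ≠ 0) (hr : (b 0).r ≠ 0) :
    HasDerivAt (fun ε => (b ε).M) ((b 0).dM d) 0 := by
  have hY := hasDerivAt_Y h hs hr
  refine (((h.s.fun_div (h.t.const_mul 2) (mul_ne_zero two_ne_zero ht)).fun_mul h.f).fun_mul
    hY).congr_deriv ?_
  simp only [dM]
  field_simp
  ring

lemma hasDerivAt_J (h : HasVelocity b d) (hs : (b 0).s ≠ 0) (ht : (b 0).t ≠ 0) (hr : (b 0).r ≠ 0) :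
    HasDerivAt (fun ε => (b ε).J) ((b 0).dJ d) 0 := by
  have hY := hasDerivAt_Y h hs hr
  have hA := hasDerivAt_A h hr
  have hM := hasDerivAt_M h hs ht hr
  refine ((((h.s.fun_div ((h.t.const_mul 2).fun_mul h.r)
    (mul_ne_zero (mul_ne_zero two_ne_zero ht) hr)).fun_mul h.f).fun_mul
      (hA.fun_sub (hY.fun_pow 2))).fun_add
      (((hM.const_mul 2).fun_mul h.N).fun_div (h.r.fun_pow 2) (pow_ne_zero 2 hr))).congr_deriv ?_
  simp only [dJ]
  field_simp
  ring

end

/-- The divergence identity for the half energies, with the derivatives of the basic quantities in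
the directions `∂_s`, `x` and `∇u` inserted. -/
lemma identity (b : Blocks) (hs : 0 < b.s) (ht : b.t ^ 2 = b.s ^ 2 + b.r ^ 2) (hrt : |b.r| < b.t)
    (hr : b.r ≠ 0) (fp fq vv n1 g1 Hxx Hxg Hgg L : ℝ) :
    b.dE ⟨1, b.s / b.t, 0, b.v, vv, n1, 2 * g1, fp * (b.s / b.t) + fq * (b.s / b.t)⟩ +
      (3 * b.J +
        b.dJ ⟨0, b.r ^ 2 / b.t, b.r, b.N, n1, Hxx + b.N, 2 * Hxg,
          fp * (b.r ^ 2 / b.t - b.r) + fq * (b.r ^ 2 / b.t + b.r)⟩ - 2 * b.M * L -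
        2 * b.dM ⟨0, b.N / b.t, b.N / b.r, b.G, g1, Hxg + b.G, 2 * Hgg,
          fp * (b.N / b.t - b.N / b.r) + fq * (b.N / b.t + b.N / b.r)⟩) =
      -2 * (L - vv - 2 / b.s * n1 - 3 / b.s * b.v) * b.M +
        b.s / (2 * b.t) * (2 * fp * b.Y ^ 2 + (2 * fq - 2 * b.f / b.r) * b.A) := by
  obtain ⟨s, t, r, u, v, N, G, f⟩ := b
  simp only at *
  have h1 : 0 < t - r := by linarith [le_abs_self r]
  have h2 : 0 < t + r := by linarith [neg_abs_le r]
  have ht0 : t ≠ 0 := by linarith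
  -- Parametrising `t - r = a²`, `t + r = b²`, `s = ab` solves the constraint `t² = s² + r²`
  -- rationally, so that only a polynomial identity remains. Here `r` may be negative.
  obtain ⟨a, ha, e1⟩ : ∃ a : ℝ, 0 < a ∧ t - r = a ^ 2 :=
    ⟨√(t - r), Real.sqrt_pos.2 h1, (Real.sq_sqrt h1.le).symm⟩
  obtain ⟨b, hb, e2⟩ : ∃ a : ℝ, 0 < a ∧ t + r = a ^ 2 :=
    ⟨√(t + r), Real.sqrt_pos.2 h2, (Real.sq_sqrt h2.le).symm⟩
  have hs' : s = a * b := by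
    have : s ^ 2 = (a * b) ^ 2 := by rw [mul_pow, ← e1, ← e2]; linarith
    exact (sq_eq_sq₀ hs.le (by positivity)).1 this
  have ht' : t = (a ^ 2 + b ^ 2) / 2 := by linarith
  have hr' : r = (b ^ 2 - a ^ 2) / 2 := by linarith
  simp only [dE, dJ, dM, dY, dA, J, M, Y, A, e1, e2]
  subst hs'
  field_simp
  rw [ht', hr']
  ring

end Blocks

/-! ### The divergence identity -/

/-- The spatial divergence of a vector field on `ℝ × ℝ³`. -/
def spDiv (V : Spacetime → Space) (z : Spacetime) : ℝ := ∑ i, dx i (fun z => V z i) z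

/-- The pair `(t - σ r, t + σ r)`, for `σ = ±1`. -/
def nullPair (σ : ℝ) (z : Spacetime) : ℝ × ℝ :=
  (hypTime z - σ * radius z, hypTime z + σ * radius z)

/-- The basic quantities of `U` and the weight `f (t - σ r, t + σ r)` at a point. -/
def blocks (σ : ℝ) (f : ℝ × ℝ → ℝ) (U : Spacetime → ℝ) (z : Spacetime) : Blocks where
  s := z.1
  t := hypTime z
  r := σ * radius z
  u := U z
  v := dt U z
  N := euler U z
  G := ‖grad U z‖ ^ 2
  f := f (nullPair σ z)

/-- The wave operator in hyperboloidal coordinates. -/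
def hypBox (U : Spacetime → ℝ) (z : Spacetime) : ℝ :=
  ∑ i, hess U z (0, EuclideanSpace.single i 1) (0, EuclideanSpace.single i 1) -
    hess U z (1, 0) (1, 0) - 2 / z.1 * hess U z (1, 0) (0, z.2) - 3 / z.1 * dt U z

/-- The flux vector field of the half energy. -/
def halfFlux (σ : ℝ) (f : ℝ × ℝ → ℝ) (U : Spacetime → ℝ) (z : Spacetime) : Space :=
  (blocks σ f U z).J • z.2 - (2 * (blocks σ f U z).M) • grad U z

section

variable {σ : ℝ} {f : ℝ × ℝ → ℝ} {U : Spacetime → ℝ} {z : Spacetime}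

lemma hasVelocity_blocks (hU : ContDiffAt ℝ 2 U z) (hs : 0 < z.1) (hx : z.2 ≠ 0)
    (hf : ContDiffAt ℝ 1 f (nullPair σ z)) (d : Spacetime) :
    Blocks.HasVelocity (fun ε : ℝ => blocks σ f U (z + ε • d))
      ⟨d.1, (z.1 * d.1 + inner ℝ z.2 d.2) / hypTime z, σ * (inner ℝ z.2 d.2 / radius z),
        d.1 * dt U z + inner ℝ (grad U z) d.2, hess U z d (1, 0),
        hess U z d (0, z.2) + inner ℝ (grad U z) d.2, 2 * hess U z d (0, grad U z),
        fderiv ℝ f (nullPair σ z) (1, 0) *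
            ((z.1 * d.1 + inner ℝ z.2 d.2) / hypTime z - σ * (inner ℝ z.2 d.2 / radius z)) +
          fderiv ℝ f (nullPair σ z) (0, 1) *
            ((z.1 * d.1 + inner ℝ z.2 d.2) / hypTime z + σ * (inner ℝ z.2 d.2 / radius z))⟩ := by
  have ht : HasDerivAt (fun ε : ℝ => hypTime (z + ε • d)) _ 0 := hasLineDerivAt_hypTime hs d
  have hr : HasDerivAt (fun ε : ℝ => σ * radius (z + ε • d)) _ 0 :=
    (hasLineDerivAt_radius hx d).const_mul σ
  refine ⟨hasLineDerivAt_fst z d, ht, hr, hasLineDerivAt_self hU d, hasLineDerivAt_dt hU d,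
    hasLineDerivAt_euler hU d, hasLineDerivAt_norm_grad_sq hU d, ?_⟩
  have h1 := (ht.fun_sub hr).prodMk (ht.fun_add hr)
  have h2 : HasFDerivAt f (fderiv ℝ f (nullPair σ z)) (nullPair σ (z + (0 : ℝ) • d)) := by
    simpa using (hf.differentiableAt (by norm_num)).hasFDerivAt
  refine (h2.comp_hasDerivAt (0 : ℝ) h1).congr_deriv ?_
  generalize fderiv ℝ f (nullPair σ z) = L
  have (a b : ℝ) : L (a, b) = L (1, 0) * a + L (0, 1) * b := by
    have e : ((a, b) : ℝ × ℝ) = a • ((1 : ℝ), (0 : ℝ)) + b • ((0 : ℝ), (1 : ℝ)) := by simp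
    rw [e, map_add, map_smul, map_smul, smul_eq_mul, smul_eq_mul]; ring
  exact this _ _

lemma contDiffAt_nullPair (hs : 0 < z.1) (hx : z.2 ≠ 0) : ContDiffAt ℝ 1 (nullPair σ) z :=
  ((contDiffAt_hypTime hs).sub (contDiffAt_const.mul (contDiffAt_radius hx))).prodMk
    ((contDiffAt_hypTime hs).add (contDiffAt_const.mul (contDiffAt_radius hx)))

lemma contDiffAt_blocks (hU : ContDiffAt ℝ 2 U z) (hs : 0 < z.1) (hx : z.2 ≠ 0) (hσ : σ ≠ 0)
    (hf : ContDiffAt ℝ 1 f (nullPair σ z)) :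
    ContDiffAt ℝ 1 (fun z => (blocks σ f U z).E) z ∧
    ContDiffAt ℝ 1 (fun z => (blocks σ f U z).M) z ∧
    ContDiffAt ℝ 1 (fun z => (blocks σ f U z).J) z := by
  have hr : ContDiffAt ℝ 1 (fun z => σ * radius z) z :=
    contDiffAt_const.mul (contDiffAt_radius hx)
  have hr0 : σ * radius z ≠ 0 := mul_ne_zero hσ (norm_ne_zero_iff.2 hx)
  have ht : ContDiffAt ℝ 1 hypTime z := contDiffAt_hypTime hs
  have ht0 : hypTime z ≠ 0 := (hypTime_pos hs).ne'
  have hw : ContDiffAt ℝ 1 (fun z => f (nullPair σ z)) z :=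
    hf.comp z (contDiffAt_nullPair hs hx)
  have hN := contDiffAt_euler hU
  have hu : ContDiffAt ℝ 1 U z := hU.of_le (by norm_num)
  have hY : ContDiffAt ℝ 1 (fun z => (blocks σ f U z).Y) z :=
    (((ht.sub hr).div contDiffAt_fst hs.ne').mul (contDiffAt_dt hU)).add ((hN.add hu).div hr hr0)
  have hA : ContDiffAt ℝ 1 (fun z => (blocks σ f U z).A) z :=
    (contDiffAt_norm_grad_sq hU).sub ((hN.pow 2).div (hr.pow 2) (pow_ne_zero 2 hr0))
  have h2t : ContDiffAt ℝ 1 (fun z => 2 * hypTime z) z := contDiffAt_const.mul ht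
  have h2t0 : 2 * hypTime z ≠ 0 := mul_ne_zero two_ne_zero ht0
  have hM : ContDiffAt ℝ 1 (fun z => (blocks σ f U z).M) z :=
    ((contDiffAt_fst.div h2t h2t0).mul hw).mul hY
  refine ⟨?_, hM, ?_⟩
  · exact (hw.mul (((ht.add hr).mul (hY.pow 2)).add ((ht.sub hr).mul hA))).div h2t h2t0
  · exact (((contDiffAt_fst.div (h2t.mul hr) (mul_ne_zero h2t0 hr0)).mul hw).mul
      (hA.sub (hY.pow 2))).add (((contDiffAt_const.mul hM).mul hN).div (hr.pow 2)
        (pow_ne_zero 2 hr0))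

lemma fderiv_eq_of_hasDerivAt {h : Spacetime → ℝ} (hh : ContDiffAt ℝ 1 h z) {d : Spacetime} {a : ℝ}
    (ha : HasDerivAt (fun ε : ℝ => h (z + ε • d)) a 0) : fderiv ℝ h z d = a :=
  (((hh.differentiableAt (by norm_num)).hasFDerivAt).hasLineDerivAt d).unique ha

/-- The divergence of a field of the form `J x - 2 M ∇U`. -/
lemma spDiv_smul_sub_smul {J M : Spacetime → ℝ} (hU : ContDiffAt ℝ 2 U z)
    (hJ : ContDiffAt ℝ 1 J z) (hM : ContDiffAt ℝ 1 M z) :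
    spDiv (fun z => J z • z.2 - (2 * M z) • grad U z) z =
      3 * J z + fderiv ℝ J z (0, z.2) -
        2 * M z * ∑ i, hess U z (0, EuclideanSpace.single i 1) (0, EuclideanSpace.single i 1) -
        2 * fderiv ℝ M z (0, grad U z) := by
  have key (i : Fin 3) : dx i (fun z => (J z • z.2 - (2 * M z) • grad U z) i) z =
      z.2 i * fderiv ℝ J z (0, EuclideanSpace.single i 1) + J z -
        2 * (M z * hess U z (0, EuclideanSpace.single i 1) (0, EuclideanSpace.single i 1)) -
        2 * (grad U z i * fderiv ℝ M z (0, EuclideanSpace.single i 1)) := by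
    have hx : ContDiffAt ℝ 1 (fun z : Spacetime => z.2 i) z :=
      (contDiffAt_euclidean.1 (contDiffAt_snd (𝕜 := ℝ) (n := 1) (p := z))) i
    have hJ' := ((hJ.differentiableAt (by norm_num)).hasFDerivAt).hasLineDerivAt
      (0, EuclideanSpace.single i 1)
    have hM' := ((hM.differentiableAt (by norm_num)).hasFDerivAt).hasLineDerivAt
      (0, EuclideanSpace.single i 1)
    have hg := hasLineDerivAt_dx i hU (0, EuclideanSpace.single i 1)
    have hxi : HasDerivAt
        (fun ε : ℝ => (z + ε • ((0 : ℝ), (EuclideanSpace.single i 1 : Space))).2 i) 1 0 := by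
      simpa using (hasDerivAt_id (0 : ℝ)).const_add (z.2 i)
    refine fderiv_eq_of_hasDerivAt (h := fun z => J z * z.2 i - 2 * M z * dx i U z)
      ((hJ.mul hx).sub ((contDiffAt_const.mul hM).mul (contDiffAt_dx i hU))) ?_
    refine ((HasDerivAt.fun_mul hJ' hxi).fun_sub
      (HasDerivAt.fun_mul (HasDerivAt.const_mul 2 hM') hg)).congr_deriv ?_
    simp only [zero_smul, add_zero]
    simp only [grad]
    ring
  simp only [spDiv, key]
  rw [clm_apply_zero_mk (fderiv ℝ J z), clm_apply_zero_mk (fderiv ℝ M z)]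
  simp only [Finset.sum_sub_distrib, Finset.sum_add_distrib, ← Finset.mul_sum]
  simp
  ring

/-- The sign `σ` lets the same algebraic identity serve both null directions: for `σ = -1` the
outgoing derivative becomes the incoming one and the arguments `t - r`, `t + r` of the weight change
places. -/
lemma half_divergence_identity (hU : ContDiffAt ℝ 2 U z) (hs : 0 < z.1) (hx : z.2 ≠ 0)
    (hσ : σ ^ 2 = 1) (hf : ContDiffAt ℝ 1 f (nullPair σ z)) :
    fderiv ℝ (fun z => (blocks σ f U z).E) z (1, 0) + spDiv (halfFlux σ f U) z =
      -2 * hypBox U z * (blocks σ f U z).M + z.1 / (2 * hypTime z) *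
        (2 * fderiv ℝ f (nullPair σ z) (1, 0) * (blocks σ f U z).Y ^ 2 +
          (2 * fderiv ℝ f (nullPair σ z) (0, 1) - 2 * f (nullPair σ z) / (σ * radius z)) *
            (blocks σ f U z).A) := by
  have hσ0 : σ ≠ 0 := by rintro rfl; norm_num at hσ
  have hr0 : radius z ≠ 0 := norm_ne_zero_iff.2 hx
  have ht := hypTime_pos hs
  obtain ⟨cE, cM, cJ⟩ := contDiffAt_blocks hU hs hx hσ0 hf
  have hv := hasVelocity_blocks hU hs hx hf
  have e0 (d : Spacetime) : blocks σ f U (z + (0 : ℝ) • d) = blocks σ f U z := by simp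
  -- Only three directions enter: `∂_s` for the density, and `x` and the frozen vector `∇U(z)` for
  -- the divergence of `J x - 2 M ∇U`.
  have dE := fderiv_eq_of_hasDerivAt cE (Blocks.hasDerivAt_E (hv (1, 0))
    (by rw [e0]; exact hs.ne') (by rw [e0]; exact ht.ne')
    (by rw [e0]; exact mul_ne_zero hσ0 hr0))
  have dJ := fderiv_eq_of_hasDerivAt cJ (Blocks.hasDerivAt_J (hv (0, z.2))
    (by rw [e0]; exact hs.ne') (by rw [e0]; exact ht.ne')
    (by rw [e0]; exact mul_ne_zero hσ0 hr0))
  have dM := fderiv_eq_of_hasDerivAt cM (Blocks.hasDerivAt_M (hv (0, grad U z))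
    (by rw [e0]; exact hs.ne') (by rw [e0]; exact ht.ne')
    (by rw [e0]; exact mul_ne_zero hσ0 hr0))
  have hdiv := spDiv_smul_sub_smul hU cJ cM
  change spDiv (halfFlux σ f U) z = _ at hdiv
  rw [hdiv, dE, dJ, dM]
  simp only [e0]
  have key := Blocks.identity (blocks σ f U z) hs
    (by simp only [blocks, hypTime_sq, mul_pow, hσ, one_mul]; rfl)
    (by
      have : |σ| = 1 := by rw [← sq_eq_sq₀ (abs_nonneg _) zero_le_one, sq_abs, hσ, one_pow]
      simp only [blocks, abs_mul, this, one_mul, radius, abs_norm]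
      exact norm_lt_hypTime hs)
    (mul_ne_zero hσ0 hr0) (fderiv ℝ f (nullPair σ z) (1, 0)) (fderiv ℝ f (nullPair σ z) (0, 1))
    (hess U z (1, 0) (1, 0)) (hess U z (1, 0) (0, z.2)) (hess U z (1, 0) (0, grad U z))
    (hess U z (0, z.2) (0, z.2)) (hess U z (0, z.2) (0, grad U z))
    (hess U z (0, grad U z) (0, grad U z))
    (∑ i, hess U z (0, EuclideanSpace.single i 1) (0, EuclideanSpace.single i 1))
  have i1 : inner ℝ (grad U z) z.2 = euler U z := (euler_eq_inner U z).symm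
  have i2 : inner ℝ z.2 (grad U z) = euler U z := by rw [real_inner_comm, i1]
  have i3 : inner ℝ z.2 z.2 = radius z ^ 2 := real_inner_self_eq_norm_sq _
  have i4 : inner ℝ (grad U z) (grad U z) = ‖grad U z‖ ^ 2 := real_inner_self_eq_norm_sq _
  have s1 := hess_symm hU (0, z.2) (1, 0)
  have s2 := hess_symm hU (0, grad U z) (1, 0)
  have s3 := hess_symm hU (0, grad U z) (0, z.2)
  have r1 : radius z ^ 2 / radius z = radius z := by field_simp
  have r2 : σ * (euler U z / radius z) = euler U z / (σ * radius z) := by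
    field_simp; rw [hσ, one_mul]
  have r3 : (σ * radius z) ^ 2 = radius z ^ 2 := by rw [mul_pow, hσ, one_mul]
  simp only [i1, i2, i3, i4, s1, s2, s3, r1, r2, inner_zero_right, mul_one, mul_zero, add_zero,
    zero_add, zero_div, one_mul, zero_mul, sub_zero]
  simp only [blocks, r3] at key ⊢
  simp only [hypBox]
  linear_combination key

end

/-! ### The energy of a pair of null weights -/

/-- The energy density of `U` with weights `f` and `g` in the two null directions. -/
def energyDensity (f g : ℝ × ℝ → ℝ) (U : Spacetime → ℝ) (z : Spacetime) : ℝ :=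
  (blocks 1 f U z).E + (blocks (-1) (fun y => g y.swap) U z).E

/-- The multiplier of `U` with weights `f` and `g` in the two null directions. -/
def multiplier (f g : ℝ × ℝ → ℝ) (U : Spacetime → ℝ) (z : Spacetime) : ℝ :=
  (blocks 1 f U z).M + (blocks (-1) (fun y => g y.swap) U z).M

/-- The energy flux of `U` with weights `f` and `g` in the two null directions. -/
def energyFlux (f g : ℝ × ℝ → ℝ) (U : Spacetime → ℝ) (z : Spacetime) : Space :=
  halfFlux 1 f U z + halfFlux (-1) (fun y => g y.swap) U z

/-- The pair `(t - r, t + r)`. -/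
def nullCoord (z : Spacetime) : ℝ × ℝ := (hypTime z - radius z, hypTime z + radius z)

/-- The weight which bounds the multiplier by the energy density. -/
def sourceWeight (f g : ℝ × ℝ → ℝ) (z : Spacetime) : ℝ :=
  ((nullCoord z).1 * f (nullCoord z) + (nullCoord z).2 * g (nullCoord z)) / (2 * hypTime z)

/-- The null coordinates `(t - r, t + r)` of the points with `t² - r² ≥ 1`. -/
def nullRegion : Set (ℝ × ℝ) := {y | 0 < y.1 ∧ y.1 ≤ y.2 ∧ 1 ≤ y.1 * y.2}

/-- The conditions on the null weights under which the energy is monotone. -/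
structure Admissible (f g : ℝ × ℝ → ℝ) : Prop where
  contDiffAt_fst : ∀ y ∈ nullRegion, ContDiffAt ℝ 1 f y
  contDiffAt_snd : ∀ y ∈ nullRegion, ContDiffAt ℝ 1 g y
  nonneg : ∀ y ∈ nullRegion, 0 ≤ g y
  le : ∀ y ∈ nullRegion, g y ≤ f y
  fst_deriv : ∀ y ∈ nullRegion, fderiv ℝ f y (1, 0) ≤ 0
  snd_deriv : ∀ y ∈ nullRegion, fderiv ℝ g y (0, 1) ≤ 0
  angular : ∀ y ∈ nullRegion,
    (fderiv ℝ f y (0, 1) + fderiv ℝ g y (1, 0)) * (y.2 - y.1) ≤ 2 * (f y - g y)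

lemma nullPair_one (z : Spacetime) : nullPair 1 z = nullCoord z := by simp [nullPair, nullCoord]

lemma nullPair_neg_one (z : Spacetime) : nullPair (-1) z = (nullCoord z).swap := by
  simp [nullPair, nullCoord, sub_eq_add_neg]

lemma nullCoord_mul (z : Spacetime) : (nullCoord z).1 * (nullCoord z).2 = z.1 ^ 2 := by
  simp only [nullCoord]
  have := hypTime_sq z
  simp only [radius]
  linear_combination this

lemma nullCoord_mem {z : Spacetime} (hz : 1 ≤ z.1) : nullCoord z ∈ nullRegion := by
  refine ⟨?_, ?_, ?_⟩
  · have := norm_lt_hypTime (z := z) (by linarith)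
    simp only [nullCoord, radius]; linarith
  · have := norm_nonneg z.2
    simp only [nullCoord, radius]; linarith
  · rw [nullCoord_mul]; nlinarith

section

variable {f g : ℝ × ℝ → ℝ} {U : Spacetime → ℝ} {z : Spacetime}

lemma Admissible.contDiffAt_swap (h : Admissible f g) {y : ℝ × ℝ} (hy : y ∈ nullRegion) :
    ContDiffAt ℝ 1 (fun y => g y.swap) y.swap :=
  (h.contDiffAt_snd y hy).comp y.swap
    (contDiff_snd.prodMk contDiff_fst : ContDiff ℝ 1 fun y : ℝ × ℝ => (y.2, y.1)).contDiffAt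

lemma Admissible.fderiv_swap (h : Admissible f g) {y : ℝ × ℝ} (hy : y ∈ nullRegion) (a b : ℝ) :
    fderiv ℝ (fun y => g y.swap) y.swap (a, b) = fderiv ℝ g y (b, a) := by
  have h1 : HasFDerivAt g (fderiv ℝ g y) (Prod.swap y.swap) :=
    ((h.contDiffAt_snd y hy).differentiableAt (by norm_num)).hasFDerivAt
  have h2 : HasFDerivAt (Prod.swap : ℝ × ℝ → ℝ × ℝ)
      ((ContinuousLinearMap.snd ℝ ℝ ℝ).prod (ContinuousLinearMap.fst ℝ ℝ ℝ)) y.swap :=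
    hasFDerivAt_snd.prodMk hasFDerivAt_fst
  have h3 : HasFDerivAt (fun y => g y.swap) _ y.swap := h1.comp y.swap h2
  rw [h3.fderiv]
  rfl

lemma Admissible.contDiffAt_nullPair_one (h : Admissible f g) (hz : 1 ≤ z.1) :
    ContDiffAt ℝ 1 f (nullPair 1 z) := by
  rw [nullPair_one]; exact h.contDiffAt_fst _ (nullCoord_mem hz)

lemma Admissible.contDiffAt_nullPair_neg_one (h : Admissible f g) (hz : 1 ≤ z.1) :
    ContDiffAt ℝ 1 (fun y => g y.swap) (nullPair (-1) z) := by
  rw [nullPair_neg_one]; exact h.contDiffAt_swap (nullCoord_mem hz)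

lemma energyDensity_eq : energyDensity f g U z =
    f (nullCoord z) * ((hypTime z + radius z) * (blocks 1 f U z).Y ^ 2 +
        (hypTime z - radius z) * (‖grad U z‖ ^ 2 - euler U z ^ 2 / radius z ^ 2)) /
      (2 * hypTime z) +
    g (nullCoord z) * ((hypTime z - radius z) * (blocks (-1) (fun y => g y.swap) U z).Y ^ 2 +
        (hypTime z + radius z) * (‖grad U z‖ ^ 2 - euler U z ^ 2 / radius z ^ 2)) /
      (2 * hypTime z) := by
  simp only [energyDensity, Blocks.E, Blocks.A]
  simp [blocks, nullPair_one, nullPair_neg_one, sub_eq_add_neg]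

lemma multiplier_eq : multiplier f g U z =
    z.1 / (2 * hypTime z) * (f (nullCoord z) * (blocks 1 f U z).Y +
      g (nullCoord z) * (blocks (-1) (fun y => g y.swap) U z).Y) := by
  simp only [multiplier, Blocks.M]
  simp [blocks, nullPair_one, nullPair_neg_one]
  ring

lemma blocks_one_Y : (blocks 1 f U z).Y =
    (hypTime z - radius z) / z.1 * dt U z + (euler U z + U z) / radius z := by
  simp [blocks, Blocks.Y]

lemma blocks_neg_one_Y : (blocks (-1) f U z).Y =
    (hypTime z + radius z) / z.1 * dt U z - (euler U z + U z) / radius z := by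
  simp [blocks, Blocks.Y, div_neg, sub_eq_add_neg]

lemma angular_nonneg (U : Spacetime → ℝ) (z : Spacetime) :
    0 ≤ ‖grad U z‖ ^ 2 - euler U z ^ 2 / radius z ^ 2 := by
  rcases eq_or_ne (radius z) 0 with h | h
  · simp [h]
  · have := euler_sq_le U z
    rw [sub_nonneg, div_le_iff₀ (by positivity)]
    exact this

lemma Admissible.energyDensity_nonneg (h : Admissible f g) (hz : 1 ≤ z.1) :
    0 ≤ energyDensity f g U z := by
  have hy := nullCoord_mem hz
  have hg := h.nonneg _ hy
  have hf := hg.trans (h.le _ hy)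
  have hA := angular_nonneg U z
  have ht := hypTime_pos (z := z) (by linarith)
  have hp : 0 ≤ hypTime z - radius z := hy.1.le
  have hr : 0 ≤ radius z := norm_nonneg _
  rw [energyDensity_eq]
  positivity

lemma Admissible.sourceWeight_nonneg (h : Admissible f g) (hz : 1 ≤ z.1) :
    0 ≤ sourceWeight f g z := by
  have hy := nullCoord_mem hz
  have hg := h.nonneg _ hy
  have hf := hg.trans (h.le _ hy)
  have ht := hypTime_pos (z := z) (by linarith)
  have hp := hy.1
  have hq := hp.trans_le hy.2.1
  unfold sourceWeight
  positivity

/-- This is a weighted Cauchy–Schwarz inequality. Up to the common factor `1/(4t²)`, the difference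
of the two sides is `fg (qY - pZ)² + A (pf + qg)²`. -/
lemma Admissible.multiplier_sq_le (h : Admissible f g) (hz : 1 ≤ z.1) :
    multiplier f g U z ^ 2 ≤ sourceWeight f g z * energyDensity f g U z := by
  have hy := nullCoord_mem hz
  have hg := h.nonneg _ hy
  have hf := hg.trans (h.le _ hy)
  have hA := angular_nonneg U z
  have ht := hypTime_pos (z := z) (by linarith)
  have hp : 0 < hypTime z - radius z := hy.1
  have hq : 0 < hypTime z + radius z := hp.trans_le hy.2.1
  have hpq := nullCoord_mul z
  rw [energyDensity_eq, multiplier_eq, sourceWeight]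
  generalize (blocks 1 f U z).Y = Y, (blocks (-1) (fun y => g y.swap) U z).Y = Z
  generalize ‖grad U z‖ ^ 2 - euler U z ^ 2 / radius z ^ 2 = A at *
  simp only [nullCoord] at *
  generalize hypTime z - radius z = p at *
  generalize hypTime z + radius z = q at *
  generalize f (p, q) = f' at *
  generalize g (p, q) = g' at *
  have hs : (z.1 / (2 * hypTime z) * (f' * Y + g' * Z)) ^ 2 =
      p * q * (f' * Y + g' * Z) ^ 2 / (4 * hypTime z ^ 2) := by
    rw [hpq]; field_simp; ring
  rw [hs]
  have e : (p * f' + q * g') / (2 * hypTime z) * (f' * (q * Y ^ 2 + p * A) / (2 * hypTime z) +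
      g' * (p * Z ^ 2 + q * A) / (2 * hypTime z)) = (p * f' + q * g') *
        (f' * (q * Y ^ 2 + p * A) + g' * (p * Z ^ 2 + q * A)) / (4 * hypTime z ^ 2) := by
    field_simp; ring
  rw [e]
  have key : (p * f' + q * g') * (f' * (q * Y ^ 2 + p * A) + g' * (p * Z ^ 2 + q * A)) -
      p * q * (f' * Y + g' * Z) ^ 2 = f' * g' * (q * Y - p * Z) ^ 2 +
        A * (p * f' + q * g') ^ 2 := by ring
  have : 0 ≤ f' * g' * (q * Y - p * Z) ^ 2 + A * (p * f' + q * g') ^ 2 := by positivity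
  exact div_le_div_of_nonneg_right (by linarith) (by positivity)

lemma Admissible.contDiffAt_energyDensity (h : Admissible f g) (hU : ContDiffAt ℝ 2 U z)
    (hz : 1 ≤ z.1) (hx : z.2 ≠ 0) : ContDiffAt ℝ 1 (energyDensity f g U) z :=
  (contDiffAt_blocks hU (by linarith) hx one_ne_zero (h.contDiffAt_nullPair_one hz)).1.add
    (contDiffAt_blocks hU (by linarith) hx (neg_ne_zero.2 one_ne_zero)
      (h.contDiffAt_nullPair_neg_one hz)).1

lemma contDiffAt_halfFlux {σ : ℝ} (hU : ContDiffAt ℝ 2 U z) (hs : 0 < z.1) (hx : z.2 ≠ 0)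
    (hσ : σ ≠ 0) (hf : ContDiffAt ℝ 1 f (nullPair σ z)) :
    ContDiffAt ℝ 1 (halfFlux σ f U) z := by
  obtain ⟨-, cM, cJ⟩ := contDiffAt_blocks hU hs hx hσ hf
  exact (cJ.smul contDiffAt_snd).sub ((contDiffAt_const.mul cM).smul (contDiffAt_grad hU))

lemma Admissible.contDiffAt_energyFlux (h : Admissible f g) (hU : ContDiffAt ℝ 2 U z)
    (hz : 1 ≤ z.1) (hx : z.2 ≠ 0) : ContDiffAt ℝ 1 (energyFlux f g U) z :=
  (contDiffAt_halfFlux hU (by linarith) hx one_ne_zero (h.contDiffAt_nullPair_one hz)).add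
    (contDiffAt_halfFlux hU (by linarith) hx (neg_ne_zero.2 one_ne_zero)
      (h.contDiffAt_nullPair_neg_one hz))

lemma contDiffAt_apply {V : Spacetime → Space} (hV : ContDiffAt ℝ 1 V z) (i : Fin 3) :
    ContDiffAt ℝ 1 (fun z => V z i) z := contDiffAt_euclidean.1 hV i

lemma spDiv_add {V W : Spacetime → Space} (hV : ContDiffAt ℝ 1 V z) (hW : ContDiffAt ℝ 1 W z) :
    spDiv (fun z => V z + W z) z = spDiv V z + spDiv W z := by
  simp only [spDiv, ← Finset.sum_add_distrib]
  refine Finset.sum_congr rfl fun i _ => ?_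
  have := fderiv_fun_add ((contDiffAt_apply hV i).differentiableAt (by norm_num))
    ((contDiffAt_apply hW i).differentiableAt (by norm_num))
  simp only [dx]
  exact DFunLike.congr_fun this _

/-- The energy inequality in divergence form. -/
lemma Admissible.fderiv_add_spDiv_le (h : Admissible f g) (hU : ContDiffAt ℝ 2 U z)
    (hz : 1 ≤ z.1) (hx : z.2 ≠ 0) :
    fderiv ℝ (energyDensity f g U) z (1, 0) + spDiv (energyFlux f g U) z ≤
      -2 * hypBox U z * multiplier f g U z := by
  have hs : 0 < z.1 := by linarith
  have hr : 0 < radius z := norm_pos_iff.2 hx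
  have hy := nullCoord_mem hz
  have c1 := h.contDiffAt_nullPair_one hz
  have c2 := h.contDiffAt_nullPair_neg_one hz
  have i1 := half_divergence_identity hU hs hx (by norm_num) c1
  have i2 := half_divergence_identity hU hs hx (by norm_num) c2
  have e1 : fderiv ℝ (energyDensity f g U) z (1, 0) =
      fderiv ℝ (fun z => (blocks 1 f U z).E) z (1, 0) +
        fderiv ℝ (fun z => (blocks (-1) (fun y => g y.swap) U z).E) z (1, 0) := by
    have := fderiv_fun_add
      ((contDiffAt_blocks hU hs hx one_ne_zero c1).1.differentiableAt (by norm_num))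
      ((contDiffAt_blocks hU hs hx (neg_ne_zero.2 one_ne_zero) c2).1.differentiableAt
        (by norm_num))
    exact DFunLike.congr_fun this _
  have e2 : spDiv (energyFlux f g U) z = _ := spDiv_add
    (contDiffAt_halfFlux hU hs hx one_ne_zero c1)
    (contDiffAt_halfFlux hU hs hx (neg_ne_zero.2 one_ne_zero) c2)
  rw [e1, e2]
  have hA1 : (blocks 1 f U z).A = ‖grad U z‖ ^ 2 - euler U z ^ 2 / radius z ^ 2 := by
    simp [blocks, Blocks.A]
  have hA2 : (blocks (-1) (fun y => g y.swap) U z).A =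
      ‖grad U z‖ ^ 2 - euler U z ^ 2 / radius z ^ 2 := by
    simp [blocks, Blocks.A]
  have hA := angular_nonneg U z
  rw [nullPair_neg_one, h.fderiv_swap hy, h.fderiv_swap hy, hA2] at i2
  rw [nullPair_one, hA1] at i1
  simp only [Prod.swap_swap] at i2
  generalize ‖grad U z‖ ^ 2 - euler U z ^ 2 / radius z ^ 2 = A at *
  have b1 := h.fst_deriv _ hy
  have b2 := h.snd_deriv _ hy
  have b3 := h.angular _ hy
  have b4 : (nullCoord z).2 - (nullCoord z).1 = 2 * radius z := by simp [nullCoord]; ring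
  rw [b4] at b3
  -- The two halves contribute separate angular terms. Since `q - p = 2r`, the angular condition
  -- says precisely that the sum of their coefficients is nonpositive.
  have b5 : 2 * fderiv ℝ f (nullCoord z) (0, 1) - 2 * f (nullCoord z) / (1 * radius z) +
      (2 * fderiv ℝ g (nullCoord z) (1, 0) - 2 * g (nullCoord z) / (-1 * radius z)) ≤ 0 := by
    have : 2 * fderiv ℝ f (nullCoord z) (0, 1) - 2 * f (nullCoord z) / (1 * radius z) +
      (2 * fderiv ℝ g (nullCoord z) (1, 0) - 2 * g (nullCoord z) / (-1 * radius z)) =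
      ((fderiv ℝ f (nullCoord z) (0, 1) + fderiv ℝ g (nullCoord z) (1, 0)) * (2 * radius z) -
        2 * (f (nullCoord z) - g (nullCoord z))) / radius z := by
      field_simp; ring
    rw [this]
    exact div_nonpos_of_nonpos_of_nonneg (by linarith) hr.le
  have ht := hypTime_pos hs
  have k0 : 0 < z.1 / (2 * hypTime z) := by positivity
  have k1 := mul_nonpos_of_nonpos_of_nonneg b1 (sq_nonneg (blocks 1 f U z).Y)
  have k2 := mul_nonpos_of_nonpos_of_nonneg b2
    (sq_nonneg (blocks (-1) (fun y => g y.swap) U z).Y)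
  have k3 := mul_nonpos_of_nonpos_of_nonneg b5 hA
  have k4 := mul_nonpos_of_nonneg_of_nonpos k0.le
    (show 2 * (fderiv ℝ f (nullCoord z) (1, 0) * (blocks 1 f U z).Y ^ 2) +
      2 * (fderiv ℝ g (nullCoord z) (0, 1) *
        (blocks (-1) (fun y => g y.swap) U z).Y ^ 2) +
      (2 * fderiv ℝ f (nullCoord z) (0, 1) - 2 * f (nullCoord z) / (1 * radius z) +
      (2 * fderiv ℝ g (nullCoord z) (1, 0) - 2 * g (nullCoord z) / (-1 * radius z))) * A ≤ 0
      by linarith)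
  simp only [multiplier]
  linarith

/-- The radial component of the flux is bounded above near the axis. -/
lemma Admissible.inner_energyFlux_le (h : Admissible f g) (hz : 1 ≤ z.1) (hx : z.2 ≠ 0) :
    inner ℝ z.2 (energyFlux f g U z) ≤
      z.1 * radius z * f (nullCoord z) * ‖grad U z‖ ^ 2 / (2 * hypTime z) +
        g (nullCoord z) * dt U z *
          (2 * radius z ^ 2 / z.1 * dt U z - 2 * (euler U z + U z)) := by
  have hs : 0 < z.1 := by linarith
  have hr : 0 < radius z := norm_pos_iff.2 hx
  have ht := hypTime_pos hs
  have hy := nullCoord_mem hz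
  have hg := h.nonneg _ hy
  have hfg := h.le _ hy
  have hf := hg.trans hfg
  -- Taking the inner product with `x` turns the gradient part of the flux into a multiple of
  -- `x·∇U`. What is left is the difference of the angular and null squares, multiplied by `σ r`.
  have half (σ : ℝ) (w : ℝ × ℝ → ℝ) (hσ : σ ^ 2 = 1) : inner ℝ z.2 (halfFlux σ w U z) =
      z.1 * (σ * radius z) / (2 * hypTime z) * (w (nullPair σ z) *
        (‖grad U z‖ ^ 2 - euler U z ^ 2 / radius z ^ 2 - (blocks σ w U z).Y ^ 2)) := by
    have i3 : inner ℝ z.2 z.2 = radius z ^ 2 := real_inner_self_eq_norm_sq _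
    have hσ0 : σ ≠ 0 := by rintro rfl; norm_num at hσ
    have eA : (blocks σ w U z).A = ‖grad U z‖ ^ 2 - euler U z ^ 2 / radius z ^ 2 := by
      simp [blocks, Blocks.A, mul_pow, hσ]
    rw [halfFlux, inner_sub_right, inner_smul_right, inner_smul_right, i3, real_inner_comm,
      ← euler_eq_inner, Blocks.J, eA]
    generalize (blocks σ w U z).Y = Y, (blocks σ w U z).M = M,
      ‖grad U z‖ ^ 2 - euler U z ^ 2 / radius z ^ 2 = A
    simp only [blocks, mul_pow, hσ]
    field_simp
    rw [hσ]
    ring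
  rw [energyFlux, inner_add_right, half 1 f (by norm_num), half (-1) _ (by norm_num),
    nullPair_one, nullPair_neg_one, blocks_one_Y, blocks_neg_one_Y]
  have hA : ‖grad U z‖ ^ 2 - euler U z ^ 2 / radius z ^ 2 ≤ ‖grad U z‖ ^ 2 :=
    sub_le_self _ (by positivity)
  have hA0 := angular_nonneg U z
  generalize ‖grad U z‖ ^ 2 - euler U z ^ 2 / radius z ^ 2 = A at *
  simp only [Prod.swap_swap]
  generalize f (nullCoord z) = f' at *
  generalize g (nullCoord z) = g' at *
  have hm : (f' - g') * A ≤ f' * ‖grad U z‖ ^ 2 :=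
    mul_le_mul (by linarith) hA hA0 hf
  have hY : 0 ≤ (f' - g') * ((hypTime z - radius z) / z.1 * dt U z +
      (euler U z + U z) / radius z) ^ 2 := mul_nonneg (by linarith) (sq_nonneg _)
  -- Write `-fY² + gZ² = -(f - g)Y² + g(Z² - Y²)`. The first term has a good sign and is dropped. In
  -- `Z² - Y² = (Z - Y)(Z + Y)` the square of `(x·∇U + U)/r` cancels, and the factor `r` in front
  -- removes the remaining pole.
  have e : z.1 * radius z * f' * ‖grad U z‖ ^ 2 / (2 * hypTime z) +
        g' * dt U z * (2 * radius z ^ 2 / z.1 * dt U z - 2 * (euler U z + U z)) -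
      (z.1 * (1 * radius z) / (2 * hypTime z) * (f' * (A - ((hypTime z - radius z) / z.1 * dt U z +
        (euler U z + U z) / radius z) ^ 2)) + z.1 * (-1 * radius z) / (2 * hypTime z) *
        (g' * (A - ((hypTime z + radius z) / z.1 * dt U z -
        (euler U z + U z) / radius z) ^ 2))) =
      z.1 * radius z / (2 * hypTime z) * ((f' * ‖grad U z‖ ^ 2 - (f' - g') * A) +
        (f' - g') * ((hypTime z - radius z) / z.1 * dt U z +
          (euler U z + U z) / radius z) ^ 2) := by
    field_simp
    ring
  have : 0 ≤ z.1 * radius z / (2 * hypTime z) * ((f' * ‖grad U z‖ ^ 2 - (f' - g') * A) +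
        (f' - g') * ((hypTime z - radius z) / z.1 * dt U z +
          (euler U z + U z) / radius z) ^ 2) :=
    mul_nonneg (by positivity) (by linarith)
  linarith

end

/-! ### Integrals over the hyperboloids -/

lemma hasFDerivAt_slice {h : Spacetime → ℝ} {s : ℝ} {x : Space} (hc : ContDiffAt ℝ 1 h (s, x)) :
    HasFDerivAt (fun x => h (s, x)) ((fderiv ℝ h (s, x)).comp (ContinuousLinearMap.inr ℝ ℝ Space))
      x :=
  ((hc.differentiableAt (by norm_num)).hasFDerivAt).comp x (hasFDerivAt_prodMk_right s x)

lemma contDiff_slice {E : Type*} [NormedAddCommGroup E] [NormedSpace ℝ E] {h : Spacetime → E}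
    {s : ℝ} {n : WithTop ℕ∞} (hc : ∀ x, ContDiffAt ℝ n h (s, x)) :
    ContDiff ℝ n (fun x => h (s, x)) :=
  contDiff_iff_contDiffAt.2 fun x => (hc x).comp x (contDiffAt_const.prodMk contDiffAt_id)

lemma integrable_dx_and_integral_eq_zero {h : Spacetime → ℝ} {s : ℝ} (hc : ∀ x, ContDiffAt ℝ 1 h (s, x))
    {K : Set Space} (hK : IsCompact K) (hK0 : ∀ x ∉ K, h (s, x) = 0) (i : Fin 3) :
    Integrable (fun x : Space => dx i h (s, x)) ∧ ∫ x : Space, dx i h (s, x) = 0 := by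
  have hg : ContDiff ℝ 1 (fun x => h (s, x)) := contDiff_slice hc
  have hcs : HasCompactSupport (fun x => h (s, x)) := HasCompactSupport.intro hK hK0
  have e (x : Space) : dx i h (s, x) =
      fderiv ℝ (fun x => h (s, x)) x (EuclideanSpace.single i 1) := by
    rw [(hasFDerivAt_slice (hc x)).fderiv]; rfl
  simp only [e]
  have hi : Integrable (fun x => fderiv ℝ (fun x => h (s, x)) x (EuclideanSpace.single i 1)) :=
    ((hg.continuous_fderiv one_ne_zero).clm_apply continuous_const).integrable_of_hasCompactSupport
      (hcs.fderiv_apply ℝ _)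
  refine ⟨hi, ?_⟩
  -- Integration by parts against the constant function `1`.
  have := integral_mul_fderiv_eq_neg_fderiv_mul_of_integrable (μ := (volume : Measure Space))
    (f := fun _ => (1 : ℝ)) (g := fun x => h (s, x)) (v := EuclideanSpace.single i 1)
    (by simp)
    (by simpa only [one_mul] using hi)
    (by simpa using hg.continuous.integrable_of_hasCompactSupport hcs)
    (fun x _ => by fun_prop) (fun x _ => hg.differentiable one_ne_zero x)
  simpa using this

lemma integral_mul_le_sqrt_mul_sqrt {f g : Space → ℝ} (hf : Continuous f) (hg : Continuous g)
    (hfc : HasCompactSupport f) (hgc : HasCompactSupport g) (hf0 : ∀ x, 0 ≤ f x)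
    (hg0 : ∀ x, 0 ≤ g x) :
    ∫ x, f x * g x ≤ √(∫ x, f x ^ 2) * √(∫ x, g x ^ 2) := by
  have := integral_mul_le_Lp_mul_Lq_of_nonneg (μ := (volume : Measure Space))
    Real.HolderConjugate.two_two (f := f) (g := g) (.of_forall hf0) (.of_forall hg0)
    (hf.memLp_of_hasCompactSupport hfc) (hg.memLp_of_hasCompactSupport hgc)
  simpa [Real.sqrt_eq_rpow] using this

lemma continuousOn_slice {h : Spacetime → ℝ} {s₀ s₁ s : ℝ} (hs : s ∈ Icc s₀ s₁)
    (hc : ContinuousOn h (Icc s₀ s₁ ×ˢ univ)) : Continuous fun x => h (s, x) :=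
  continuousOn_univ.1 (hc.comp (Continuous.continuousOn (by fun_prop)) fun x _ => ⟨hs, trivial⟩)

lemma continuousOn_integral {h : Spacetime → ℝ} {s₀ s₁ : ℝ}
    (hc : ContinuousOn h (Icc s₀ s₁ ×ˢ univ)) {K : Set Space} (hK : IsCompact K)
    (hK0 : ∀ s ∈ Icc s₀ s₁, ∀ x ∉ K, h (s, x) = 0) :
    ContinuousOn (fun s => ∫ x, h (s, x)) (Icc s₀ s₁) :=
  continuousOn_integral_of_compact_support hK hc fun s x hs hx => hK0 s hs x hx

lemma exists_bound {h : Spacetime → ℝ} {s₀ s₁ : ℝ}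
    (hc : ContinuousOn h (Icc s₀ s₁ ×ˢ univ)) {K : Set Space} (hK : IsCompact K)
    (hK0 : ∀ s ∈ Icc s₀ s₁, ∀ x ∉ K, h (s, x) = 0) :
    ∃ C, 0 ≤ C ∧ ∀ s ∈ Icc s₀ s₁, ∀ x, |h (s, x)| ≤ C := by
  obtain ⟨C, hC⟩ := (isCompact_Icc.prod hK).exists_bound_of_continuousOn
    (hc.mono (prod_mono_right (subset_univ K)))
  refine ⟨max C 0, le_max_right _ _, fun s hs x => ?_⟩
  by_cases hx : x ∈ K
  · exact (hC (s, x) ⟨hs, hx⟩).trans (le_max_left _ _)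
  · rw [hK0 s hs x hx, abs_zero]; exact le_max_right _ _

lemma hasDerivAt_integral {h : Spacetime → ℝ} {s₀ s₁ : ℝ}
    (hc : ∀ z ∈ Icc s₀ s₁ ×ˢ (univ : Set Space), ContDiffAt ℝ 1 h z) {K : Set Space}
    (hK : IsCompact K) (hK0 : ∀ s ∈ Icc s₀ s₁, ∀ x ∉ K, h (s, x) = 0) {s : ℝ}
    (hs : s ∈ Ioo s₀ s₁) :
    HasDerivAt (fun s => ∫ x, h (s, x)) (∫ x, fderiv ℝ h (s, x) (1, 0)) s := by
  have hI : Ioo s₀ s₁ ∈ nhds s := isOpen_Ioo.mem_nhds hs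
  have hcont : ContinuousOn h (Icc s₀ s₁ ×ˢ univ) := fun z hz =>
    (hc z hz).continuousAt.continuousWithinAt
  have hcd : ContinuousOn (fun z => fderiv ℝ h z (1, 0)) (Icc s₀ s₁ ×ˢ univ) := fun z hz =>
    (((hc z hz).fderiv_right (m := 0) (by norm_num)).continuousAt.clm_apply
      continuousAt_const).continuousWithinAt
  have hd (t : ℝ) (ht : t ∈ Ioo s₀ s₁) (x : Space) :
      HasDerivAt (fun t => h (t, x)) (fderiv ℝ h (t, x) (1, 0)) t := by
    have h1 := ((hc (t, x) ⟨Ioo_subset_Icc_self ht, trivial⟩).differentiableAt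
      (by norm_num)).hasFDerivAt
    exact h1.comp_hasDerivAt t ((hasDerivAt_id t).prodMk (hasDerivAt_const t x))
  -- Outside `K` the function is identically zero in `t`, hence so is its derivative. The constant
  -- `C` on `K` is therefore a dominating function.
  have hd0 (t : ℝ) (ht : t ∈ Ioo s₀ s₁) (x : Space) (hx : x ∉ K) :
      fderiv ℝ h (t, x) (1, 0) = 0 := by
    refine (hd t ht x).unique ?_
    refine (hasDerivAt_const t (0 : ℝ)).congr_of_eventuallyEq ?_
    filter_upwards [isOpen_Ioo.mem_nhds ht] with t' ht'
    exact hK0 t' (Ioo_subset_Icc_self ht') x hx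
  obtain ⟨C, hC⟩ := (isCompact_Icc.prod hK).exists_bound_of_continuousOn
    (hcd.mono (prod_mono_right (subset_univ K)))
  refine (hasDerivAt_integral_of_dominated_loc_of_deriv_le (μ := (volume : Measure Space))
    (F := fun s x => h (s, x)) (F' := fun s x => fderiv ℝ h (s, x) (1, 0)) (s := Ioo s₀ s₁)
    (bound := K.indicator fun _ => C) hI ?_ ?_ ?_ ?_ ?_ ?_).2
  · filter_upwards [hI] with t ht
    exact (continuousOn_slice (Ioo_subset_Icc_self ht) hcont).aestronglyMeasurable
  · exact (continuousOn_slice (Ioo_subset_Icc_self hs) hcont).integrable_of_hasCompactSupport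
      (HasCompactSupport.intro hK (hK0 s (Ioo_subset_Icc_self hs)))
  · exact (continuousOn_slice (Ioo_subset_Icc_self hs) hcd).aestronglyMeasurable
  · refine .of_forall fun x t ht => ?_
    by_cases hx : x ∈ K
    · simpa [hx] using hC (t, x) ⟨Ioo_subset_Icc_self ht, hx⟩
    · simp [hx, hd0 t ht x hx]
  · exact (integrable_indicator_iff hK.measurableSet).2 (integrableOn_const hK.measure_ne_top)
  · exact .of_forall fun x t ht => hd t ht x

/-- A Grönwall type inequality for the square root of an energy. -/
lemma sqrt_energy_growth {E N : ℝ → ℝ} {E' : ℝ → ℝ} {s₀ s₁ η : ℝ} (hE : ContinuousOn E (Icc s₀ s₁))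
    (hN : ContinuousOn N (Icc s₀ s₁)) (hE' : ∀ s ∈ Ioo s₀ s₁, HasDerivAt E (E' s) s)
    (hE0 : ∀ s ∈ Icc s₀ s₁, 0 ≤ E s) (hN0 : ∀ s ∈ Icc s₀ s₁, 0 ≤ N s) (hη : 0 ≤ η)
    (hle : ∀ s ∈ Ioo s₀ s₁, E' s ≤ 2 * N s * √(E s) + η) (h01 : s₀ ≤ s₁) :
    √(E s₁) ≤ √(E s₀) + √(η * (s₁ - s₀)) + 2 * ∫ s in s₀..s₁, N s := by
  -- The differential inequality is integrated only up to a maximum point `m` of `E`, where `√E`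
  -- under the integral is replaced by `√(E m)`. This avoids dividing by `√E`, which may vanish.
  obtain ⟨m, hm, hmax⟩ := isCompact_Icc.exists_isMaxOn (nonempty_Icc.2 h01) hE
  have hmax' : ∀ s ∈ Icc s₀ s₁, E s ≤ E m := hmax
  have hNm : ContinuousOn N (Icc s₀ m) := hN.mono (Icc_subset_Icc_right hm.2)
  have hint : IntervalIntegrable N volume s₀ m :=
    ContinuousOn.intervalIntegrable_of_Icc hm.1 hNm
  have h1 := intervalIntegral.sub_le_integral_of_hasDeriv_right_of_le (g := E) (g' := E')
    (φ := fun s => 2 * √(E m) * N s + η) hm.1 (hE.mono (Icc_subset_Icc_right hm.2))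
    (fun s hs => (hE' s ⟨hs.1, hs.2.trans_le hm.2⟩).hasDerivWithinAt)
    ((continuousOn_const.mul hNm).add continuousOn_const).integrableOn_Icc
    (fun s hs => by
      have hs' : s ∈ Ioo s₀ s₁ := ⟨hs.1, hs.2.trans_le hm.2⟩
      have := Real.sqrt_le_sqrt (hmax' s (Ioo_subset_Icc_self hs'))
      have h2 := mul_le_mul_of_nonneg_left this
        (mul_nonneg zero_le_two (hN0 s (Ioo_subset_Icc_self hs')))
      linarith [hle s hs'])
  rw [intervalIntegral.integral_add (hint.const_mul _) intervalIntegrable_const,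
    intervalIntegral.integral_const_mul, intervalIntegral.integral_const] at h1
  have h2 : ∫ s in s₀..m, N s ≤ ∫ s in s₀..s₁, N s := by
    refine intervalIntegral.integral_mono_interval le_rfl hm.1 hm.2 ?_
      (ContinuousOn.intervalIntegrable_of_Icc h01 hN)
    filter_upwards [ae_restrict_mem measurableSet_Ioc] with s hs
    exact hN0 s (Ioc_subset_Icc_self hs)
  have h3 : 0 ≤ ∫ s in s₀..m, N s := intervalIntegral.integral_nonneg hm.1 fun s hs =>
    hN0 s ⟨hs.1, hs.2.trans hm.2⟩
  have h4 : √(E s₁) ≤ √(E m) := Real.sqrt_le_sqrt (hmax' s₁ (right_mem_Icc.2 h01))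
  have h5 : (m - s₀) • η ≤ η * (s₁ - s₀) := by
    rw [smul_eq_mul, mul_comm]
    exact mul_le_mul_of_nonneg_left (by linarith [hm.2]) hη
  have e0 := Real.sq_sqrt (hE0 s₀ (left_mem_Icc.2 h01))
  have e1 := Real.sq_sqrt (hE0 m hm)
  have e2 := Real.sq_sqrt (mul_nonneg hη (sub_nonneg.2 h01))
  have p0 := Real.sqrt_nonneg (E s₀)
  have p1 := Real.sqrt_nonneg (E m)
  have p2 := Real.sqrt_nonneg (η * (s₁ - s₀))
  set I := ∫ s in s₀..m, N s
  -- The inequality `X² ≤ A² + B² + 2 I X`, with nonnegative `A`, `B`, `I`, `X`, forces `X ≤ A + B +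
  -- 2 I`.
  have h6 : √(E m) ≤ √(E s₀) + √(η * (s₁ - s₀)) + 2 * I := by
    by_contra hcon
    push Not at hcon
    nlinarith [mul_nonneg p0 p2, mul_nonneg p1 h3]
  linarith

/-! ### The radial cut-off -/

/-- A smooth radial function which vanishes for `l |x|² ≤ 1` and is `1` for `l |x|² ≥ 2`. -/
def cutoff (l : ℝ) (x : Space) : ℝ := Real.smoothTransition (l * ‖x‖ ^ 2 - 1)

lemma cutoff_nonneg (l : ℝ) (x : Space) : 0 ≤ cutoff l x := Real.smoothTransition.nonneg _

lemma cutoff_le_one (l : ℝ) (x : Space) : cutoff l x ≤ 1 := Real.smoothTransition.le_one _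

lemma contDiff_cutoff (l : ℝ) {n : ℕ∞} : ContDiff ℝ n (cutoff l) :=
  Real.smoothTransition.contDiff.comp
    ((contDiff_const.mul (contDiff_norm_sq ℝ)).sub contDiff_const)

lemma cutoff_eq_zero {l : ℝ} {x : Space} (h : l * ‖x‖ ^ 2 ≤ 1) : cutoff l x = 0 :=
  Real.smoothTransition.zero_of_nonpos (by linarith)

lemma cutoff_eq_one {l : ℝ} {x : Space} (h : 2 ≤ l * ‖x‖ ^ 2) : cutoff l x = 1 :=
  Real.smoothTransition.one_of_one_le (by linarith)

lemma eventually_cutoff_eq_zero (l : ℝ) : ∀ᶠ x in nhds (0 : Space), cutoff l x = 0 := by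
  have : ∀ᶠ x in nhds (0 : Space), l * ‖x‖ ^ 2 < 1 :=
    ContinuousAt.eventually_lt (by fun_prop) continuousAt_const (by simp)
  filter_upwards [this] with x hx using cutoff_eq_zero hx.le

lemma deriv_smoothTransition_eq_zero {y : ℝ} (hy : y ∉ Icc (0 : ℝ) 1) :
    deriv Real.smoothTransition y = 0 := by
  simp only [mem_Icc, not_and_or, not_le] at hy
  rcases hy with h | h
  · have : Real.smoothTransition =ᶠ[nhds y] fun _ => 0 := by
      filter_upwards [isOpen_Iio.mem_nhds h] with w hw
      exact Real.smoothTransition.zero_of_nonpos (le_of_lt hw)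
    rw [this.deriv_eq]; simp
  · have : Real.smoothTransition =ᶠ[nhds y] fun _ => 1 := by
      filter_upwards [isOpen_Ioi.mem_nhds h] with w hw
      exact Real.smoothTransition.one_of_one_le (le_of_lt hw)
    rw [this.deriv_eq]; simp

lemma exists_deriv_smoothTransition_le :
    ∃ C, 0 ≤ C ∧ ∀ y, |deriv Real.smoothTransition y| ≤ C := by
  have hc : Continuous (deriv Real.smoothTransition) :=
    (Real.smoothTransition.contDiff (n := 1)).continuous_deriv le_rfl
  obtain ⟨C, hC⟩ := (isCompact_Icc (a := (0 : ℝ)) (b := 1)).exists_bound_of_continuousOn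
    hc.continuousOn
  refine ⟨max C 0, le_max_right _ _, fun y => ?_⟩
  by_cases hy : y ∈ Icc (0 : ℝ) 1
  · exact (hC y hy).trans (le_max_left _ _)
  · rw [deriv_smoothTransition_eq_zero hy, abs_zero]; exact le_max_right _ _

lemma deriv_smoothTransition_nonneg (y : ℝ) : 0 ≤ deriv Real.smoothTransition y :=
  Real.smoothTransition.monotone.deriv_nonneg

lemma hasFDerivAt_cutoff (l : ℝ) (x : Space) :
    HasFDerivAt (cutoff l)
      ((deriv Real.smoothTransition (l * ‖x‖ ^ 2 - 1) * (2 * l)) • innerSL ℝ x) x := by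
  have h1 : HasFDerivAt (fun x : Space => l * ‖x‖ ^ 2 - 1) ((2 * l) • innerSL ℝ x) x := by
    have := (((hasFDerivAt_id x).norm_sq).const_mul l).sub_const 1
    refine this.congr_fderiv ?_
    ext y
    simp
    ring
  have h2 : HasDerivAt Real.smoothTransition _ (l * ‖x‖ ^ 2 - 1) :=
    (Real.smoothTransition.contDiff (n := 1)).differentiable one_ne_zero _ |>.hasDerivAt
  refine (h2.comp_hasFDerivAt x h1).congr_fderiv ?_
  rw [smul_smul]

/-! ### The energy estimate -/

/-- Functions which are `C²` on the slab `s₀ ≤ s ≤ s₁` and supported in `|x| ∈ K`. -/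
structure Regular (U : Spacetime → ℝ) (s₀ s₁ : ℝ) (K : Set Space) : Prop where
  one_le : 1 ≤ s₀
  isCompact : IsCompact K
  contDiffAt : ∀ s ∈ Icc s₀ s₁, ∀ x, ContDiffAt ℝ 2 U (s, x)
  eq_zero : ∀ s ∈ Icc s₀ s₁, ∀ x ∉ K, U (s, x) = 0
  fderiv_eq_zero : ∀ s ∈ Icc s₀ s₁, ∀ x ∉ K, fderiv ℝ U (s, x) = 0
  hess_eq_zero : ∀ s ∈ Icc s₀ s₁, ∀ x ∉ K, hess U (s, x) = 0

lemma Regular.mono {U : Spacetime → ℝ} {s₀ s₁ s₁' : ℝ} {K : Set Space} (h : Regular U s₀ s₁ K)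
    (hs : s₁' ≤ s₁) : Regular U s₀ s₁' K where
  one_le := h.one_le
  isCompact := h.isCompact
  contDiffAt := fun s hs' => h.contDiffAt s ⟨hs'.1, hs'.2.trans hs⟩
  eq_zero := fun s hs' => h.eq_zero s ⟨hs'.1, hs'.2.trans hs⟩
  fderiv_eq_zero := fun s hs' => h.fderiv_eq_zero s ⟨hs'.1, hs'.2.trans hs⟩
  hess_eq_zero := fun s hs' => h.hess_eq_zero s ⟨hs'.1, hs'.2.trans hs⟩

section

variable {f g : ℝ × ℝ → ℝ} {U : Spacetime → ℝ} {s₀ s₁ s : ℝ} {K : Set Space}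

lemma Regular.one_le' (h : Regular U s₀ s₁ K) (hs : s ∈ Icc s₀ s₁) : 1 ≤ s :=
  h.one_le.trans hs.1

lemma Regular.dt_eq_zero (h : Regular U s₀ s₁ K) (hs : s ∈ Icc s₀ s₁) {x : Space} (hx : x ∉ K) :
    dt U (s, x) = 0 := by simp [dt, h.fderiv_eq_zero s hs x hx]

lemma Regular.euler_eq_zero (h : Regular U s₀ s₁ K) (hs : s ∈ Icc s₀ s₁) {x : Space}
    (hx : x ∉ K) : euler U (s, x) = 0 := by simp [euler, h.fderiv_eq_zero s hs x hx]

lemma Regular.grad_eq_zero (h : Regular U s₀ s₁ K) (hs : s ∈ Icc s₀ s₁) {x : Space}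
    (hx : x ∉ K) : grad U (s, x) = 0 := by
  ext i
  simp [grad, dx, h.fderiv_eq_zero s hs x hx]

lemma Regular.blocks_eq_zero (h : Regular U s₀ s₁ K) (hs : s ∈ Icc s₀ s₁) {x : Space}
    (hx : x ∉ K) (σ : ℝ) : (blocks σ f U (s, x)).Y = 0 ∧ (blocks σ f U (s, x)).A = 0 := by
  simp [blocks, Blocks.Y, Blocks.A, h.dt_eq_zero hs hx, h.euler_eq_zero hs hx,
    h.grad_eq_zero hs hx, h.eq_zero s hs x hx]

lemma Regular.energyDensity_eq_zero (h : Regular U s₀ s₁ K) (hs : s ∈ Icc s₀ s₁) {x : Space}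
    (hx : x ∉ K) : energyDensity f g U (s, x) = 0 := by
  simp [energyDensity, Blocks.E, h.blocks_eq_zero hs hx]

lemma Regular.energyFlux_eq_zero (h : Regular U s₀ s₁ K) (hs : s ∈ Icc s₀ s₁) {x : Space}
    (hx : x ∉ K) : energyFlux f g U (s, x) = 0 := by
  simp [energyFlux, halfFlux, Blocks.J, Blocks.M, h.blocks_eq_zero hs hx, h.grad_eq_zero hs hx]

lemma Regular.hypBox_eq_zero (h : Regular U s₀ s₁ K) (hs : s ∈ Icc s₀ s₁) {x : Space}
    (hx : x ∉ K) : hypBox U (s, x) = 0 := by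
  simp [hypBox, h.hess_eq_zero s hs x hx, h.dt_eq_zero hs hx]

lemma continuousAt_hypBox {z : Spacetime} (hU : ContDiffAt ℝ 2 U z) (hz : z.1 ≠ 0) :
    ContinuousAt (hypBox U) z := by
  have h1 : ContinuousAt (hess U) z :=
    ((contDiffAt_fderiv hU).fderiv_right (m := 0) (by norm_num)).continuousAt
  have h2 : ContinuousAt (dt U) z := (contDiffAt_dt hU).continuousAt
  have h3 (c : ℝ) : ContinuousAt (fun z : Spacetime => c / z.1) z :=
    continuousAt_const.div continuousAt_fst hz
  have h4 : ContinuousAt (fun z : Spacetime => ((0 : ℝ), z.2)) z :=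
    continuousAt_const.prodMk continuousAt_snd
  exact (((tendsto_finsetSum _ fun i _ => ((h1.clm_apply continuousAt_const).clm_apply
    continuousAt_const : ContinuousAt _ z)).sub ((h1.clm_apply continuousAt_const).clm_apply
    continuousAt_const : ContinuousAt _ z)).sub ((h3 2).mul ((h1.clm_apply
    continuousAt_const).clm_apply h4))).sub ((h3 3).mul h2)

lemma continuous_hypTime : Continuous hypTime := by unfold hypTime; fun_prop

lemma continuous_radius : Continuous radius := by unfold radius; fun_prop

lemma continuous_nullCoord : Continuous nullCoord :=
  (continuous_hypTime.sub continuous_radius).prodMk (continuous_hypTime.add continuous_radius)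

lemma Admissible.continuousAt_weight_fst (h : Admissible f g) {z : Spacetime} (hz : 1 ≤ z.1) :
    ContinuousAt (fun z => f (nullCoord z)) z :=
  ContinuousAt.comp (h.contDiffAt_fst _ (nullCoord_mem hz)).continuousAt
    continuous_nullCoord.continuousAt

lemma Admissible.continuousAt_weight_snd (h : Admissible f g) {z : Spacetime} (hz : 1 ≤ z.1) :
    ContinuousAt (fun z => g (nullCoord z)) z :=
  ContinuousAt.comp (h.contDiffAt_snd _ (nullCoord_mem hz)).continuousAt
    continuous_nullCoord.continuousAt

lemma Admissible.continuousAt_sourceWeight (h : Admissible f g) {z : Spacetime} (hz : 1 ≤ z.1) :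
    ContinuousAt (sourceWeight f g) z := by
  have ht := hypTime_pos (z := z) (by linarith)
  exact (((continuous_fst.comp continuous_nullCoord).continuousAt.mul (h.continuousAt_weight_fst hz)).add
    ((continuous_snd.comp continuous_nullCoord).continuousAt.mul (h.continuousAt_weight_snd hz))).div
      (continuousAt_const.mul continuous_hypTime.continuousAt) (by positivity)

/-- Multiplication by the cut-off removes singularities on the axis. -/
lemma contDiffAt_cutoff_smul {E : Type*} [NormedAddCommGroup E] [NormedSpace ℝ E]
    {F : Spacetime → E} {z : Spacetime} (l : ℝ) (hF : z.2 ≠ 0 → ContDiffAt ℝ 1 F z) :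
    ContDiffAt ℝ 1 (fun z => cutoff l z.2 • F z) z := by
  by_cases hx : z.2 = 0
  · have h0 : ∀ᶠ w in nhds z, cutoff l w.2 = 0 := by
      have : Filter.Tendsto (fun w : Spacetime => w.2) (nhds z) (nhds 0) := by
        rw [← hx]; exact continuousAt_snd
      exact this.eventually (eventually_cutoff_eq_zero l)
    refine (contDiffAt_const (c := (0 : E))).congr_of_eventuallyEq ?_
    filter_upwards [h0] with w hw
    rw [hw, zero_smul]
  · exact (((contDiff_cutoff l).contDiffAt (n := 1)).comp z contDiffAt_snd).smul (hF hx)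

lemma contDiffAt_cutoff_mul {F : Spacetime → ℝ} {z : Spacetime} (l : ℝ)
    (hF : z.2 ≠ 0 → ContDiffAt ℝ 1 F z) : ContDiffAt ℝ 1 (fun z => cutoff l z.2 * F z) z :=
  contDiffAt_cutoff_smul l hF

lemma hasFDerivAt_cutoff_snd (l : ℝ) (z : Spacetime) :
    HasFDerivAt (fun z : Spacetime => cutoff l z.2)
      (((deriv Real.smoothTransition (l * ‖z.2‖ ^ 2 - 1) * (2 * l)) • innerSL ℝ z.2).comp
        (ContinuousLinearMap.snd ℝ ℝ Space)) z :=
  (hasFDerivAt_cutoff l z.2).comp z hasFDerivAt_snd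

lemma fderiv_cutoff_mul {F : Spacetime → ℝ} {z : Spacetime} (l : ℝ) (hF : ContDiffAt ℝ 1 F z)
    (d : Spacetime) : fderiv ℝ (fun z => cutoff l z.2 * F z) z d =
      cutoff l z.2 * fderiv ℝ F z d +
        deriv Real.smoothTransition (l * ‖z.2‖ ^ 2 - 1) * (2 * l) * inner ℝ z.2 d.2 * F z := by
  have := (hasFDerivAt_cutoff_snd l z).mul ((hF.differentiableAt (by norm_num)).hasFDerivAt)
  have h2 : HasFDerivAt (fun z : Spacetime => cutoff l z.2 * F z) _ z := this
  rw [h2.fderiv]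
  simp
  ring

lemma spDiv_cutoff_smul {V : Spacetime → Space} {z : Spacetime} (l : ℝ)
    (hV : ContDiffAt ℝ 1 V z) : spDiv (fun z => cutoff l z.2 • V z) z =
      cutoff l z.2 * spDiv V z +
        deriv Real.smoothTransition (l * ‖z.2‖ ^ 2 - 1) * (2 * l) * inner ℝ z.2 (V z) := by
  have key (i : Fin 3) : dx i (fun z => (cutoff l z.2 • V z) i) z =
      cutoff l z.2 * dx i (fun z => V z i) z +
        deriv Real.smoothTransition (l * ‖z.2‖ ^ 2 - 1) * (2 * l) * (z.2 i * V z i) := by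
    have := fderiv_cutoff_mul l (contDiffAt_apply hV i) (0, EuclideanSpace.single i 1)
    simp only [dx, PiLp.smul_apply, smul_eq_mul]
    rw [this]
    simp [EuclideanSpace.inner_single_right]
    ring
  simp only [spDiv, key, Finset.sum_add_distrib, ← Finset.mul_sum]
  simp [PiLp.inner_apply, mul_comm]

lemma integral_spDiv_eq_zero {V : Spacetime → Space} (hV : ∀ x, ContDiffAt ℝ 1 V (s, x))
    (hK : IsCompact K) (hK0 : ∀ x ∉ K, V (s, x) = 0) :
    Integrable (fun x => spDiv V (s, x)) ∧ ∫ x, spDiv V (s, x) = 0 := by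
  have h (i : Fin 3) := integrable_dx_and_integral_eq_zero (h := fun z => V z i) (s := s)
    (fun x => contDiffAt_apply (hV x) i) hK (fun x hx => by simp [hK0 x hx]) i
  refine ⟨integrable_finsetSum _ fun i _ => (h i).1, ?_⟩
  simp only [spDiv]
  rw [integral_finsetSum _ fun i _ => (h i).1]
  exact Finset.sum_eq_zero fun i _ => (h i).2

/-- The energy inequality with a cut-off near the axis. -/
lemma Admissible.integral_cutoff_fderiv_le (h : Admissible f g) (hU : Regular U s₀ s₁ K) :
    ∃ C, 0 ≤ C ∧ ∀ l, 0 < l → ∀ s ∈ Icc s₀ s₁,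
      ∫ x, fderiv ℝ (fun z => cutoff l z.2 * energyDensity f g U z) (s, x) (1, 0) ≤
        2 * (√(∫ x, (√(sourceWeight f g (s, x)) * |hypBox U (s, x)|) ^ 2) *
          √(∫ x, cutoff l x * energyDensity f g U (s, x))) + C * l * √(2 / l) ^ 3 := by
  -- Only an upper bound of the radial flux is needed, because the derivative of the cut-off is
  -- nonnegative. The majorant from `inner_energyFlux_le` is continuous across the axis, unlike the
  -- flux itself.
  obtain ⟨B, hB0, hB⟩ : ∃ B, 0 ≤ B ∧ ∀ s ∈ Icc s₀ s₁, ∀ x : Space, x ≠ 0 →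
      inner ℝ x (energyFlux f g U (s, x)) ≤ B := by
    have hcont : ContinuousOn (fun z : Spacetime =>
        z.1 * radius z * f (nullCoord z) * ‖grad U z‖ ^ 2 / (2 * hypTime z) +
        g (nullCoord z) * dt U z *
          (2 * radius z ^ 2 / z.1 * dt U z - 2 * (euler U z + U z))) (Icc s₀ s₁ ×ˢ univ) := by
      rintro ⟨s, x⟩ ⟨hs, -⟩
      have c := hU.contDiffAt s hs x
      have h1 := hU.one_le' hs
      have h0 : (0 : ℝ) < s := by linarith
      have ht := hypTime_pos (z := (s, x)) h0
      refine ContinuousAt.continuousWithinAt ?_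
      refine ContinuousAt.add (ContinuousAt.div (((continuousAt_fst.mul
        continuous_radius.continuousAt).mul (h.continuousAt_weight_fst h1)).mul
          (contDiffAt_norm_grad_sq c).continuousAt) (continuousAt_const.mul
            continuous_hypTime.continuousAt) (by positivity)) ?_
      refine ((h.continuousAt_weight_snd h1).mul (contDiffAt_dt c).continuousAt).mul
        ((((continuousAt_const.mul (continuous_radius.continuousAt.pow 2)).div continuousAt_fst
          h0.ne').mul (contDiffAt_dt c).continuousAt).sub (continuousAt_const.mul
            ((contDiffAt_euler c).continuousAt.add c.continuousAt)))
    obtain ⟨B, hB0, hB⟩ := exists_bound hcont hU.isCompact fun s hs x hx => by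
      simp [hU.dt_eq_zero hs hx, hU.grad_eq_zero hs hx]
    exact ⟨B, hB0, fun s hs x hx => (h.inner_energyFlux_le (z := (s, x)) (hU.one_le' hs) hx).trans
      ((le_abs_self _).trans (hB s hs x))⟩
  obtain ⟨D, hD0, hD⟩ := exists_deriv_smoothTransition_le
  set ω : ℝ := volume.real (Metric.ball (0 : Space) 1)
  refine ⟨D * 2 * B * ω, by positivity, fun l hl s hs => ?_⟩
  have h1s := hU.one_le' hs
  have h0s : (0 : ℝ) < s := by linarith
  set e := fun z : Spacetime => cutoff l z.2 * energyDensity f g U z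
  have ce (x : Space) : ContDiffAt ℝ 1 e (s, x) := contDiffAt_cutoff_mul l fun hx =>
    h.contDiffAt_energyDensity (hU.contDiffAt s hs x) h1s hx
  have cV (x : Space) : ContDiffAt ℝ 1 (fun z => cutoff l z.2 • energyFlux f g U z) (s, x) :=
    contDiffAt_cutoff_smul l fun hx => h.contDiffAt_energyFlux (hU.contDiffAt s hs x) h1s hx
  obtain ⟨iV, iV0⟩ := integral_spDiv_eq_zero (s := s) cV hU.isCompact fun x hx => by
    simp [hU.energyFlux_eq_zero hs hx]
  set k := fun x : Space => √(sourceWeight f g (s, x)) * |hypBox U (s, x)|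
  have ck : Continuous k := continuous_iff_continuousAt.2 fun x => by
    have hp : ContinuousAt (fun x : Space => (s, x)) x := by fun_prop
    exact ((ContinuousAt.comp (f := fun x : Space => (s, x))
      (h.continuousAt_sourceWeight h1s) hp).sqrt).mul
      ((ContinuousAt.comp (f := fun x : Space => (s, x))
        (continuousAt_hypBox (hU.contDiffAt s hs x) h0s.ne') hp).abs)
  have sk : HasCompactSupport k := HasCompactSupport.intro hU.isCompact fun x hx => by
    simp [k, hU.hypBox_eq_zero hs hx]
  have ce' : Continuous fun x => √(e (s, x)) := (contDiff_slice ce).continuous.sqrt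
  have se : HasCompactSupport fun x => √(e (s, x)) :=
    HasCompactSupport.intro hU.isCompact fun x hx => by
      simp [e, hU.energyDensity_eq_zero hs hx]
  have ike : Integrable fun x => k x * √(e (s, x)) :=
    (ck.mul ce').integrable_of_hasCompactSupport sk.mul_right
  have ind : Integrable ((Metric.closedBall (0 : Space) √(2 / l)).indicator
      fun _ => D * (2 * l) * B) :=
    (integrable_indicator_iff measurableSet_closedBall).2
      (integrableOn_const (isCompact_closedBall _ _).measure_ne_top)
  have pw (x : Space) : fderiv ℝ e (s, x) (1, 0) ≤ 2 * (k x * √(e (s, x))) -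
      spDiv (fun z => cutoff l z.2 • energyFlux f g U z) (s, x) +
      (Metric.closedBall (0 : Space) √(2 / l)).indicator (fun _ => D * (2 * l) * B) x := by
    have hind : 0 ≤ (Metric.closedBall (0 : Space) √(2 / l)).indicator
        (fun _ => D * (2 * l) * B) x := indicator_nonneg (fun _ _ => by positivity) x
    have hke : 0 ≤ k x * √(e (s, x)) := by positivity
    by_cases hx : x = 0
    -- On the axis the cut-off vanishes in a whole neighbourhood, so both derivatives are zero there
    -- whatever values the singular expressions take.
    · have h0 : ∀ᶠ w in nhds (s, x), cutoff l w.2 = 0 := by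
        have : Filter.Tendsto (fun w : Spacetime => w.2) (nhds (s, x)) (nhds 0) := by
          rw [← hx]; exact continuousAt_snd
        exact this.eventually (eventually_cutoff_eq_zero l)
      have z1 : fderiv ℝ e (s, x) = 0 := by
        have : e =ᶠ[nhds (s, x)] fun _ => 0 := by
          filter_upwards [h0] with w hw
          simp [e, hw]
        rw [this.fderiv_eq]; simp
      have z2 : spDiv (fun z => cutoff l z.2 • energyFlux f g U z) (s, x) = 0 := by
        refine Finset.sum_eq_zero fun i _ => ?_
        have : (fun z : Spacetime => (cutoff l z.2 • energyFlux f g U z) i) =ᶠ[nhds (s, x)]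
            fun _ => 0 := by
          filter_upwards [h0] with w hw
          simp [hw]
        simp only [dx, this.fderiv_eq]
        simp
      rw [z1, z2]
      simp only [zero_apply]
      linarith
    · have cE := h.contDiffAt_energyDensity (hU.contDiffAt s hs x) h1s hx
      have cF := h.contDiffAt_energyFlux (hU.contDiffAt s hs x) h1s hx
      rw [fderiv_cutoff_mul l cE, spDiv_cutoff_smul l cF]
      have p1 := h.fderiv_add_spDiv_le (hU.contDiffAt s hs x) h1s hx
      have p2 := mul_le_mul_of_nonneg_left p1 (cutoff_nonneg l x)
      have hE := h.energyDensity_nonneg (U := U) (z := (s, x)) h1s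
      have hα := h.sourceWeight_nonneg (z := (s, x)) h1s
      have p3 : |multiplier f g U (s, x)| ≤
          √(sourceWeight f g (s, x)) * √(energyDensity f g U (s, x)) := by
        rw [← Real.sqrt_mul hα]
        exact Real.abs_le_sqrt (h.multiplier_sq_le h1s)
      have p4 : cutoff l x * (-2 * hypBox U (s, x) * multiplier f g U (s, x)) ≤
          2 * (k x * √(e (s, x))) := by
        -- Since the cut-off lies in `[0, 1]`, it is at most its own root, and this root is what the
        -- energy with cut-off absorbs.
        have q1 : cutoff l x ≤ √(cutoff l x) := Real.le_sqrt_of_sq_le (by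
          nlinarith [cutoff_nonneg l x, cutoff_le_one l x])
        have q2 : √(e (s, x)) = √(cutoff l x) * √(energyDensity f g U (s, x)) :=
          Real.sqrt_mul (cutoff_nonneg l x) _
        have q3 : -2 * hypBox U (s, x) * multiplier f g U (s, x) ≤
            2 * (|hypBox U (s, x)| * (√(sourceWeight f g (s, x)) *
              √(energyDensity f g U (s, x)))) := by
          have := mul_le_mul_of_nonneg_left p3 (abs_nonneg (hypBox U (s, x)))
          rw [← abs_mul] at this
          linarith [neg_abs_le (hypBox U (s, x) * multiplier f g U (s, x))]
        calc _ ≤ cutoff l x * (2 * (|hypBox U (s, x)| * (√(sourceWeight f g (s, x)) *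
              √(energyDensity f g U (s, x))))) :=
              mul_le_mul_of_nonneg_left q3 (cutoff_nonneg l x)
          _ ≤ √(cutoff l x) * (2 * (|hypBox U (s, x)| * (√(sourceWeight f g (s, x)) *
              √(energyDensity f g U (s, x))))) :=
              mul_le_mul_of_nonneg_right q1 (by positivity)
          _ = _ := by rw [q2]; ring
      -- The derivative of the cut-off is supported in `1 ≤ l|x|² ≤ 2`. The error is at most `2 l D
      -- B` on a ball of radius `√(2/l)`, whose volume supplies the cube.
      have p5 : deriv Real.smoothTransition (l * ‖x‖ ^ 2 - 1) * (2 * l) *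
          inner ℝ x (energyFlux f g U (s, x)) ≤
          (Metric.closedBall (0 : Space) √(2 / l)).indicator (fun _ => D * (2 * l) * B) x := by
        by_cases hxm : x ∈ Metric.closedBall (0 : Space) √(2 / l)
        · rw [indicator_of_mem hxm]
          have hθ := deriv_smoothTransition_nonneg (l * ‖x‖ ^ 2 - 1)
          have hθ' := (le_abs_self _).trans (hD (l * ‖x‖ ^ 2 - 1))
          calc _ ≤ deriv Real.smoothTransition (l * ‖x‖ ^ 2 - 1) * (2 * l) * B :=
                mul_le_mul_of_nonneg_left (hB s hs x hx) (by positivity)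
            _ ≤ _ := by gcongr
        · rw [indicator_of_notMem hxm, deriv_smoothTransition_eq_zero]
          · simp
          · simp only [mem_closedBall_zero_iff, not_le] at hxm
            have := (Real.sqrt_lt' ((Real.sqrt_nonneg _).trans_lt hxm)).1 hxm
            rw [div_lt_iff₀ hl] at this
            simp only [mem_Icc, not_and_or, not_le]
            right
            linarith
      simp only [inner_zero_right, mul_zero, zero_mul, add_zero]
      linarith
  have iR : Integrable fun x => 2 * (k x * √(e (s, x))) -
      spDiv (fun z => cutoff l z.2 • energyFlux f g U z) (s, x) +
      (Metric.closedBall (0 : Space) √(2 / l)).indicator (fun _ => D * (2 * l) * B) x :=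
    ((ike.const_mul 2).sub iV).add ind
  have hR : ∫ x, (2 * (k x * √(e (s, x))) -
      spDiv (fun z => cutoff l z.2 • energyFlux f g U z) (s, x) +
      (Metric.closedBall (0 : Space) √(2 / l)).indicator (fun _ => D * (2 * l) * B) x) =
      2 * (∫ x, k x * √(e (s, x))) + √(2 / l) ^ 3 * ω * (D * (2 * l) * B) := by
    have i1 : Integrable fun x => 2 * (k x * √(e (s, x))) -
        spDiv (fun z => cutoff l z.2 • energyFlux f g U z) (s, x) := (ike.const_mul 2).sub iV
    rw [integral_add i1 ind, integral_sub (ike.const_mul 2) iV, iV0,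
      integral_const_mul, integral_indicator measurableSet_closedBall, setIntegral_const,
      measureReal_def, Measure.addHaar_closedBall _ _ (Real.sqrt_nonneg _), smul_eq_mul,
      ENNReal.toReal_mul, ENNReal.toReal_ofReal (by positivity)]
    simp [ω, measureReal_def]
  have hCS := integral_mul_le_sqrt_mul_sqrt ck ce' sk se (fun x => by positivity)
    (fun x => Real.sqrt_nonneg _)
  have hsq (x : Space) : √(e (s, x)) ^ 2 = e (s, x) :=
    Real.sq_sqrt (mul_nonneg (cutoff_nonneg l x) (h.energyDensity_nonneg h1s))
  simp only [hsq] at hCS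
  have hfin : ∫ x, fderiv ℝ e (s, x) (1, 0) ≤
      2 * (∫ x, k x * √(e (s, x))) + √(2 / l) ^ 3 * ω * (D * (2 * l) * B) := by
    rw [← hR]
    -- If the derivative were not integrable, its integral would be `0` by convention, and the
    -- right-hand side is nonnegative anyway.
    by_cases hi : Integrable fun x => fderiv ℝ e (s, x) (1, 0)
    · exact integral_mono hi iR pw
    · rw [integral_undef hi, hR]
      have : 0 ≤ ∫ x, k x * √(e (s, x)) := integral_nonneg fun x => by positivity
      positivity
  calc _ ≤ _ := hfin
    _ ≤ 2 * (√(∫ x, k x ^ 2) * √(∫ x, e (s, x))) + √(2 / l) ^ 3 * ω * (D * (2 * l) * B) := by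
      gcongr
    _ = _ := by ring

end

/-! ### Passage to the limit in the cut-off -/

lemma eLpNorm_two_eq {k : Space → ℝ} (hk : Continuous k) (hc : HasCompactSupport k) :
    eLpNorm k 2 volume = ENNReal.ofReal √(∫ x, k x ^ 2) := by
  rw [(hk.memLp_of_hasCompactSupport hc).eLpNorm_eq_integral_rpow_norm two_ne_zero
    ENNReal.ofNat_ne_top, Real.sqrt_eq_rpow]
  simp

lemma ofReal_intervalIntegral {N : ℝ → ℝ} {s₀ s₁ : ℝ} (h01 : s₀ ≤ s₁)
    (hN : ContinuousOn N (Icc s₀ s₁)) (hN0 : ∀ s ∈ Icc s₀ s₁, 0 ≤ N s) :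
    ENNReal.ofReal (∫ s in s₀..s₁, N s) = ∫⁻ s in Icc s₀ s₁, ENNReal.ofReal (N s) := by
  rw [intervalIntegral.integral_of_le h01, ← integral_Icc_eq_integral_Ioc]
  refine ofReal_integral_eq_lintegral_ofReal hN.integrableOn_Icc ?_
  filter_upwards [ae_restrict_mem measurableSet_Icc] with s hs using hN0 s hs

/-- If the `L²` norms of truncations away from the axis are bounded up to a vanishing error, then
so is the `L²` norm. -/
lemma eLpNorm_le_of_cutoff {k : Space → ℝ} {B : ℝ≥0∞} {η : ℕ → ℝ≥0∞}
    (hk : ∀ n : ℕ, Continuous fun x => √(cutoff (n + 1) x * k x))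
    (hη : Filter.Tendsto η Filter.atTop (nhds 0))
    (hle : ∀ n : ℕ, eLpNorm (fun x => √(cutoff (n + 1) x * k x)) 2 volume ≤ B + η n) :
    eLpNorm (fun x => √(k x)) 2 volume ≤ B := by
  -- Away from the origin the truncations are eventually constant in `n`.
  have hlim : ∀ᵐ x : Space, Filter.Tendsto (fun n : ℕ => √(cutoff (n + 1) x * k x))
      Filter.atTop (nhds √(k x)) := by
    have hne : ∀ᵐ x : Space, x ≠ 0 := by
      simp [ae_iff, measure_singleton]
    filter_upwards [hne] with x hx
    have hx2 : 0 < ‖x‖ ^ 2 := by positivity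
    refine tendsto_const_nhds.congr' ?_
    obtain ⟨m, hm⟩ := exists_nat_gt (2 / ‖x‖ ^ 2)
    filter_upwards [Filter.eventually_ge_atTop m] with n hn
    rw [cutoff_eq_one, one_mul]
    rw [div_lt_iff₀ hx2] at hm
    have : (m : ℝ) ≤ n := by exact_mod_cast hn
    nlinarith
  -- Fatou's lemma for `L²` norms.
  refine (Lp.eLpNorm_lim_le_liminf_eLpNorm (fun n => (hk n).aestronglyMeasurable) _ hlim).trans ?_
  have h2 : Filter.Tendsto (fun n => B + η n) Filter.atTop (nhds B) := by
    simpa using tendsto_const_nhds.add hη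
  calc _ ≤ Filter.liminf (fun n => B + η n) Filter.atTop :=
        Filter.liminf_le_liminf (.of_forall hle)
    _ = B := h2.liminf_eq

/-- With `l = n + 1` one has `l (2/l)^(3/2) = 2 √(2/l)`: in dimension three the volume of the ball
beats the size of the derivative of the cut-off. -/
lemma tendsto_cutoff_error (C D : ℝ) : Filter.Tendsto
    (fun n : ℕ => ENNReal.ofReal √(C * (n + 1 : ℝ) * √(2 / (n + 1 : ℝ)) ^ 3 * D)) Filter.atTop
    (nhds 0) := by
  have h1 : Filter.Tendsto (fun n : ℕ => √(C * 2 * √(2 * (1 / ((n : ℝ) + 1))) * D)) Filter.atTop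
      (nhds √(C * 2 * √(2 * 0) * D)) :=
    ((((tendsto_one_div_add_atTop_nhds_zero_nat (𝕜 := ℝ)).const_mul 2).sqrt.const_mul
      (C * 2)).mul_const D).sqrt
  have h2 := ENNReal.tendsto_ofReal h1
  simp only [mul_zero, Real.sqrt_zero, zero_mul, ENNReal.ofReal_zero] at h2
  refine h2.congr fun n => ?_
  congr 2
  have hn : (0 : ℝ) < (n : ℝ) + 1 := by positivity
  have : √(2 / ((n : ℝ) + 1)) ^ 3 = 2 / ((n : ℝ) + 1) * √(2 / ((n : ℝ) + 1)) := by
    rw [pow_succ, Real.sq_sqrt (by positivity)]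
  rw [this, mul_one_div]
  field_simp

section

variable {f g : ℝ × ℝ → ℝ} {U : Spacetime → ℝ} {s₀ s₁ s : ℝ} {K : Set Space}

/-- The energy estimate for an admissible pair of weights. -/
theorem Admissible.energy_estimate (h : Admissible f g) (hU : Regular U s₀ s₁ K) (h01 : s₀ ≤ s₁) :
    eLpNorm (fun x => √(energyDensity f g U (s₁, x))) 2 volume ≤
      eLpNorm (fun x => √(energyDensity f g U (s₀, x))) 2 volume +
        2 * ∫⁻ s in Icc s₀ s₁,
          eLpNorm (fun x => √(sourceWeight f g (s, x)) * |hypBox U (s, x)|) 2 volume := by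
  obtain ⟨C, hC0, hC⟩ := h.integral_cutoff_fderiv_le hU
  set k := fun z : Spacetime => √(sourceWeight f g z) * |hypBox U z|
  have ck : ContinuousOn k (Icc s₀ s₁ ×ˢ univ) := by
    rintro ⟨s, x⟩ ⟨hs, -⟩
    have h1s := hU.one_le' hs
    have h0s : s ≠ 0 := by linarith
    exact ((h.continuousAt_sourceWeight (z := (s, x)) h1s).sqrt.mul (continuousAt_hypBox
      (hU.contDiffAt s hs x) h0s).abs).continuousWithinAt
  have sk (s : ℝ) (hs : s ∈ Icc s₀ s₁) (x : Space) (hx : x ∉ K) : k (s, x) = 0 := by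
    simp [k, hU.hypBox_eq_zero hs hx]
  set N := fun s => √(∫ x, k (s, x) ^ 2)
  have cN : ContinuousOn N (Icc s₀ s₁) := (continuousOn_integral (ck.pow 2) hU.isCompact
    fun s hs x hx => by simp [sk s hs x hx]).sqrt
  have ce (l : ℝ) (z : Spacetime) (hz : z ∈ Icc s₀ s₁ ×ˢ (univ : Set Space)) :
      ContDiffAt ℝ 1 (fun z => cutoff l z.2 * energyDensity f g U z) z :=
    contDiffAt_cutoff_mul l fun hx =>
      h.contDiffAt_energyDensity (hU.contDiffAt z.1 hz.1 z.2) (hU.one_le' hz.1) hx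
  have se (l s : ℝ) (hs : s ∈ Icc s₀ s₁) (x : Space) (hx : x ∉ K) :
      cutoff l x * energyDensity f g U (s, x) = 0 := by
    rw [hU.energyDensity_eq_zero hs hx, mul_zero]
  have ne (l s : ℝ) (hs : s ∈ Icc s₀ s₁) (x : Space) :
      0 ≤ cutoff l x * energyDensity f g U (s, x) :=
    mul_nonneg (cutoff_nonneg l x) (h.energyDensity_nonneg (hU.one_le' hs))
  have cs (l s : ℝ) (hs : s ∈ Icc s₀ s₁) :
      Continuous fun x => √(cutoff l x * energyDensity f g U (s, x)) :=
    (contDiff_slice (h := fun z => cutoff l z.2 * energyDensity f g U z)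
      fun x => ce l (s, x) ⟨hs, trivial⟩).continuous.sqrt
  have eE (l s : ℝ) (hs : s ∈ Icc s₀ s₁) :
      eLpNorm (fun x => √(cutoff l x * energyDensity f g U (s, x))) 2 volume =
        ENNReal.ofReal √(∫ x, cutoff l x * energyDensity f g U (s, x)) := by
    rw [eLpNorm_two_eq (cs l s hs)
      (HasCompactSupport.intro hU.isCompact fun x hx => by rw [se l s hs x hx, Real.sqrt_zero])]
    simp only [Real.sq_sqrt (ne l s hs _)]
  have eN (s : ℝ) (hs : s ∈ Icc s₀ s₁) :
      eLpNorm (fun x => k (s, x)) 2 volume = ENNReal.ofReal (N s) :=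
    eLpNorm_two_eq (continuousOn_slice hs ck) (HasCompactSupport.intro hU.isCompact (sk s hs))
  have hL := left_mem_Icc.2 h01
  have hR := right_mem_Icc.2 h01
  have hint : ∫⁻ s in Icc s₀ s₁, eLpNorm (fun x => k (s, x)) 2 volume =
      ENNReal.ofReal (∫ s in s₀..s₁, N s) := by
    rw [ofReal_intervalIntegral h01 cN fun s _ => Real.sqrt_nonneg _]
    exact setLIntegral_congr_fun measurableSet_Icc fun s hs => eN s hs
  -- The cut-off parameter is `l = n + 1`. It is kept in the energy at `s₁` until Fatou's lemma
  -- removes it, and discarded at `s₀` by monotonicity.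
  refine eLpNorm_le_of_cutoff (fun n => cs _ s₁ hR) (tendsto_cutoff_error C (s₁ - s₀))
    fun n => ?_
  have hn : (0 : ℝ) < (n : ℝ) + 1 := by positivity
  have key := sqrt_energy_growth (s₀ := s₀) (s₁ := s₁)
    (E := fun s => ∫ x, cutoff (n + 1) x * energyDensity f g U (s, x)) (N := N)
    (η := C * (n + 1 : ℝ) * √(2 / (n + 1 : ℝ)) ^ 3)
    (continuousOn_integral (h := fun z => cutoff (n + 1) z.2 * energyDensity f g U z)
      (fun z hz => (ce _ z hz).continuousAt.continuousWithinAt) hU.isCompact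
      fun s hs x hx => se _ s hs x hx) cN
    (fun s hs => hasDerivAt_integral (ce _) hU.isCompact (fun s hs x hx => se _ s hs x hx) hs)
    (fun s hs => integral_nonneg fun x => ne _ s hs x) (fun s _ => Real.sqrt_nonneg _)
    (by positivity)
    (fun s hs => (hC _ hn s (Ioo_subset_Icc_self hs)).trans (le_of_eq (by ring))) h01
  rw [eE _ _ hR, hint]
  have hcut : ENNReal.ofReal √(∫ x, cutoff (n + 1) x * energyDensity f g U (s₀, x)) ≤
      eLpNorm (fun x => √(energyDensity f g U (s₀, x))) 2 volume := by
    rw [← eE _ _ hL]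
    refine eLpNorm_mono fun x => ?_
    rw [Real.norm_of_nonneg (Real.sqrt_nonneg _), Real.norm_of_nonneg (Real.sqrt_nonneg _)]
    exact Real.sqrt_le_sqrt (mul_le_of_le_one_left
      (h.energyDensity_nonneg (hU.one_le' hL)) (cutoff_le_one _ x))
  have hI : 0 ≤ ∫ s in s₀..s₁, N s := intervalIntegral.integral_nonneg h01 fun s _ =>
    Real.sqrt_nonneg _
  refine (ENNReal.ofReal_le_ofReal key).trans ?_
  rw [ENNReal.ofReal_add (by positivity) (by positivity),
    ENNReal.ofReal_add (by positivity) (by positivity), ENNReal.ofReal_mul zero_le_two,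
    ENNReal.ofReal_ofNat, add_right_comm]
  gcongr

end

/-! ### Hardy type inequalities on the hyperboloids -/

section

variable {f g : ℝ × ℝ → ℝ} {U : Spacetime → ℝ} {s₀ s₁ s : ℝ} {K : Set Space}

lemma spDiv_smul_snd {h : Spacetime → ℝ} {z : Spacetime} (hh : ContDiffAt ℝ 1 h z) :
    spDiv (fun z => h z • z.2) z = 3 * h z + fderiv ℝ h z (0, z.2) := by
  have := spDiv_smul_sub_smul (U := fun _ => 0) (M := fun _ => 0) (z := z) contDiffAt_const hh
    contDiffAt_const
  simpa using this

lemma Regular.contDiffAt_one (hU : Regular U s₀ s₁ K) (hs : s ∈ Icc s₀ s₁) (x : Space) :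
    ContDiffAt ℝ 1 U (s, x) := (hU.contDiffAt s hs x).of_le (by norm_num)

lemma Regular.continuous (hU : Regular U s₀ s₁ K) (hs : s ∈ Icc s₀ s₁) :
    Continuous fun x => U (s, x) := (contDiff_slice (hU.contDiffAt_one hs)).continuous

lemma Regular.continuous_dt (hU : Regular U s₀ s₁ K) (hs : s ∈ Icc s₀ s₁) :
    Continuous fun x => dt U (s, x) :=
  (contDiff_slice fun x => contDiffAt_dt (hU.contDiffAt s hs x)).continuous

lemma Regular.continuous_euler (hU : Regular U s₀ s₁ K) (hs : s ∈ Icc s₀ s₁) :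
    Continuous fun x => euler U (s, x) :=
  (contDiff_slice fun x => contDiffAt_euler (hU.contDiffAt s hs x)).continuous

lemma Regular.continuous_grad (hU : Regular U s₀ s₁ K) (hs : s ∈ Icc s₀ s₁) :
    Continuous fun x => grad U (s, x) :=
  (contDiff_slice fun x => contDiffAt_grad (hU.contDiffAt s hs x)).continuous

lemma fderiv_sq_apply {z : Spacetime} (hU : ContDiffAt ℝ 1 U z) (d : Spacetime) :
    fderiv ℝ (fun z => U z ^ 2) z d = 2 * U z * fderiv ℝ U z d := by
  have := ((hU.differentiableAt (by norm_num)).hasFDerivAt).pow 2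
  rw [this.fderiv]
  simp

/-- The `L²` norm of a function is bounded by that of its Euler derivative. -/
lemma Regular.eLpNorm_le_euler (hU : Regular U s₀ s₁ K) (hs : s ∈ Icc s₀ s₁) :
    eLpNorm (fun x => U (s, x)) 2 volume ≤ eLpNorm (fun x => euler U (s, x)) 2 volume := by
  have cU := hU.continuous hs
  have cN := hU.continuous_euler hs
  have sU : HasCompactSupport fun x => U (s, x) :=
    HasCompactSupport.intro hU.isCompact (hU.eq_zero s hs)
  have sN : HasCompactSupport fun x => euler U (s, x) :=
    HasCompactSupport.intro hU.isCompact fun x hx => hU.euler_eq_zero hs hx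
  rw [eLpNorm_two_eq cU sU, eLpNorm_two_eq cN sN]
  refine ENNReal.ofReal_le_ofReal ?_
  -- The field `U² x` has divergence `3 U² + 2 U (x·∇U)`. Its integral vanishes, so Cauchy–Schwarz
  -- gives `3 ‖U‖ ≤ 2 ‖x·∇U‖`.
  have hc (x : Space) : ContDiffAt ℝ 1 (fun z => U z ^ 2) (s, x) := (hU.contDiffAt_one hs x).pow 2
  have h0 := (integral_spDiv_eq_zero (V := fun z => U z ^ 2 • z.2) (s := s)
    (fun x => (hc x).smul contDiffAt_snd) hU.isCompact
    (fun x hx => by simp [hU.eq_zero s hs x hx])).2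
  have e (x : Space) : spDiv (fun z => U z ^ 2 • z.2) (s, x) =
      3 * U (s, x) ^ 2 + 2 * (U (s, x) * euler U (s, x)) := by
    rw [spDiv_smul_snd (hc x), fderiv_sq_apply (hU.contDiffAt_one hs x), euler]
    ring
  have iU2 : Integrable fun x => U (s, x) ^ 2 :=
    (cU.pow 2).integrable_of_hasCompactSupport
      (HasCompactSupport.intro hU.isCompact fun x hx => by simp [hU.eq_zero s hs x hx])
  have iUN : Integrable fun x => U (s, x) * euler U (s, x) :=
    (cU.mul cN).integrable_of_hasCompactSupport sU.mul_right
  simp only [e] at h0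
  rw [integral_add (iU2.const_mul 3) (iUN.const_mul 2), integral_const_mul,
    integral_const_mul] at h0
  have hCS := integral_mul_le_sqrt_mul_sqrt cU.abs cN.abs sU.abs sN.abs (fun x => abs_nonneg _)
    (fun x => abs_nonneg _)
  simp only [sq_abs] at hCS
  have hle : -(∫ x, U (s, x) * euler U (s, x)) ≤ ∫ x, |U (s, x)| * |euler U (s, x)| := by
    rw [← integral_neg]
    refine integral_mono iUN.neg ?_ fun x => ?_
    · simpa [abs_mul] using iUN.abs
    · rw [← abs_mul]; exact neg_le_abs _
  have hI : 0 ≤ ∫ x, U (s, x) ^ 2 := integral_nonneg fun x => sq_nonneg _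
  have e1 := Real.sq_sqrt hI
  have p1 := Real.sqrt_nonneg (∫ x, U (s, x) ^ 2)
  have p2 := Real.sqrt_nonneg (∫ x, euler U (s, x) ^ 2)
  by_contra hcon
  push Not at hcon
  nlinarith [mul_lt_mul_of_pos_left hcon (p2.trans_lt hcon)]

/-- The growth of the `L²` norm in `s`. -/
lemma Regular.eLpNorm_growth (hU : Regular U s₀ s₁ K) (h01 : s₀ ≤ s₁) :
    eLpNorm (fun x => U (s₁, x)) 2 volume ≤ eLpNorm (fun x => U (s₀, x)) 2 volume +
      2 * ∫⁻ s in Icc s₀ s₁, eLpNorm (fun x => dt U (s, x)) 2 volume := by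
  have sU (s : ℝ) (hs : s ∈ Icc s₀ s₁) : HasCompactSupport fun x => U (s, x) :=
    HasCompactSupport.intro hU.isCompact (hU.eq_zero s hs)
  have sD (s : ℝ) (hs : s ∈ Icc s₀ s₁) : HasCompactSupport fun x => dt U (s, x) :=
    HasCompactSupport.intro hU.isCompact fun x hx => hU.dt_eq_zero hs hx
  have hL := left_mem_Icc.2 h01
  have hR := right_mem_Icc.2 h01
  have hc (z : Spacetime) (hz : z ∈ Icc s₀ s₁ ×ˢ (univ : Set Space)) :
      ContDiffAt ℝ 1 (fun z => U z ^ 2) z := (hU.contDiffAt_one hz.1 z.2).pow 2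
  have hcd : ContinuousOn (fun z => dt U z ^ 2) (Icc s₀ s₁ ×ˢ univ) := fun z hz =>
    ((contDiffAt_dt (hU.contDiffAt z.1 hz.1 z.2)).continuousAt.pow 2).continuousWithinAt
  have sU2 (s : ℝ) (hs : s ∈ Icc s₀ s₁) (x : Space) (hx : x ∉ K) : U (s, x) ^ 2 = 0 := by
    simp [hU.eq_zero s hs x hx]
  have cN : ContinuousOn (fun s => √(∫ x, dt U (s, x) ^ 2)) (Icc s₀ s₁) :=
    (continuousOn_integral hcd hU.isCompact fun s hs x hx => by
      simp [hU.dt_eq_zero hs hx]).sqrt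
  -- The Grönwall lemma is applied to `E = ‖U‖²`, whose derivative is `2 ∫ U ∂_s U`, without an
  -- error term.
  have key := sqrt_energy_growth (E := fun s => ∫ x, U (s, x) ^ 2) (η := 0)
    (continuousOn_integral (h := fun z => U z ^ 2)
      (fun z hz => (hc z hz).continuousAt.continuousWithinAt) hU.isCompact sU2) cN
    (fun s hs => hasDerivAt_integral hc hU.isCompact sU2 hs)
    (fun s hs => integral_nonneg fun x => sq_nonneg _) (fun s _ => Real.sqrt_nonneg _) le_rfl
    (fun s hs => by
      have hs' := Ioo_subset_Icc_self hs
      have cU := hU.continuous hs'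
      have cD := hU.continuous_dt hs'
      have hCS := integral_mul_le_sqrt_mul_sqrt cU.abs cD.abs (sU s hs').abs (sD s hs').abs
        (fun x => abs_nonneg _) (fun x => abs_nonneg _)
      simp only [sq_abs] at hCS
      have i1 : Integrable fun x => U (s, x) * dt U (s, x) :=
        (cU.mul cD).integrable_of_hasCompactSupport (sU s hs').mul_right
      have e (x : Space) : fderiv ℝ (fun z => U z ^ 2) (s, x) (1, 0) =
          2 * (U (s, x) * dt U (s, x)) := by
        rw [fderiv_sq_apply (hU.contDiffAt_one hs' x), dt, mul_assoc]
      simp only [e, integral_const_mul]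
      have hle : ∫ x, U (s, x) * dt U (s, x) ≤ ∫ x, |U (s, x)| * |dt U (s, x)| := by
        refine integral_mono i1 ?_ fun x => ?_
        · simpa [abs_mul] using i1.abs
        · rw [← abs_mul]; exact le_abs_self _
      linarith) h01
  rw [eLpNorm_two_eq (hU.continuous hR) (sU _ hR), eLpNorm_two_eq (hU.continuous hL) (sU _ hL),
    setLIntegral_congr_fun measurableSet_Icc fun s hs =>
      eLpNorm_two_eq (hU.continuous_dt hs) (sD s hs),
    ← ofReal_intervalIntegral h01 cN fun s _ => Real.sqrt_nonneg _]
  refine (ENNReal.ofReal_le_ofReal key).trans ?_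
  have hI : 0 ≤ ∫ s in s₀..s₁, √(∫ x, dt U (s, x) ^ 2) :=
    intervalIntegral.integral_nonneg h01 fun s _ => Real.sqrt_nonneg _
  rw [zero_mul, Real.sqrt_zero, add_zero, ENNReal.ofReal_add (by positivity) (by positivity),
    ENNReal.ofReal_mul zero_le_two, ENNReal.ofReal_ofNat]

lemma sqrt_add_le {a b : ℝ} (ha : 0 ≤ a) (hb : 0 ≤ b) : √(a + b) ≤ √a + √b := by
  refine Real.sqrt_le_iff.2 ⟨by positivity, ?_⟩
  nlinarith [Real.sq_sqrt ha, Real.sq_sqrt hb, Real.sqrt_nonneg a, Real.sqrt_nonneg b,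
    mul_nonneg (Real.sqrt_nonneg a) (Real.sqrt_nonneg b)]

/-- Two densities whose difference has a small integral away from the axis have comparable
integrals. -/
lemma eLpNorm_sqrt_le_of_cutoff {k₁ k₂ : Spacetime → ℝ} {C : ℝ} (hK : IsCompact K)
    (h₁ : ∀ x : Space, x ≠ 0 → ContDiffAt ℝ 1 k₁ (s, x))
    (h₂ : ∀ x : Space, x ≠ 0 → ContDiffAt ℝ 1 k₂ (s, x))
    (p₁ : ∀ x, 0 ≤ k₁ (s, x)) (p₂ : ∀ x, 0 ≤ k₂ (s, x))
    (z₁ : ∀ x ∉ K, k₁ (s, x) = 0) (z₂ : ∀ x ∉ K, k₂ (s, x) = 0) (hC : 0 ≤ C)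
    (hle : ∀ l, 0 < l → ∫ x, cutoff l x * k₁ (s, x) ≤
      (∫ x, cutoff l x * k₂ (s, x)) + C * l * √(2 / l) ^ 3) :
    eLpNorm (fun x => √(k₁ (s, x))) 2 volume ≤ eLpNorm (fun x => √(k₂ (s, x))) 2 volume := by
  have aux {k : Spacetime → ℝ} (h : ∀ x : Space, x ≠ 0 → ContDiffAt ℝ 1 k (s, x))
      (p : ∀ x, 0 ≤ k (s, x)) (z : ∀ x ∉ K, k (s, x) = 0) (l : ℝ) :
      Continuous (fun x => √(cutoff l x * k (s, x))) ∧
      eLpNorm (fun x => √(cutoff l x * k (s, x))) 2 volume =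
        ENNReal.ofReal √(∫ x, cutoff l x * k (s, x)) := by
    have c : Continuous (fun x => √(cutoff l x * k (s, x))) :=
      (contDiff_slice (h := fun z => cutoff l z.2 * k z)
        fun x => contDiffAt_cutoff_mul l (h x)).continuous.sqrt
    refine ⟨c, ?_⟩
    rw [eLpNorm_two_eq c (HasCompactSupport.intro hK fun x hx => by simp [z x hx])]
    simp only [Real.sq_sqrt (mul_nonneg (cutoff_nonneg l _) (p _))]
  refine eLpNorm_le_of_cutoff (fun n => (aux h₁ p₁ z₁ _).1) (tendsto_cutoff_error C 1) fun n => ?_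
  have hn : (0 : ℝ) < (n : ℝ) + 1 := by positivity
  rw [(aux h₁ p₁ z₁ _).2]
  have hcut : ENNReal.ofReal √(∫ x, cutoff (n + 1) x * k₂ (s, x)) ≤
      eLpNorm (fun x => √(k₂ (s, x))) 2 volume := by
    rw [← (aux h₂ p₂ z₂ _).2]
    refine eLpNorm_mono fun x => ?_
    rw [Real.norm_of_nonneg (Real.sqrt_nonneg _), Real.norm_of_nonneg (Real.sqrt_nonneg _)]
    exact Real.sqrt_le_sqrt (mul_le_of_le_one_left (p₂ x) (cutoff_le_one _ x))
  have p : 0 ≤ ∫ x, cutoff (n + 1) x * k₂ (s, x) :=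
    integral_nonneg fun x => mul_nonneg (cutoff_nonneg _ x) (p₂ x)
  have hsq : √(∫ x, cutoff (n + 1) x * k₁ (s, x)) ≤ √(∫ x, cutoff (n + 1) x * k₂ (s, x)) +
      √(C * (n + 1 : ℝ) * √(2 / (n + 1 : ℝ)) ^ 3 * 1) := by
    rw [mul_one]
    refine (Real.sqrt_le_sqrt (hle _ hn)).trans ?_
    exact sqrt_add_le p (by positivity)
  refine (ENNReal.ofReal_le_ofReal hsq).trans ?_
  rw [ENNReal.ofReal_add (by positivity) (by positivity)]
  gcongr

/-- The radial part of the conformal energy density and the radial derivative have the same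
`L²` norm. -/
lemma Regular.eLpNorm_radial (hU : Regular U s₀ s₁ K) (hs : s ∈ Icc s₀ s₁) :
    eLpNorm (fun x : Space => (euler U (s, x) + U (s, x)) / ‖x‖) 2 volume =
      eLpNorm (fun x : Space => euler U (s, x) / ‖x‖) 2 volume := by
  set k₁ : Spacetime → ℝ := fun z => ((euler U z + U z) / radius z) ^ 2
  set k₂ : Spacetime → ℝ := fun z => (euler U z / radius z) ^ 2
  have hr0 {x : Space} (hx : x ≠ 0) : radius (s, x) ≠ 0 := norm_ne_zero_iff.2 hx
  have h₁ (x : Space) (hx : x ≠ 0) : ContDiffAt ℝ 1 k₁ (s, x) :=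
    (((contDiffAt_euler (hU.contDiffAt s hs x)).add (hU.contDiffAt_one hs x)).div
      (contDiffAt_radius hx) (hr0 hx)).pow 2
  have h₂ (x : Space) (hx : x ≠ 0) : ContDiffAt ℝ 1 k₂ (s, x) :=
    ((contDiffAt_euler (hU.contDiffAt s hs x)).div (contDiffAt_radius hx) (hr0 hx)).pow 2
  have z₁ (x : Space) (hx : x ∉ K) : k₁ (s, x) = 0 := by
    simp [k₁, hU.euler_eq_zero hs hx, hU.eq_zero s hs x hx]
  have z₂ (x : Space) (hx : x ∉ K) : k₂ (s, x) = 0 := by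
    simp [k₂, hU.euler_eq_zero hs hx]
  obtain ⟨D, hD0, hD⟩ := exists_deriv_smoothTransition_le
  have cU2 : Continuous fun x => U (s, x) ^ 2 := (hU.continuous hs).pow 2
  obtain ⟨B, hB⟩ := hU.isCompact.exists_bound_of_continuousOn cU2.continuousOn
  have hB' (x : Space) : U (s, x) ^ 2 ≤ max B 0 := by
    by_cases hx : x ∈ K
    · exact ((le_abs_self _).trans (hB x hx)).trans (le_max_left _ _)
    · simp [hU.eq_zero s hs x hx]
  set ω : ℝ := volume.real (Metric.ball (0 : Space) 1)
  set C : ℝ := D * 2 * max B 0 * ω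
  have hC : 0 ≤ C := by positivity
  have key (l : ℝ) (hl : 0 < l) : |(∫ x, cutoff l x * k₁ (s, x)) - ∫ x, cutoff l x * k₂ (s, x)| ≤
      C * l * √(2 / l) ^ 3 := by
    have hint {k : Spacetime → ℝ} (h : ∀ x : Space, x ≠ 0 → ContDiffAt ℝ 1 k (s, x))
        (z : ∀ x ∉ K, k (s, x) = 0) : Integrable fun x => cutoff l x * k (s, x) :=
      (contDiff_slice (h := fun z => cutoff l z.2 * k z)
        fun x => contDiffAt_cutoff_mul l (h x)).continuous.integrable_of_hasCompactSupport
          (HasCompactSupport.intro hU.isCompact fun x hx => by simp [z x hx])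
    have cV (x : Space) (hx : x ≠ 0) :
        ContDiffAt ℝ 1 (fun z => U z ^ 2 / radius z ^ 2) (s, x) :=
      ((hU.contDiffAt_one hs x).pow 2).div ((contDiffAt_radius hx).pow 2)
        (pow_ne_zero 2 (hr0 hx))
    obtain ⟨iV, iV0⟩ := integral_spDiv_eq_zero (s := s)
      (V := fun z => cutoff l z.2 • ((U z ^ 2 / radius z ^ 2) • z.2))
      (fun x => contDiffAt_cutoff_smul l fun hx => (cV x hx).smul contDiffAt_snd) hU.isCompact
      fun x hx => by simp [hU.eq_zero s hs x hx]
    have hae : ∀ᵐ x : Space, x ≠ 0 := by simp [ae_iff, measure_singleton]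
    -- In dimension three `div(U² x/r²) = (2 U (x·∇U) + U²)/r²`, which is exactly the difference of
    -- the two densities. The cut-off adds `θ' · 2l · U²`, bounded by a multiple of `l` on the ball
    -- of radius `√(2/l)`.
    have hpt : ∀ᵐ x : Space, cutoff l x * k₁ (s, x) - cutoff l x * k₂ (s, x) =
        spDiv (fun z => cutoff l z.2 • ((U z ^ 2 / radius z ^ 2) • z.2)) (s, x) -
          deriv Real.smoothTransition (l * ‖x‖ ^ 2 - 1) * (2 * l) * U (s, x) ^ 2 := by
      filter_upwards [hae] with x hx
      have hr := hr0 hx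
      rw [spDiv_cutoff_smul (V := fun z => (U z ^ 2 / radius z ^ 2) • z.2) (z := (s, x)) l
        ((cV x hx).smul contDiffAt_snd),
        spDiv_smul_snd (cV x hx), inner_smul_right]
      have i3 : inner ℝ x x = radius (s, x) ^ 2 := real_inner_self_eq_norm_sq _
      have hd : fderiv ℝ (fun z => U z ^ 2 / radius z ^ 2) (s, x) (0, x) =
          2 * U (s, x) * euler U (s, x) / radius (s, x) ^ 2 -
            2 * U (s, x) ^ 2 / radius (s, x) ^ 2 := by
        have a1 : HasDerivAt (fun ε : ℝ => U ((s, x) + ε • (0, x))) _ 0 :=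
          hasLineDerivAt_self (hU.contDiffAt s hs x) (0, x)
        have a2 : HasDerivAt (fun ε : ℝ => radius ((s, x) + ε • (0, x))) _ 0 :=
          hasLineDerivAt_radius (z := (s, x)) hx (0, x)
        refine fderiv_eq_of_hasDerivAt (cV x hx) (((a1.fun_pow 2).fun_div (a2.fun_pow 2)
          (by simpa using hr)).congr_deriv ?_)
        simp only [zero_smul, add_zero, i3, euler_eq_inner]
        field_simp
        simp
        ring
      rw [hd]
      simp only [i3, k₁, k₂]
      field_simp
      ring
    rw [← integral_sub (hint h₁ z₁) (hint h₂ z₂), integral_congr_ae hpt]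
    have cθ : Continuous fun x : Space => deriv Real.smoothTransition (l * ‖x‖ ^ 2 - 1) :=
      ((Real.smoothTransition.contDiff (n := 1)).continuous_deriv le_rfl).comp (by fun_prop)
    have iθ : Integrable fun x : Space =>
        deriv Real.smoothTransition (l * ‖x‖ ^ 2 - 1) * (2 * l) * U (s, x) ^ 2 :=
      ((cθ.mul continuous_const).mul cU2).integrable_of_hasCompactSupport
        (HasCompactSupport.intro hU.isCompact fun x hx => by simp [hU.eq_zero s hs x hx])
    rw [integral_sub iV iθ, iV0, zero_sub, abs_neg]
    have ind : Integrable ((Metric.closedBall (0 : Space) √(2 / l)).indicator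
        fun _ => D * (2 * l) * max B 0) :=
      (integrable_indicator_iff measurableSet_closedBall).2
        (integrableOn_const (isCompact_closedBall _ _).measure_ne_top)
    refine (abs_integral_le_integral_abs).trans ((integral_mono iθ.abs ind fun x => ?_).trans ?_)
    · by_cases hxm : x ∈ Metric.closedBall (0 : Space) √(2 / l)
      · rw [indicator_of_mem hxm]
        simp only [abs_mul, abs_of_pos hl, abs_two, abs_of_nonneg (sq_nonneg (U (s, x)))]
        gcongr
        · exact hD _
        · exact hB' x
      · rw [indicator_of_notMem hxm]
        simp only []
        rw [deriv_smoothTransition_eq_zero]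
        · simp
        · simp only [mem_closedBall_zero_iff, not_le] at hxm
          have := (Real.sqrt_lt' ((Real.sqrt_nonneg _).trans_lt hxm)).1 hxm
          rw [div_lt_iff₀ hl] at this
          simp only [mem_Icc, not_and_or, not_le]
          right
          linarith
    · rw [integral_indicator measurableSet_closedBall, setIntegral_const,
        measureReal_def, Measure.addHaar_closedBall _ _ (Real.sqrt_nonneg _), smul_eq_mul,
        ENNReal.toReal_mul, ENNReal.toReal_ofReal (by positivity)]
      have : (volume (Metric.ball (0 : Space) 1)).toReal = ω := rfl
      rw [this]
      simp only [finrank_euclideanSpace_fin, C]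
      exact le_of_eq (by ring)
  have e₁ (x : Space) : √(k₁ (s, x)) = |(euler U (s, x) + U (s, x)) / ‖x‖| := Real.sqrt_sq_eq_abs _
  have e₂ (x : Space) : √(k₂ (s, x)) = |euler U (s, x) / ‖x‖| := Real.sqrt_sq_eq_abs _
  -- The error bound is two-sided, so the comparison can be made in both directions.
  have l₁ := eLpNorm_sqrt_le_of_cutoff hU.isCompact h₁ h₂ (fun x => sq_nonneg _)
    (fun x => sq_nonneg _) z₁ z₂ hC fun l hl => by linarith [(abs_le.1 (key l hl)).2]
  have l₂ := eLpNorm_sqrt_le_of_cutoff hU.isCompact h₂ h₁ (fun x => sq_nonneg _)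
    (fun x => sq_nonneg _) z₂ z₁ hC fun l hl => by linarith [(abs_le.1 (key l hl)).1]
  simp only [e₁, e₂, ← Real.norm_eq_abs, eLpNorm_norm] at l₁ l₂
  exact le_antisymm l₁ l₂

end

/-! ### Passage to hyperboloidal coordinates -/

/-- The point of Minkowski space with hyperboloidal coordinates `(s, x)`. -/
def hypMap (z : Spacetime) : Spacetime := (hypTime z, z.2)

/-- A function on Minkowski space in hyperboloidal coordinates. -/
def hypPull (φ : Spacetime → ℝ) (z : Spacetime) : ℝ := φ (hypMap z)

section

variable {φ : Spacetime → ℝ} {z : Spacetime}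

lemma contDiffAt_hypMap {n : WithTop ℕ∞} (hz : 0 < z.1) : ContDiffAt ℝ n hypMap z :=
  (contDiffAt_hypTime hz).prodMk contDiffAt_snd

lemma contDiffAt_hypPull (hz : 0 < z.1) (hφ : ContDiffAt ℝ 2 φ (hypMap z)) :
    ContDiffAt ℝ 2 (hypPull φ) z := hφ.comp z (contDiffAt_hypMap hz)

/-- The chain rule for the passage to hyperboloidal coordinates. -/
lemma hasLineDerivAt_comp_hypMap {F : Spacetime → ℝ} (hz : 0 < z.1)
    (hF : DifferentiableAt ℝ F (hypMap z)) (d : Spacetime) :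
    HasLineDerivAt ℝ (fun z => F (hypMap z))
      ((z.1 * d.1 + inner ℝ z.2 d.2) / hypTime z * dt F (hypMap z) +
        fderiv ℝ F (hypMap z) (0, d.2)) z d := by
  have h1 : HasDerivAt (fun ε : ℝ => hypTime (z + ε • d)) _ 0 := hasLineDerivAt_hypTime hz d
  have h2 : HasDerivAt (fun ε : ℝ => (z + ε • d).2) d.2 0 := by
    simpa using ((hasDerivAt_id (0 : ℝ)).smul_const d.2).const_add z.2
  have h3 : HasFDerivAt F (fderiv ℝ F (hypMap z)) (hypMap (z + (0 : ℝ) • d)) := by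
    simpa using hF.hasFDerivAt
  refine (h3.comp_hasDerivAt (0 : ℝ) (h1.prodMk h2)).congr_deriv ?_
  have e (a : ℝ) (y : Space) : ((a, y) : Spacetime) = a • ((1 : ℝ), (0 : Space)) + (0, y) := by
    simp
  rw [e, map_add, map_smul, smul_eq_mul, dt]

lemma fderiv_comp_hypMap {F : Spacetime → ℝ} (hz : 0 < z.1)
    (hF : DifferentiableAt ℝ F (hypMap z)) (d : Spacetime) :
    fderiv ℝ (fun z => F (hypMap z)) z d =
      (z.1 * d.1 + inner ℝ z.2 d.2) / hypTime z * dt F (hypMap z) +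
        fderiv ℝ F (hypMap z) (0, d.2) :=
  ((hF.comp z ((contDiffAt_hypMap (n := 1) hz).differentiableAt
    one_ne_zero)).hasFDerivAt.hasLineDerivAt d).unique (hasLineDerivAt_comp_hypMap hz hF d)

lemma dt_hypPull (hz : 0 < z.1) (hF : DifferentiableAt ℝ φ (hypMap z)) :
    dt (hypPull φ) z = z.1 / hypTime z * dt φ (hypMap z) := by
  have h2 : dt (hypPull φ) z = _ := fderiv_comp_hypMap hz hF (1, 0)
  have h0 : fderiv ℝ φ (hypMap z) ((0 : ℝ), (0 : Space)) = 0 := map_zero _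
  rw [h2]
  simp [h0]

lemma dx_hypPull (hz : 0 < z.1) (hF : DifferentiableAt ℝ φ (hypMap z)) (i : Fin 3) :
    dx i (hypPull φ) z = dx i φ (hypMap z) + z.2 i / hypTime z * dt φ (hypMap z) := by
  have h2 : dx i (hypPull φ) z = _ := fderiv_comp_hypMap hz hF (0, EuclideanSpace.single i 1)
  rw [h2]
  simp [dx, EuclideanSpace.inner_single_right]
  ring

lemma grad_hypPull (hz : 0 < z.1) (hF : DifferentiableAt ℝ φ (hypMap z)) :
    grad (hypPull φ) z = hypGrad φ (hypMap z) := by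
  ext i
  simp only [grad, hypGrad, dx_hypPull hz hF]
  rfl

lemma euler_hypPull (hz : 0 < z.1) (hF : DifferentiableAt ℝ φ (hypMap z)) :
    euler (hypPull φ) z =
      euler φ (hypMap z) + radius z ^ 2 / hypTime z * dt φ (hypMap z) := by
  have h2 : euler (hypPull φ) z = _ := fderiv_comp_hypMap hz hF (0, z.2)
  rw [h2]
  simp [euler, hypMap, radius]
  ring

/-- The first-order chain rules hold near the point and not just at it. This permits differentiating
them once more. -/
lemma eventually_contDiffAt_hypMap (hz : 0 < z.1) (hφ : ContDiffAt ℝ 2 φ (hypMap z)) :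
    ∀ᶠ w in nhds z, 0 < w.1 ∧ DifferentiableAt ℝ φ (hypMap w) := by
  have h1 : ∀ᶠ w in nhds z, 0 < w.1 := continuousAt_fst.eventually_const_lt hz
  have h2 := (contDiffAt_hypMap (n := 1) hz).continuousAt.eventually (hφ.eventually (by simp))
  filter_upwards [h1, h2] with w hw1 hw2 using ⟨hw1, hw2.differentiableAt (by norm_num)⟩

/-- The wave operator in hyperboloidal coordinates. -/
lemma hypBox_hypPull (hz : 0 < z.1) (hφ : ContDiffAt ℝ 2 φ (hypMap z)) :
    hypBox (hypPull φ) z = box φ (hypMap z) := by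
  have hU := contDiffAt_hypPull hz hφ
  have ht := hypTime_pos hz
  have ht2 := hypTime_sq z
  have hev := eventually_contDiffAt_hypMap hz hφ
  set P := hess φ (hypMap z)
  have dtd : DifferentiableAt ℝ (dt φ) (hypMap z) :=
    (contDiffAt_dt hφ).differentiableAt one_ne_zero
  have dxd (i : Fin 3) : DifferentiableAt ℝ (dx i φ) (hypMap z) :=
    (contDiffAt_dx i hφ).differentiableAt one_ne_zero
  have fdt (d' : Spacetime) : fderiv ℝ (dt φ) (hypMap z) d' = P d' (1, 0) := by
    have h : HasFDerivAt (dt φ) _ _ := hasFDerivAt_fderiv_apply hφ (1, 0)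
    rw [h.fderiv]; rfl
  have fdx (i : Fin 3) (d' : Spacetime) : fderiv ℝ (dx i φ) (hypMap z) d' =
      P d' (0, EuclideanSpace.single i 1) := by
    have h : HasFDerivAt (dx i φ) _ _ :=
      hasFDerivAt_fderiv_apply hφ (0, EuclideanSpace.single i 1)
    rw [h.fderiv]; rfl
  have h1 (d : Spacetime) : hess (hypPull φ) z d (1, 0) =
      (d.1 / hypTime z - z.1 * ((z.1 * d.1 + inner ℝ z.2 d.2) / hypTime z) / hypTime z ^ 2) *
          dt φ (hypMap z) +
        z.1 / hypTime z * ((z.1 * d.1 + inner ℝ z.2 d.2) / hypTime z * P (1, 0) (1, 0) +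
          P (0, d.2) (1, 0)) := by
    have a1 : HasDerivAt (fun ε : ℝ => hypTime (z + ε • d)) _ 0 := hasLineDerivAt_hypTime hz d
    have a2 : HasDerivAt (fun ε : ℝ => (z + ε • d).1) _ 0 := hasLineDerivAt_fst z d
    have a3 : HasDerivAt (fun ε : ℝ => dt φ (hypMap (z + ε • d))) _ 0 :=
      hasLineDerivAt_comp_hypMap hz dtd d
    have a4 := (a2.fun_div a1 (by simpa using ht.ne')).fun_mul a3
    -- The Hessian of the pull-back is identified by differentiating the first-order chain rule and
    -- using uniqueness of derivatives.
    have a5 := (hasLineDerivAt_dt hU d).congr_of_eventuallyEq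
      (f₁ := fun w => w.1 / hypTime w * dt φ (hypMap w)) (by
        filter_upwards [hev] with w hw using (dt_hypPull hw.1 hw.2).symm)
    refine a5.unique (HasDerivAt.congr_deriv a4 ?_)
    simp only [zero_smul, add_zero, fdt, dt]
    field_simp
  have h2 (i : Fin 3) (d : Spacetime) :
      hess (hypPull φ) z d (0, EuclideanSpace.single i 1) =
      (d.2 i / hypTime z - z.2 i * ((z.1 * d.1 + inner ℝ z.2 d.2) / hypTime z) /
          hypTime z ^ 2) * dt φ (hypMap z) +
        z.2 i / hypTime z * ((z.1 * d.1 + inner ℝ z.2 d.2) / hypTime z * P (1, 0) (1, 0) +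
          P (0, d.2) (1, 0)) +
        ((z.1 * d.1 + inner ℝ z.2 d.2) / hypTime z * P (1, 0) (0, EuclideanSpace.single i 1) +
          P (0, d.2) (0, EuclideanSpace.single i 1)) := by
    have a1 : HasDerivAt (fun ε : ℝ => hypTime (z + ε • d)) _ 0 := hasLineDerivAt_hypTime hz d
    have a2 : HasDerivAt (fun ε : ℝ => (z + ε • d).2 i) (d.2 i) 0 := by
      simpa using ((hasDerivAt_id (0 : ℝ)).mul_const (d.2 i)).const_add (z.2 i)
    have a3 : HasDerivAt (fun ε : ℝ => dt φ (hypMap (z + ε • d))) _ 0 :=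
      hasLineDerivAt_comp_hypMap hz dtd d
    have a4 : HasDerivAt (fun ε : ℝ => dx i φ (hypMap (z + ε • d))) _ 0 :=
      hasLineDerivAt_comp_hypMap hz (dxd i) d
    have a5 := a4.fun_add ((a2.fun_div a1 (by simpa using ht.ne')).fun_mul a3)
    have a6 := (hasLineDerivAt_dx i hU d).congr_of_eventuallyEq
      (f₁ := fun w => dx i φ (hypMap w) + w.2 i / hypTime w * dt φ (hypMap w)) (by
        filter_upwards [hev] with w hw using (dx_hypPull hw.1 hw.2 i).symm)
    refine a6.unique (HasDerivAt.congr_deriv a5 ?_)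
    have e1 : dt (dx i φ) (hypMap z) = P (1, 0) (0, EuclideanSpace.single i 1) := fdx i _
    have e2 : dt (dt φ) (hypMap z) = P (1, 0) (1, 0) := fdt _
    simp only [zero_smul, add_zero, fdt, fdx, e1, e2]
    field_simp
    ring
  have hbox : box φ (hypMap z) = -P (1, 0) (1, 0) +
      ∑ i, P (0, EuclideanSpace.single i 1) (0, EuclideanSpace.single i 1) := by
    simp only [box]
    congr 1
    · rw [← fdt]; rfl
    · exact Finset.sum_congr rfl fun i _ => by rw [← fdx]; rfl
  have i3 : inner ℝ z.2 z.2 = ‖z.2‖ ^ 2 := real_inner_self_eq_norm_sq _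
  have hsym (d d' : Spacetime) : P d d' = P d' d := hess_symm hφ d d'
  have hlap : ∑ i, hess (hypPull φ) z (0, EuclideanSpace.single i 1)
      (0, EuclideanSpace.single i 1) =
      (3 / hypTime z - ‖z.2‖ ^ 2 / hypTime z ^ 3) * dt φ (hypMap z) +
        ‖z.2‖ ^ 2 / hypTime z ^ 2 * P (1, 0) (1, 0) + 2 / hypTime z * P (0, z.2) (1, 0) +
        ∑ i, P (0, EuclideanSpace.single i 1) (0, EuclideanSpace.single i 1) := by
    have e1 : P (0, z.2) (1, 0) = ∑ i, z.2 i * P (1, 0) (0, EuclideanSpace.single i 1) := by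
      rw [hsym, clm_apply_zero_mk]
    have e2 : ‖z.2‖ ^ 2 = ∑ i, z.2 i ^ 2 := by
      rw [EuclideanSpace.norm_sq_eq]; simp
    have e3 (i : Fin 3) : P (0, EuclideanSpace.single i 1) (1, 0) =
      P (1, 0) (0, EuclideanSpace.single i 1) := hsym _ _
    simp only [h2, e1, e2, e3, Fin.sum_univ_three, EuclideanSpace.inner_single_right]
    simp
    field_simp
    ring
  simp only [hypBox]
  rw [hlap, hbox, hess_symm hU (1, 0) (0, z.2), h1, h1]
  simp only [i3, inner_zero_right, mul_one, mul_zero, add_zero, zero_add, zero_div]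
  have e0 : P ((0 : ℝ), (0 : Space)) (1, 0) = 0 := by
    have : (((0 : ℝ), (0 : Space)) : Spacetime) = 0 := rfl
    rw [this]; simp
  rw [e0]
  have hn : ‖z.2‖ ^ 2 = hypTime z ^ 2 - z.1 ^ 2 := by linarith
  rw [hn, dt_hypPull hz (hφ.differentiableAt (by norm_num))]
  field_simp
  ring

end

/-! ### The energy norms in hyperboloidal coordinates -/

/-- The squared norm of the angular gradient. -/
def angSq (U : Spacetime → ℝ) (z : Spacetime) : ℝ :=
  ‖grad U z‖ ^ 2 - euler U z ^ 2 / radius z ^ 2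

/-- The conformal `∂ᴮ_r` derivative with weight `r`. -/
def conjR (U : Spacetime → ℝ) (z : Spacetime) : ℝ :=
  (hypTime z - radius z) / z.1 * dt U z + (euler U z + U z) / radius z

/-- The conformal `∂ᴮ_u` derivative with weight `s²`. -/
def conjSU (U : Spacetime → ℝ) (z : Spacetime) : ℝ := dt U z + 2 * U z / z.1

/-- The conformal `∂ᴮ_r` derivative with weight `s²`. -/
def conjSR (U : Spacetime → ℝ) (z : Spacetime) : ℝ :=
  (hypTime z - radius z) / z.1 * conjSU U z + euler U z / radius z

lemma norm_pair (y : ℝ) (v : Space) : ‖pair y v‖ = √(y ^ 2 + ‖v‖ ^ 2) := by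
  rw [pair, WithLp.prod_norm_eq_of_L2]
  simp

section

variable {φ W : Spacetime → ℝ} {p z : Spacetime}

lemma dr_eq_euler (φ : Spacetime → ℝ) (p : Spacetime) : dr φ p = euler φ p / radius p := by
  rw [euler, clm_apply_zero_mk, Finset.sum_div]
  exact Finset.sum_congr rfl fun i _ => by simp only [dx]; ring

lemma dt_mul (hW : DifferentiableAt ℝ W p) (hφ : DifferentiableAt ℝ φ p) :
    dt (fun q => W q * φ q) p = W p * dt φ p + φ p * dt W p := by
  simp only [dt]
  rw [fderiv_fun_mul hW hφ]
  simp

lemma euler_mul (hW : DifferentiableAt ℝ W p) (hφ : DifferentiableAt ℝ φ p) :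
    euler (fun q => W q * φ q) p = W p * euler φ p + φ p * euler W p := by
  simp only [euler]
  rw [fderiv_fun_mul hW hφ]
  simp

lemma dr_mul (hW : DifferentiableAt ℝ W p) (hφ : DifferentiableAt ℝ φ p) :
    dr (fun q => W q * φ q) p = W p * dr φ p + φ p * dr W p := by
  simp only [dr_eq_euler, euler_mul hW hφ]
  ring

lemma differentiableAt_weightR (hp : p.2 ≠ 0) : DifferentiableAt ℝ weightR p :=
  (contDiffAt_radius (n := 1) hp).differentiableAt one_ne_zero

lemma fderiv_weightR (hp : p.2 ≠ 0) (d : Spacetime) :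
    fderiv ℝ weightR p d = inner ℝ p.2 d.2 / radius p :=
  ((differentiableAt_weightR hp).hasFDerivAt.hasLineDerivAt d).unique (hasLineDerivAt_radius hp d)

lemma dt_weightR (hp : p.2 ≠ 0) : dt weightR p = 0 := by
  simp [dt, fderiv_weightR hp]

lemma dr_weightR (hp : p.2 ≠ 0) : dr weightR p = 1 := by
  have hr : ‖p.2‖ ≠ 0 := norm_ne_zero_iff.2 hp
  rw [dr_eq_euler, euler, fderiv_weightR hp]
  simp only [real_inner_self_eq_norm_sq, radius]
  field_simp

lemma hasFDerivAt_weightS (p : Spacetime) : HasFDerivAt weightS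
    ((2 * p.1) • ContinuousLinearMap.fst ℝ ℝ Space -
      (2 : ℝ) • (innerSL ℝ p.2).comp (ContinuousLinearMap.snd ℝ ℝ Space)) p := by
  have h1 := HasFDerivAt.pow (hasFDerivAt_fst (𝕜 := ℝ) (E := ℝ) (F := Space) (p := p)) 2
  have h2 := (hasFDerivAt_snd (𝕜 := ℝ) (E := ℝ) (F := Space) (p := p)).norm_sq
  have h3 : HasFDerivAt weightS _ p := h1.sub h2
  refine h3.congr_fderiv ?_
  ext <;> simp

lemma dt_weightS (p : Spacetime) : dt weightS p = 2 * p.1 := by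
  simp [dt, (hasFDerivAt_weightS p).fderiv]

lemma dr_weightS (hp : p.2 ≠ 0) : dr weightS p = -2 * radius p := by
  have hr : ‖p.2‖ ≠ 0 := norm_ne_zero_iff.2 hp
  rw [dr_eq_euler, euler, (hasFDerivAt_weightS p).fderiv]
  simp [radius]
  field_simp

lemma weightS_hypMap (z : Spacetime) : weightS (hypMap z) = z.1 ^ 2 := by
  simp only [weightS, hypMap, radius]
  linarith [hypTime_sq z]

/-- The gradients of `φ` in `x` at fixed `t` and at fixed `s` differ by the radial vector `(x/t) ∂_t
φ`, so their angular parts coincide. -/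
lemma norm_angGrad_sq (hz : 0 < z.1) (hx : z.2 ≠ 0) (hφ : DifferentiableAt ℝ φ (hypMap z)) :
    ‖angGrad φ (hypMap z)‖ ^ 2 = angSq (hypPull φ) z := by
  have hr : ‖z.2‖ ≠ 0 := norm_ne_zero_iff.2 hx
  have ht := (hypTime_pos hz).ne'
  have e2 : ‖z.2‖ ^ 2 = ∑ i, z.2 i ^ 2 := by
    rw [EuclideanSpace.norm_sq_eq]; simp
  have e3 : euler φ (hypMap z) = ∑ i, z.2 i * dx i φ (hypMap z) := by
    rw [euler, clm_apply_zero_mk]; rfl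
  have e4 : ‖grad (hypPull φ) z‖ ^ 2 = (∑ i, dx i φ (hypMap z) ^ 2) +
      2 * dt φ (hypMap z) / hypTime z * euler φ (hypMap z) +
      ‖z.2‖ ^ 2 / hypTime z ^ 2 * dt φ (hypMap z) ^ 2 := by
    rw [norm_grad_sq, e3, e2]
    simp only [dx_hypPull hz hφ, Fin.sum_univ_three]
    field_simp
    ring
  have e5 : ‖angGrad φ (hypMap z)‖ ^ 2 = (∑ i, dx i φ (hypMap z) ^ 2) -
      2 * dr φ (hypMap z) / ‖z.2‖ * euler φ (hypMap z) +
      dr φ (hypMap z) ^ 2 / ‖z.2‖ ^ 2 * ∑ i, z.2 i ^ 2 := by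
    rw [EuclideanSpace.norm_sq_eq, e3]
    simp only [angGrad, Fin.sum_univ_three, Real.norm_eq_abs, sq_abs, hypMap, radius]
    field_simp
    ring
  rw [e5, ← e2, angSq, e4, dr_eq_euler, euler_hypPull hz hφ]
  simp only [radius, hypMap]
  field_simp
  ring

lemma bondiU_weightR (hz : 0 < z.1) (hx : z.2 ≠ 0) (hφ : DifferentiableAt ℝ φ (hypMap z)) :
    z.1 / (hypMap z).1 * (bondiU (fun q => weightR q * φ q) (hypMap z) / weightR (hypMap z)) =
      dt (hypPull φ) z := by
  have hr : weightR (hypMap z) ≠ 0 := norm_ne_zero_iff.2 hx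
  rw [bondiU, dt_mul (differentiableAt_weightR (p := hypMap z) hx) hφ,
    dt_weightR (p := hypMap z) hx, dt_hypPull hz hφ]
  simp only [hypMap] at *
  field_simp
  ring

lemma bondiR_weightR (hz : 0 < z.1) (hx : z.2 ≠ 0) (hφ : DifferentiableAt ℝ φ (hypMap z)) :
    bondiR (fun q => weightR q * φ q) (hypMap z) / weightR (hypMap z) =
      conjR (hypPull φ) z := by
  have hr : ‖z.2‖ ≠ 0 := norm_ne_zero_iff.2 hx
  have ht := (hypTime_pos hz).ne'
  rw [bondiR, dt_mul (differentiableAt_weightR (p := hypMap z) hx) hφ,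
    dr_mul (differentiableAt_weightR (p := hypMap z) hx) hφ, dt_weightR (p := hypMap z) hx,
    dr_weightR (p := hypMap z) hx, dr_eq_euler, conjR, dt_hypPull hz hφ, euler_hypPull hz hφ]
  simp only [hypMap, weightR, radius, hypPull]
  field_simp
  ring

lemma bondiU_weightS (hz : 0 < z.1) (hφ : DifferentiableAt ℝ φ (hypMap z)) :
    z.1 / (hypMap z).1 * (bondiU (fun q => weightS q * φ q) (hypMap z) / weightS (hypMap z)) =
      conjSU (hypPull φ) z := by
  have ht := (hypTime_pos hz).ne'
  rw [bondiU, dt_mul (hasFDerivAt_weightS _).differentiableAt hφ, dt_weightS, weightS_hypMap,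
    conjSU, dt_hypPull hz hφ]
  simp only [hypMap, hypPull]
  field_simp

lemma bondiR_weightS (hz : 0 < z.1) (hx : z.2 ≠ 0) (hφ : DifferentiableAt ℝ φ (hypMap z)) :
    bondiR (fun q => weightS q * φ q) (hypMap z) / weightS (hypMap z) =
      conjSR (hypPull φ) z := by
  have hr : ‖z.2‖ ≠ 0 := norm_ne_zero_iff.2 hx
  have ht := (hypTime_pos hz).ne'
  rw [bondiR, dt_mul (hasFDerivAt_weightS _).differentiableAt hφ,
    dr_mul (hasFDerivAt_weightS _).differentiableAt hφ, dt_weightS, dr_weightS (p := hypMap z) hx,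
    weightS_hypMap, conjSR, conjSU, dr_eq_euler, dt_hypPull hz hφ, euler_hypPull hz hφ]
  simp only [hypMap, hypPull, radius]
  field_simp
  ring

lemma jap_pos (y : ℝ) : 0 < jap y := by unfold jap; positivity

lemma hypMap_mk (s : ℝ) (x : Space) : hypMap (s, x) = (√(s ^ 2 + ‖x‖ ^ 2), x) := rfl

lemma ae_ne_zero : ∀ᵐ x : Space, x ≠ 0 := by simp [ae_iff, measure_singleton]

lemma energyW_eq {s : ℝ} (hs : 0 < s) (hφ : ∀ x, DifferentiableAt ℝ φ (hypMap (s, x))) :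
    energyW s φ = eLpNorm (fun x => dt (hypPull φ) (s, x)) 2 volume +
      eLpNorm (fun x => ‖grad (hypPull φ) (s, x)‖) 2 volume := by
  simp only [energyW, hypL2, eLpNorm_norm]
  congr 2
  · funext x
    rw [dt_hypPull (z := (s, x)) hs (hφ x)]
    rfl
  · funext x
    rw [grad_hypPull (z := (s, x)) hs (hφ x)]
    rfl

/-- The formulas for the derivatives divide by `r`. Pointwise identities are required only off the
origin, which is a null set. -/
lemma hypL2_smul_pair {s : ℝ} {w y : Spacetime → ℝ} {v : Spacetime → Space} {w' k : Space → ℝ}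
    (h : ∀ x : Space, x ≠ 0 → 0 ≤ w (hypMap (s, x)) ∧ w (hypMap (s, x)) = w' x ∧
      y (hypMap (s, x)) ^ 2 + ‖v (hypMap (s, x))‖ ^ 2 = k x) :
    hypL2 s (fun p => w p • pair (y p) (v p)) = eLpNorm (fun x => w' x * √(k x)) 2 volume := by
  rw [hypL2, ← eLpNorm_norm]
  refine eLpNorm_congr_ae ?_
  filter_upwards [ae_ne_zero] with x hx
  obtain ⟨h1, h2, h3⟩ := h x hx
  rw [hypMap_mk] at h1 h2 h3
  rw [norm_smul, norm_pair, h3, Real.norm_of_nonneg h1, h2]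

lemma energyR_eq {a s : ℝ} (ha : 0 ≤ a) (hs : 0 < s)
    (hφ : ∀ x, DifferentiableAt ℝ φ (hypMap (s, x))) :
    energyR a s φ =
      eLpNorm (fun x => (1 + a * jap (nullCoord (s, x)).2 ^ a *
        (jap (nullCoord (s, x)).1 / jap (nullCoord (s, x)).2) ^ max a (1 / 2)) *
          √(dt (hypPull φ) (s, x) ^ 2 + angSq (hypPull φ) (s, x))) 2 volume +
      eLpNorm (fun x => jap (nullCoord (s, x)).2 ^ a * √(conjR (hypPull φ) (s, x) ^ 2 +
        (s / hypTime (s, x)) ^ 2 * angSq (hypPull φ) (s, x))) 2 volume := by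
  have j (y : ℝ) : 0 ≤ jap y := (jap_pos y).le
  rw [energyR]
  congr 1
  · refine hypL2_smul_pair fun x hx => ⟨?_, rfl, ?_⟩
    · have h1 := j ((hypMap (s, x)).1 + radius (hypMap (s, x)))
      have h2 := j ((hypMap (s, x)).1 - radius (hypMap (s, x)))
      simp only [tauPlus, tauZero, tauMinus]
      positivity
    · rw [bondiU_weightR (z := (s, x)) hs hx (hφ x), norm_angGrad_sq (z := (s, x)) hs hx (hφ x)]
  · refine hypL2_smul_pair fun x hx => ⟨?_, rfl, ?_⟩
    · exact Real.rpow_nonneg (j _) _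
    · rw [bondiR_weightR (z := (s, x)) hs hx (hφ x), norm_smul, mul_pow,
        norm_angGrad_sq (z := (s, x)) hs hx (hφ x), Real.norm_eq_abs, sq_abs]
      rfl

lemma energyS_eq {a s : ℝ} (hs : 0 < s)
    (hφ : ∀ x, DifferentiableAt ℝ φ (hypMap (s, x))) :
    energyS a s φ =
      eLpNorm (fun x => (1 + s ^ (a - 1) * jap (nullCoord (s, x)).1) *
          √(conjSU (hypPull φ) (s, x) ^ 2 + angSq (hypPull φ) (s, x))) 2 volume +
      eLpNorm (fun x => (s ^ (a - 1) * jap (nullCoord (s, x)).2) *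
        √(conjSR (hypPull φ) (s, x) ^ 2 +
          (s / hypTime (s, x)) ^ 2 * angSq (hypPull φ) (s, x))) 2 volume := by
  have j (y : ℝ) : 0 ≤ jap y := (jap_pos y).le
  have hsa : 0 ≤ s ^ (a - 1) := Real.rpow_nonneg hs.le _
  rw [energyS]
  congr 1
  · refine hypL2_smul_pair fun x hx => ⟨?_, rfl, ?_⟩
    · exact add_nonneg zero_le_one (mul_nonneg hsa (j _))
    · rw [bondiU_weightS (z := (s, x)) hs (hφ x), norm_angGrad_sq (z := (s, x)) hs hx (hφ x)]
  · refine hypL2_smul_pair fun x hx => ⟨?_, rfl, ?_⟩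
    · exact mul_nonneg hsa (j _)
    · rw [bondiR_weightS (z := (s, x)) hs hx (hφ x), norm_smul, mul_pow,
        norm_angGrad_sq (z := (s, x)) hs hx (hφ x), Real.norm_eq_abs, sq_abs]
      rfl

lemma hypMap_mem_slab {s₀ s₁ s : ℝ} (h0 : 0 < s₀) (hs : s ∈ Icc s₀ s₁) (x : Space) :
    hypMap (s, x) ∈ slab s₀ s₁ := by
  have hs0 : 0 < s := h0.trans_le hs.1
  have e : (hypMap (s, x)).1 ^ 2 - radius (hypMap (s, x)) ^ 2 = s ^ 2 := weightS_hypMap (s, x)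
  refine ⟨hypTime_pos (z := (s, x)) hs0, ?_, ?_⟩
  · rw [e]; exact pow_le_pow_left₀ h0.le hs.1 2
  · rw [e]; exact pow_le_pow_left₀ hs0.le hs.2 2

lemma sourceNorm_eq {a s₀ s₁ : ℝ} {F : Spacetime → ℝ} (h0 : 0 < s₀)
    (hφ : ∀ p ∈ slab s₀ s₁, ContDiffAt ℝ 2 φ p) (hF : ∀ p ∈ slab s₀ s₁, box φ p = F p) :
    sourceNorm a s₀ s₁ F = ∫⁻ s in Icc s₀ s₁,
      eLpNorm (fun x => jap (nullCoord (s, x)).2 ^ a * hypBox (hypPull φ) (s, x)) 2 volume := by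
  refine setLIntegral_congr_fun measurableSet_Icc fun s hs => ?_
  simp only [hypL2]
  congr 1
  funext x
  have hm := hypMap_mem_slab h0 hs x
  rw [hypBox_hypPull (z := (s, x)) (h0.trans_le hs.1) (hφ _ hm), hF _ hm]
  rfl

/-- A solution with compact support in the slab is regular in hyperboloidal coordinates. -/
lemma exists_regular {s₀ s₁ : ℝ} (h0 : 1 ≤ s₀) (h01 : s₀ < s₁)
    (hφ : ∀ p ∈ slab s₀ s₁, ContDiffAt ℝ 2 φ p)
    (hS : ∃ S : Set Spacetime, IsCompact S ∧ ∀ p ∈ slab s₀ s₁, φ p ≠ 0 → p ∈ S) :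
    ∃ K, Regular (hypPull φ) s₀ s₁ K := by
  obtain ⟨S, hS, hφS⟩ := hS
  obtain ⟨ρ, hρ⟩ := (hS.image continuous_snd).isBounded.subset_closedBall 0
  have h0' : 0 < s₀ := by linarith
  have hc (s : ℝ) (hs : s ∈ Icc s₀ s₁) (x : Space) : ContDiffAt ℝ 2 (hypPull φ) (s, x) :=
    contDiffAt_hypPull (h0'.trans_le hs.1) (hφ _ (hypMap_mem_slab h0' hs x))
  have hz (s : ℝ) (hs : s ∈ Icc s₀ s₁) (x : Space) (hx : x ∉ Metric.closedBall (0 : Space) ρ) :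
      hypPull φ (s, x) = 0 := by
    by_contra hne
    exact hx (hρ ⟨_, hφS _ (hypMap_mem_slab h0' hs x) hne, rfl⟩)
  -- Derivatives at the faces `s = s₀` and `s = s₁` are determined by values inside the slab, by
  -- unique differentiability. This needs `s₀ < s₁`. The argument is used for `U` and then for its
  -- derivative.
  have hu : UniqueDiffOn ℝ (Icc s₀ s₁ ×ˢ (Metric.closedBall (0 : Space) ρ)ᶜ) :=
    (uniqueDiffOn_Icc h01).prod Metric.isClosed_closedBall.isOpen_compl.uniqueDiffOn
  have aux {E : Type} [NormedAddCommGroup E] [NormedSpace ℝ E] {G : Spacetime → E}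
      (hG : ∀ s ∈ Icc s₀ s₁, ∀ x, DifferentiableAt ℝ G (s, x))
      (hG0 : ∀ s ∈ Icc s₀ s₁, ∀ x ∉ Metric.closedBall (0 : Space) ρ, G (s, x) = 0) (s : ℝ)
      (hs : s ∈ Icc s₀ s₁) (x : Space) (hx : x ∉ Metric.closedBall (0 : Space) ρ) :
      fderiv ℝ G (s, x) = 0 := by
    have hm : (s, x) ∈ Icc s₀ s₁ ×ˢ (Metric.closedBall (0 : Space) ρ)ᶜ := ⟨hs, hx⟩
    rw [← (hG s hs x).fderivWithin (hu _ hm), fderivWithin_congr (f₁ := G) (f := fun _ => 0)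
      (fun z hz => hG0 z.1 hz.1 z.2 hz.2) (hG0 s hs x hx)]
    simp
  have hz1 := aux (fun s hs x => (hc s hs x).differentiableAt (by norm_num)) hz
  exact ⟨Metric.closedBall 0 ρ, h0, isCompact_closedBall _ _, hc, hz, hz1,
    aux (fun s hs x => (contDiffAt_fderiv (hc s hs x)).differentiableAt one_ne_zero) hz1⟩

end

/-! ### Null weights -/

section

variable {y : ℝ × ℝ}

lemma snd_pos_of_mem (hy : y ∈ nullRegion) : 0 < y.2 := hy.1.trans_le hy.2.1

lemma one_le_snd_of_mem (hy : y ∈ nullRegion) : 1 ≤ y.2 := by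
  nlinarith [hy.1, hy.2.1, hy.2.2, (snd_pos_of_mem hy)]

lemma contDiffAt_rpow_fst (hy : 0 < y.1) (k : ℝ) :
    ContDiffAt ℝ 1 (fun y : ℝ × ℝ => y.1 ^ k) y :=
  contDiffAt_fst.rpow_const_of_ne hy.ne'

lemma contDiffAt_rpow_snd (hy : 0 < y.2) (k : ℝ) :
    ContDiffAt ℝ 1 (fun y : ℝ × ℝ => y.2 ^ k) y :=
  contDiffAt_snd.rpow_const_of_ne hy.ne'

lemma hasFDerivAt_rpow_fst (hy : 0 < y.1) (k : ℝ) : HasFDerivAt (fun y : ℝ × ℝ => y.1 ^ k)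
    ((k * y.1 ^ (k - 1)) • ContinuousLinearMap.fst ℝ ℝ ℝ) y :=
  (Real.hasDerivAt_rpow_const (Or.inl hy.ne')).comp_hasFDerivAt y hasFDerivAt_fst

lemma hasFDerivAt_rpow_snd (hy : 0 < y.2) (k : ℝ) : HasFDerivAt (fun y : ℝ × ℝ => y.2 ^ k)
    ((k * y.2 ^ (k - 1)) • ContinuousLinearMap.snd ℝ ℝ ℝ) y :=
  (Real.hasDerivAt_rpow_const (Or.inl hy.ne')).comp_hasFDerivAt y hasFDerivAt_snd

/-- The time translation `∂_t`, for the standard energy. -/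
lemma admissible_one : Admissible (fun _ => 1) (fun _ => 1) where
  contDiffAt_fst := fun _ _ => contDiffAt_const
  contDiffAt_snd := fun _ _ => contDiffAt_const
  nonneg := fun _ _ => zero_le_one
  le := fun _ _ => le_rfl
  fst_deriv := fun _ _ => by simp
  snd_deriv := fun _ _ => by simp
  angular := fun _ _ => by simp

/-- The conformal vector field `(q²(∂_t + ∂_r) + p²(∂_t - ∂_r))/2`. The bulk term vanishes: `f_p =
g_q = 0`, and the angular condition is the equality `(2q + 2p)(q - p) = 2(q² - p²)`. -/
lemma admissible_sq : Admissible (fun y => y.2 ^ 2) (fun y => y.1 ^ 2) where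
  contDiffAt_fst := fun _ _ => contDiffAt_snd.pow 2
  contDiffAt_snd := fun _ _ => contDiffAt_fst.pow 2
  nonneg := fun _ _ => sq_nonneg _
  le := fun _ hy => pow_le_pow_left₀ hy.1.le hy.2.1 2
  fst_deriv := fun y _ => by
    simp [(HasFDerivAt.pow (hasFDerivAt_snd (𝕜 := ℝ) (p := y)) 2).fderiv]
  snd_deriv := fun y _ => by
    simp [(HasFDerivAt.pow (hasFDerivAt_fst (𝕜 := ℝ) (p := y)) 2).fderiv]
  angular := fun y _ => by
    simp only [(HasFDerivAt.pow (hasFDerivAt_snd (𝕜 := ℝ) (p := y)) 2).fderiv,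
      (HasFDerivAt.pow (hasFDerivAt_fst (𝕜 := ℝ) (p := y)) 2).fderiv]
    simp
    nlinarith

lemma rpow_two_mul_eq {x : ℝ} (hx : 0 < x) (a : ℝ) : x ^ (2 * a) = x * x ^ (2 * a - 1) := by
  rw [Real.rpow_sub hx, Real.rpow_one, mul_div_cancel₀ _ hx.ne']

variable {a p q : ℝ}

/-- The weighted arithmetic-geometric mean inequality behind the angular condition. -/
lemma mul_rpow_mul_sub_le (ha : 0 ≤ a) (ha1 : a ≤ 1) (hp : 0 < p) (hq : 0 < q) (hpq : 1 ≤ p * q) :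
    a * q ^ (2 * a - 1) * (q - p) ≤ q * q ^ (2 * a - 1) - 1 := by
  have h := Real.geom_mean_le_arith_mean2_weighted (w₁ := 1 - a) (w₂ := a) (by linarith) ha
    hq.le hp.le (by ring)
  -- The right-hand side is `(pq)^a`, which is at least `1` on hyperboloids with `s ≥ 1`.
  have h1 : 1 ≤ q ^ (2 * a - 1) * (q ^ (1 - a) * p ^ a) := by
    rw [← mul_assoc, ← Real.rpow_add hq, show 2 * a - 1 + (1 - a) = a by ring,
      ← Real.mul_rpow hq.le hp.le]
    exact Real.one_le_rpow (by linarith) ha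
  have h2 := mul_le_mul_of_nonneg_left h (Real.rpow_nonneg hq.le (2 * a - 1))
  linarith

/-- The mean inequality with weights `2a - 1` and `2 - 2a` gives `p^(2a-1) q ≤ q^(2a-1) ((2a - 1) p
+ (2 - 2a) q)`. Nonnegativity of the first weight is where `a ≥ 1/2` is essential. -/
lemma rpow_angular_le (ha : 1 / 2 ≤ a) (ha1 : a ≤ 1) (hp : 0 < p) (hpq : p ≤ q) :
    (2 * a * q ^ (2 * a - 1) + a * p ^ (2 * a - 1)) * (q - p) ≤
      2 * (q * q ^ (2 * a - 1)) - p * p ^ (2 * a - 1) := by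
  have hq : 0 < q := hp.trans_le hpq
  have h := Real.geom_mean_le_arith_mean2_weighted (w₁ := 2 * a - 1) (w₂ := 2 - 2 * a)
    (by linarith) (by linarith) hp.le hq.le (by ring)
  have hA := Real.rpow_pos_of_pos hq (2 * a - 1)
  have h1 : q ^ (2 - 2 * a) * q ^ (2 * a - 1) = q := by
    rw [← Real.rpow_add hq]; ring_nf; exact Real.rpow_one q
  have h2 := mul_le_mul_of_nonneg_right h hA.le
  rw [mul_assoc, h1] at h2
  generalize q ^ (2 * a - 1) = A at *
  generalize p ^ (2 * a - 1) = B at *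
  -- In the variables `y = q - p` and `b = 1 - a` the claim reads `B (p + (1 - b) y) ≤ 2 A (p + b
  -- y)`, and the mean inequality reads `B (p + y) ≤ A (p + 2 b y)`.
  obtain ⟨y, rfl⟩ : ∃ y, q = p + y := ⟨q - p, by ring⟩
  obtain ⟨b, rfl⟩ : ∃ b, a = 1 - b := ⟨1 - a, by ring⟩
  have hy : 0 ≤ y := by linarith
  have hb : 0 ≤ b := by linarith
  have ha0 : 0 ≤ 1 - b := by linarith
  have h3 : B * (p + y) * (p + (1 - b) * y) ≤ A * (p + 2 * b * y) * (p + (1 - b) * y) := by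
    refine mul_le_mul_of_nonneg_right ?_ (by positivity)
    linarith
  have h4 : (p + 2 * b * y) * (p + (1 - b) * y) ≤ 2 * (p + b * y) * (p + y) := by
    have e : 2 * (p + b * y) * (p + y) - (p + 2 * b * y) * (p + (1 - b) * y) =
      p ^ 2 + (1 + b) * (p * y) + 2 * b ^ 2 * y ^ 2 := by ring
    have : 0 ≤ p ^ 2 + (1 + b) * (p * y) + 2 * b ^ 2 * y ^ 2 := by positivity
    linarith
  have h5 := mul_le_mul_of_nonneg_left h4 hA.le
  have h6 : B * (p + (1 - b) * y) ≤ A * (2 * (p + b * y)) := by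
    refine le_of_mul_le_mul_right ?_ hq
    linarith
  linarith

/-- The factor `3` is `1 + 2`: one copy of `q^(2a)` compensates the constant `1` in `g`
(`mul_rpow_mul_sub_le`), two copies compensate `p^(2a)` (`rpow_angular_le`). -/
lemma admissible_of_half_le (ha : 1 / 2 ≤ a) (ha1 : a ≤ 1) :
    Admissible (fun y => 3 * y.2 ^ (2 * a)) (fun y => 1 + y.1 ^ (2 * a)) where
  contDiffAt_fst := fun y hy => contDiffAt_const.mul (contDiffAt_rpow_snd (snd_pos_of_mem hy) _)
  contDiffAt_snd := fun y hy => contDiffAt_const.add (contDiffAt_rpow_fst hy.1 _)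
  nonneg := fun y hy => add_nonneg zero_le_one (Real.rpow_nonneg hy.1.le _)
  le := fun y hy => by
    have h1 : y.1 ^ (2 * a) ≤ y.2 ^ (2 * a) := Real.rpow_le_rpow hy.1.le hy.2.1 (by linarith)
    have h2 : 1 ≤ y.2 ^ (2 * a) := Real.one_le_rpow (one_le_snd_of_mem hy) (by linarith)
    show 1 + y.1 ^ (2 * a) ≤ 3 * y.2 ^ (2 * a)
    linarith
  fst_deriv := fun y hy => by
    rw [((hasFDerivAt_rpow_snd (snd_pos_of_mem hy) (2 * a)).const_mul 3).fderiv]; simp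
  snd_deriv := fun y hy => by
    rw [((hasFDerivAt_rpow_fst hy.1 (2 * a)).const_add 1).fderiv]; simp
  angular := fun y hy => by
    rw [((hasFDerivAt_rpow_snd (snd_pos_of_mem hy) (2 * a)).const_mul 3).fderiv,
      ((hasFDerivAt_rpow_fst hy.1 (2 * a)).const_add 1).fderiv]
    have h1 := mul_rpow_mul_sub_le (by linarith) ha1 hy.1 (snd_pos_of_mem hy) hy.2.2
    have h2 := rpow_angular_le ha ha1 hy.1 hy.2.1
    simp [rpow_two_mul_eq hy.1, rpow_two_mul_eq (snd_pos_of_mem hy)]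
    linarith

/-- For `a < 1/2` the derivative of `p^(2a)` in `p` is unbounded as `p → 0`, so a weight linear in
`p` replaces it. It decreases in `q` since `2a - 1 ≤ 0`. In the angular condition two copies of
`q^(2a)` pay for the constant `1`, and the other four for the term with `a²`. -/
lemma admissible_of_le_half (ha0 : 0 ≤ a) (ha : a ≤ 1 / 2) :
    Admissible (fun y => 3 * y.2 ^ (2 * a))
      (fun y => 1 + y.1 * (a ^ 2 * y.2 ^ (2 * a - 1))) where
  contDiffAt_fst := fun y hy => contDiffAt_const.mul (contDiffAt_rpow_snd (snd_pos_of_mem hy) _)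
  contDiffAt_snd := fun y hy => contDiffAt_const.add
    (contDiffAt_fst.mul (contDiffAt_const.mul (contDiffAt_rpow_snd (snd_pos_of_mem hy) _)))
  nonneg := fun y hy => by
    have := hy.1; have := (snd_pos_of_mem hy)
    positivity
  le := fun y hy => by
    have h2 : 1 ≤ y.2 ^ (2 * a) := Real.one_le_rpow (one_le_snd_of_mem hy) (by linarith)
    have h0 : 0 ≤ y.2 ^ (2 * a - 1) := Real.rpow_nonneg (snd_pos_of_mem hy).le _
    have h1 : y.1 * (a ^ 2 * y.2 ^ (2 * a - 1)) ≤ y.2 * (1 * y.2 ^ (2 * a - 1)) := by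
      have := hy.1.le; have := hy.2.1; have := (snd_pos_of_mem hy).le
      gcongr
      nlinarith
    rw [one_mul, ← rpow_two_mul_eq (snd_pos_of_mem hy)] at h1
    linarith
  fst_deriv := fun y hy => by
    rw [((hasFDerivAt_rpow_snd (snd_pos_of_mem hy) (2 * a)).const_mul 3).fderiv]; simp
  snd_deriv := fun y hy => by
    rw [((hasFDerivAt_fst.fun_mul ((hasFDerivAt_rpow_snd (snd_pos_of_mem hy) (2 * a - 1)).const_mul
      (a ^ 2))).const_add 1).fderiv]
    have h0 : 0 ≤ y.2 ^ (2 * a - 1 - 1) := Real.rpow_nonneg (snd_pos_of_mem hy).le _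
    have h1 : 0 ≤ y.1 * (a ^ 2 * ((1 - 2 * a) * y.2 ^ (2 * a - 1 - 1))) := by
      have := hy.1; have : 0 ≤ 1 - 2 * a := by linarith
      positivity
    simp
    linarith
  angular := fun y hy => by
    rw [((hasFDerivAt_rpow_snd (snd_pos_of_mem hy) (2 * a)).const_mul 3).fderiv,
      ((hasFDerivAt_fst.fun_mul ((hasFDerivAt_rpow_snd (snd_pos_of_mem hy) (2 * a - 1)).const_mul
      (a ^ 2))).const_add 1).fderiv]
    have h1 := mul_rpow_mul_sub_le ha0 (by linarith) hy.1 (snd_pos_of_mem hy) hy.2.2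
    have h0 : 0 ≤ y.2 ^ (2 * a - 1) := Real.rpow_nonneg (snd_pos_of_mem hy).le _
    simp [rpow_two_mul_eq (snd_pos_of_mem hy)]
    have h2 : 0 ≤ y.2 ^ (2 * a - 1) * ((4 - 4 * a - a ^ 2) * (y.2 - y.1) +
        (4 - 2 * a ^ 2) * y.1) := by
      have h3 := hy.1.le
      have h4 := sub_nonneg.2 hy.2.1
      have h5 : 0 ≤ 4 - 4 * a - a ^ 2 := by nlinarith
      have h6 : 0 ≤ 4 - 2 * a ^ 2 := by nlinarith
      positivity
    linarith

/-! ### Comparison of the admissible weights with powers of `τ₊` and `τ₋`. -/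

lemma jap_sq (x : ℝ) : jap x ^ 2 = 1 + x ^ 2 := Real.sq_sqrt (by positivity)

lemma le_jap {x : ℝ} : x ≤ jap x := Real.le_sqrt_of_sq_le (by linarith)

lemma one_le_jap (x : ℝ) : 1 ≤ jap x := Real.one_le_sqrt.2 (by nlinarith [sq_nonneg x])

lemma jap_le_one_add {x : ℝ} (hx : 0 ≤ x) : jap x ≤ 1 + x :=
  Real.sqrt_le_iff.2 ⟨by linarith, by nlinarith⟩

lemma jap_le_two_mul {x : ℝ} (hx : 1 ≤ x) : jap x ≤ 2 * x := by
  linarith [jap_le_one_add (x := x) (by linarith)]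

lemma rpow_sq_eq {x : ℝ} (hx : 0 ≤ x) (a : ℝ) : (x ^ a) ^ 2 = (x ^ 2) ^ a := by
  rw [← Real.rpow_natCast, ← Real.rpow_mul hx, ← Real.rpow_natCast, ← Real.rpow_mul hx, mul_comm]

/-- The weight of the outgoing derivatives is dominated by an admissible weight. -/
lemma three_mul_rpow_bounds (ha : 0 ≤ a) (ha1 : a ≤ 1) (hq : 1 ≤ q) :
    3 * q ^ (2 * a) ≤ 3 * (jap q ^ a) ^ 2 ∧ (jap q ^ a) ^ 2 ≤ 3 * q ^ (2 * a) := by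
  have hq0 : 0 ≤ q := by linarith
  rw [rpow_sq_eq (jap_pos q).le, jap_sq, Real.rpow_mul hq0, Real.rpow_two]
  refine ⟨by gcongr; linarith, ?_⟩
  calc (1 + q ^ 2) ^ a ≤ (2 * q ^ 2) ^ a := by gcongr; nlinarith
    _ = 2 ^ a * (q ^ 2) ^ a := Real.mul_rpow (by norm_num) (by positivity)
    _ ≤ 3 * (q ^ 2) ^ a := by
      gcongr
      have := Real.rpow_le_rpow_of_exponent_le (x := 2) (by norm_num) ha1
      rw [Real.rpow_one] at this
      linarith

/-- Here `τ₊^a τ₀^a = τ₋^a`, and `(1 + p²)^a ≤ 1 + p^(2a)` because `a ≤ 1`. The factor `a` in the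
norm is harmless as `a ≥ 1/2`. -/
lemma bounds_of_half_le (ha : 1 / 2 ≤ a) (ha1 : a ≤ 1) (hp : 0 < p) :
    1 + p ^ (2 * a) ≤ 4 * (1 + a * jap q ^ a * (jap p / jap q) ^ max a (1 / 2)) ^ 2 ∧
    (1 + a * jap q ^ a * (jap p / jap q) ^ max a (1 / 2)) ^ 2 ≤ 4 * (1 + p ^ (2 * a)) := by
  have hP := jap_pos p
  have hQ := jap_pos q
  have e : jap q ^ a * (jap p / jap q) ^ a = jap p ^ a := by
    rw [← Real.mul_rpow hQ.le (by positivity), mul_div_cancel₀ _ hQ.ne']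
  have e2 : (jap p ^ a) ^ 2 = (1 + p ^ 2) ^ a := by rw [rpow_sq_eq hP.le, jap_sq]
  rw [max_eq_left ha, mul_assoc, e, Real.rpow_mul hp.le, Real.rpow_two]
  have h1 : (p ^ 2) ^ a ≤ (1 + p ^ 2) ^ a := by
    apply Real.rpow_le_rpow <;> first | positivity | linarith
  have h2 : (1 + p ^ 2) ^ a ≤ 1 + (p ^ 2) ^ a := by
    have := Real.rpow_add_le_add_rpow (a := 1) (b := p ^ 2) (p := a) zero_le_one (sq_nonneg p)
      (by linarith) ha1
    rwa [Real.one_rpow] at this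
  have h0 : 0 ≤ jap p ^ a := by positivity
  rw [← e2] at h1 h2
  generalize jap p ^ a = X at *
  constructor
  · have : 1 / 4 * X ^ 2 ≤ a ^ 2 * X ^ 2 := by gcongr; nlinarith
    have : 0 ≤ a * X := by positivity
    nlinarith
  · have : a * X ≤ X := by nlinarith
    have : 0 ≤ a * X := by positivity
    have : (a * X) ^ 2 ≤ X ^ 2 := by gcongr
    have : 0 ≤ (p ^ 2) ^ a := by positivity
    nlinarith [sq_nonneg (a * X - 1)]

/-- Here `(τ₊^a τ₀^(1/2))² = τ₊^(2a-1) τ₋`. Since `q ≤ τ₊ ≤ 2q` and the exponent lies in `[-1, 0]`,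
replacing `τ₊` by `q` costs at most a factor `2`. The excess of `τ₋` over `p` is absorbed by the
constant `1`. -/
lemma bounds_of_le_half (ha0 : 0 ≤ a) (ha : a ≤ 1 / 2) (hp : 0 < p) (hq : 1 ≤ q) :
    1 + p * (a ^ 2 * q ^ (2 * a - 1)) ≤
      4 * (1 + a * jap q ^ a * (jap p / jap q) ^ max a (1 / 2)) ^ 2 ∧
    (1 + a * jap q ^ a * (jap p / jap q) ^ max a (1 / 2)) ^ 2 ≤
      4 * (1 + p * (a ^ 2 * q ^ (2 * a - 1))) := by
  have hq0 : 0 < q := by linarith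
  have hP := jap_pos p
  have hQ := jap_pos q
  rw [max_eq_right ha]
  have e : (jap q ^ a * (jap p / jap q) ^ (1 / 2 : ℝ)) ^ 2 = jap q ^ (2 * a - 1) * jap p := by
    rw [mul_pow, rpow_sq_eq (x := jap p / jap q) (by positivity), ← Real.rpow_two (jap p / jap q),
      ← Real.rpow_mul (by positivity), Real.rpow_sub hQ, Real.rpow_one, rpow_sq_eq hQ.le,
      ← Real.rpow_two, ← Real.rpow_mul hQ.le]
    norm_num
    ring
  have h1 : jap q ^ (2 * a - 1) ≤ q ^ (2 * a - 1) :=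
    Real.rpow_le_rpow_of_nonpos hq0 le_jap (by linarith)
  have h2 : q ^ (2 * a - 1) ≤ 2 * jap q ^ (2 * a - 1) := by
    have h3 : (2 * q) ^ (2 * a - 1) ≤ jap q ^ (2 * a - 1) :=
      Real.rpow_le_rpow_of_nonpos hQ (jap_le_two_mul hq) (by linarith)
    have h4 : (2 : ℝ) ^ (-1 : ℝ) ≤ 2 ^ (2 * a - 1) :=
      Real.rpow_le_rpow_of_exponent_le (by norm_num) (by linarith)
    rw [Real.rpow_neg_one] at h4
    rw [Real.mul_rpow (by norm_num) hq0.le] at h3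
    have := mul_le_mul_of_nonneg_right h4 (Real.rpow_nonneg hq0.le (2 * a - 1))
    linarith
  have h5 : q ^ (2 * a - 1) ≤ 1 := Real.rpow_le_one_of_one_le_of_nonpos hq (by linarith)
  have h6 : 0 ≤ q ^ (2 * a - 1) := by positivity
  have h7 : 0 ≤ jap q ^ (2 * a - 1) := by positivity
  have h8 : p ≤ jap p := le_jap
  have h9 := jap_le_one_add hp.le
  have h10 : 0 ≤ jap q ^ a * (jap p / jap q) ^ (1 / 2 : ℝ) := by positivity
  rw [mul_assoc]
  generalize jap q ^ a * (jap p / jap q) ^ (1 / 2 : ℝ) = X at *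
  generalize jap q ^ (2 * a - 1) = B at *
  generalize q ^ (2 * a - 1) = A at *
  generalize jap p = P at *
  have ha2 : a ^ 2 ≤ 1 / 4 := by nlinarith
  have i1 : A * p ≤ 2 * X ^ 2 := by
    rw [e]
    calc A * p ≤ 2 * B * P := by gcongr
      _ = _ := by ring
  have i2 : X ^ 2 ≤ 1 + A * p := by
    rw [e]
    calc B * P ≤ A * (1 + p) := by gcongr
      _ ≤ _ := by linarith
  have i3 := mul_le_mul_of_nonneg_left i1 (sq_nonneg a)
  have i4 := mul_le_mul_of_nonneg_left i2 (sq_nonneg a)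
  have i5 : 0 ≤ a * X := by positivity
  have i6 : 0 ≤ a ^ 2 * (A * p) := by positivity
  constructor
  · nlinarith
  · nlinarith [sq_nonneg (a * X - 1)]

/-- Admissible weights which are comparable with the weights of the conformal energy of `r φ`. -/
lemma exists_admissible (ha0 : 0 ≤ a) (ha1 : a ≤ 1) : ∃ f g, Admissible f g ∧
    ∀ y ∈ nullRegion, f y ≤ 3 * (jap y.2 ^ a) ^ 2 ∧ (jap y.2 ^ a) ^ 2 ≤ f y ∧
      g y ≤ 4 * (1 + a * jap y.2 ^ a * (jap y.1 / jap y.2) ^ max a (1 / 2)) ^ 2 ∧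
      (1 + a * jap y.2 ^ a * (jap y.1 / jap y.2) ^ max a (1 / 2)) ^ 2 ≤ 4 * g y := by
  rcases le_total (1 / 2) a with h | h
  · refine ⟨_, _, admissible_of_half_le h ha1, fun y hy => ?_⟩
    obtain ⟨h1, h2⟩ := three_mul_rpow_bounds ha0 ha1 (one_le_snd_of_mem hy)
    exact ⟨h1, h2, bounds_of_half_le h ha1 hy.1⟩
  · refine ⟨_, _, admissible_of_le_half ha0 h, fun y hy => ?_⟩
    obtain ⟨h1, h2⟩ := three_mul_rpow_bounds ha0 ha1 (one_le_snd_of_mem hy)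
    exact ⟨h1, h2, bounds_of_le_half ha0 h hy.1 (one_le_snd_of_mem hy)⟩

lemma sourceWeight_one {z : Spacetime} (hz : 0 < z.1) :
    sourceWeight (fun _ => 1) (fun _ => 1) z = 1 := by
  have := hypTime_pos hz
  simp only [sourceWeight, nullCoord]
  field_simp
  ring

/-- The weight is `(pq² + qp²)/(2t) = pq = s²`. -/
lemma sourceWeight_sq {z : Spacetime} (hz : 0 < z.1) :
    sourceWeight (fun y => y.2 ^ 2) (fun y => y.1 ^ 2) z = z.1 ^ 2 := by
  have := hypTime_pos hz
  rw [← nullCoord_mul z]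
  simp only [sourceWeight, nullCoord]
  field_simp
  ring

/-- As `2t = p + q`, the source weight is an average of `f` and `g`, and `g ≤ f`. -/
lemma Admissible.sourceWeight_le {f g : ℝ × ℝ → ℝ} (h : Admissible f g) {z : Spacetime}
    (hz : 1 ≤ z.1) : sourceWeight f g z ≤ f (nullCoord z) := by
  have hy := nullCoord_mem hz
  have ht := hypTime_pos (z := z) (by linarith)
  rw [sourceWeight, div_le_iff₀ (by positivity)]
  have e : 2 * hypTime z = (nullCoord z).1 + (nullCoord z).2 := by simp [nullCoord]; ring
  rw [e]
  nlinarith [mul_le_mul_of_nonneg_left (h.le _ hy) (snd_pos_of_mem hy).le]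

end

/-! ### Comparison of the energies -/

section

variable {f g : ℝ × ℝ → ℝ} {U : Spacetime → ℝ} {z : Spacetime} {s s₀ s₁ : ℝ} {K : Set Space}

/-- With `P = p/(2t)` and `Q = q/(2t)` this compares the null density with the quantities in the
norm of `rφ`. Each difference is written as a sum of terms that are nonnegative because `0 ≤ P ≤
1/2` and `0 ≤ g ≤ f`. -/
lemma null_energy_bounds {P Q f g Y Z A v : ℝ} (hPQ : P + Q = 1) (hP : 0 ≤ P) (h : P ≤ Q)
    (hg : 0 ≤ g) (hgf : g ≤ f) (hA : 0 ≤ A) (hv : v ^ 2 = P * Q * (Y + Z) ^ 2) :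
    g * (v ^ 2 + A) ≤ 2 * (f * (Q * Y ^ 2 + P * A) + g * (P * Z ^ 2 + Q * A)) ∧
    f * (Y ^ 2 + 4 * P * Q * A) ≤ 4 * (f * (Q * Y ^ 2 + P * A) + g * (P * Z ^ 2 + Q * A)) ∧
    f * (Q * Y ^ 2 + P * A) + g * (P * Z ^ 2 + Q * A) ≤
      2 * (f * (Y ^ 2 + 4 * P * Q * A)) + 4 * (g * (v ^ 2 + A)) := by
  obtain rfl : Q = 1 - P := by linarith
  have hf : 0 ≤ f := hg.trans hgf
  have hP2 : 0 ≤ 1 - 2 * P := by linarith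
  have hQ : 0 ≤ 1 - P := by linarith
  have hY : 0 ≤ (f - g) * Y ^ 2 := mul_nonneg (by linarith) (sq_nonneg _)
  rw [hv]
  refine ⟨?_, ?_, ?_⟩
  · have e : 2 * (f * ((1 - P) * Y ^ 2 + P * A) + g * (P * Z ^ 2 + (1 - P) * A)) -
        g * (P * (1 - P) * (Y + Z) ^ 2 + A) =
        2 * (1 - P) * ((f - g) * Y ^ 2) + 2 * (1 - P) * (1 - P) * (g * Y ^ 2)
          + 2 * P * P * (g * Z ^ 2) + P * (1 - P) * (g * (Y - Z) ^ 2) + 2 * P * (f * A) +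
          (1 - 2 * P) * (g * A) := by ring
    rw [← sub_nonneg, e]
    positivity
  · have e : 4 * (f * ((1 - P) * Y ^ 2 + P * A) + g * (P * Z ^ 2 + (1 - P) * A)) -
        f * (Y ^ 2 + 4 * P * (1 - P) * A) =
        (1 - P) * (2 * (f * Y ^ 2)) + (1 - 2 * P) * (f * Y ^ 2) + 4 * P * P * (f * A) +
          4 * P * (g * Z ^ 2) + 4 * (1 - P) * (g * A) := by ring
    rw [← sub_nonneg, e]
    positivity
  · have e : 2 * (f * (Y ^ 2 + 4 * P * (1 - P) * A)) + 4 * (g * (P * (1 - P) * (Y + Z) ^ 2 + A)) -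
        (f * ((1 - P) * Y ^ 2 + P * A) + g * (P * Z ^ 2 + (1 - P) * A)) =
        (f - g) * Y ^ 2 + P * (f * Y ^ 2) + ((1 - 2 * P) ^ 2) * (g * Y ^ 2)
          + 2 * P * (1 - P) * (g * (2 * Y + Z) ^ 2) + P * (1 - 2 * P) * (g * Z ^ 2)
          + P * (3 * (f * A) + 4 * (1 - 2 * P) * (f * A)) + (3 + P) * (g * A) := by ring
    rw [← sub_nonneg, e]
    positivity

/-- The input is `Y + Z = (2t/s) ∂_s U`, from which the radial derivative has cancelled, together
with `4PQ = (s/t)²`. -/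
lemma Admissible.energyDensity_bounds (h : Admissible f g) (hz : 1 ≤ z.1) :
    g (nullCoord z) * (dt U z ^ 2 + angSq U z) ≤ 2 * energyDensity f g U z ∧
    f (nullCoord z) * (conjR U z ^ 2 + (z.1 / hypTime z) ^ 2 * angSq U z) ≤
      4 * energyDensity f g U z ∧
    energyDensity f g U z ≤
      2 * (f (nullCoord z) * (conjR U z ^ 2 + (z.1 / hypTime z) ^ 2 * angSq U z)) +
        4 * (g (nullCoord z) * (dt U z ^ 2 + angSq U z)) := by
  have hy := nullCoord_mem hz
  have ht := hypTime_pos (z := z) (by linarith)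
  have hz0 : z.1 ≠ 0 := by linarith
  have hr : 0 ≤ radius z := norm_nonneg _
  have hm := nullCoord_mul z
  simp only [nullCoord] at hm
  have key := null_energy_bounds (P := (hypTime z - radius z) / (2 * hypTime z))
    (Q := (hypTime z + radius z) / (2 * hypTime z)) (f := f (nullCoord z)) (g := g (nullCoord z))
    (Y := (blocks 1 f U z).Y) (Z := (blocks (-1) (fun y => g y.swap) U z).Y)
    (A := angSq U z) (v := dt U z) (by field_simp; ring)
    (div_nonneg hy.1.le (by positivity)) (by gcongr; linarith) (h.nonneg _ hy) (h.le _ hy)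
    (angular_nonneg U z) ?_
  · have e : 4 * ((hypTime z - radius z) / (2 * hypTime z)) *
        ((hypTime z + radius z) / (2 * hypTime z)) = (z.1 / hypTime z) ^ 2 := by
      rw [div_pow, ← hm]; field_simp; ring
    have e2 : energyDensity f g U z = f (nullCoord z) * ((hypTime z + radius z) / (2 * hypTime z) *
        (blocks 1 f U z).Y ^ 2 + (hypTime z - radius z) / (2 * hypTime z) * angSq U z) +
        g (nullCoord z) * ((hypTime z - radius z) / (2 * hypTime z) *
        (blocks (-1) (fun y => g y.swap) U z).Y ^ 2 +
          (hypTime z + radius z) / (2 * hypTime z) * angSq U z) := by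
      rw [energyDensity_eq, angSq]; ring
    rw [← e2, e] at key
    rw [conjR, ← blocks_one_Y (f := f)]
    exact key
  · rw [blocks_one_Y, blocks_neg_one_Y, div_mul_div_comm, hm]
    field_simp
    ring

/-- The cross terms of `qY²` and `pZ²` cancel. -/
lemma energyDensity_one (hz : 1 ≤ z.1) : energyDensity (fun _ => 1) (fun _ => 1) U z =
    dt U z ^ 2 + ((euler U z + U z) / radius z) ^ 2 + angSq U z := by
  have ht := hypTime_pos (z := z) (by linarith)
  have hz0 : z.1 ≠ 0 := by linarith
  have hm := nullCoord_mul z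
  simp only [nullCoord] at hm
  rw [energyDensity_eq, blocks_one_Y, blocks_neg_one_Y, angSq]
  generalize (euler U z + U z) / radius z = R
  generalize ‖grad U z‖ ^ 2 - euler U z ^ 2 / radius z ^ 2 = A
  generalize dt U z = v
  field_simp
  linear_combination (2 * hypTime z * v ^ 2) * hm

/-- With `R = (x·∇U + U)/r`, the form in `(∂_s U, R)` obtained from `(q³Y² + p³Z²)/(2t)` is
completed to a square by means of `q² - pq + p² = (q - p)² + pq`. -/
lemma energyDensity_sq (hz : 1 ≤ z.1) :
    energyDensity (fun y => y.2 ^ 2) (fun y => y.1 ^ 2) U z =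
      (z.1 * dt U z + 2 * radius z * ((euler U z + U z) / radius z)) ^ 2 +
        z.1 ^ 2 * ((euler U z + U z) / radius z) ^ 2 + z.1 ^ 2 * angSq U z := by
  have ht := hypTime_pos (z := z) (by linarith)
  have hz0 : z.1 ≠ 0 := by linarith
  have hm := nullCoord_mul z
  simp only [nullCoord] at hm
  rw [energyDensity_eq, blocks_one_Y, blocks_neg_one_Y, angSq]
  simp only [nullCoord]
  generalize (euler U z + U z) / radius z = R
  generalize ‖grad U z‖ ^ 2 - euler U z ^ 2 / radius z ^ 2 = A
  generalize dt U z = v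
  field_simp
  linear_combination (2 * hypTime z * v ^ 2 * ((hypTime z - radius z) * (hypTime z + radius z) +
    z.1 ^ 2) + 8 * z.1 * hypTime z * radius z * v * R + 2 * hypTime z * z.1 ^ 2 * R ^ 2 +
    2 * hypTime z * z.1 ^ 2 * A) * hm

end

/-- The norm of `L²(ℝ³)`. -/
abbrev l2 (f : Space → ℝ) : ℝ≥0∞ := eLpNorm f 2 volume

/-! ### Pointwise domination and `L²` norms. -/

section

variable {h k k₁ k₂ k₃ k₄ : Space → ℝ} {n : ℕ}

lemma l2_le_one (hk : ∀ᵐ x, |h x| ≤ n * |k x|) : l2 h ≤ n * l2 k := by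
  have := eLpNorm_le_nnreal_smul_eLpNorm_of_ae_le_mul (c := n) (f := h) (g := k) (p := 2)
    (μ := volume) (by
      filter_upwards [hk] with x hx
      exact_mod_cast hx)
  simpa [ENNReal.smul_def] using this

lemma l2_mono (hk : ∀ᵐ x, |h x| ≤ |k x|) : l2 h ≤ l2 k := eLpNorm_mono_ae hk

lemma l2_le_two (h₁ : Measurable k₁) (h₂ : Measurable k₂)
    (hk : ∀ᵐ x, |h x| ≤ n * (|k₁ x| + |k₂ x|)) : l2 h ≤ n * (l2 k₁ + l2 k₂) := by
  have h1 : l2 h ≤ n * l2 ((fun x => |k₁ x|) + fun x => |k₂ x|) := by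
    refine l2_le_one ?_
    filter_upwards [hk] with x hx
    exact hx.trans (by gcongr; exact le_abs_self _)
  refine h1.trans ?_
  gcongr
  refine (eLpNorm_add_le (by fun_prop) (by fun_prop) (by norm_num)).trans ?_
  gcongr <;> exact l2_mono (by simp)

lemma l2_le_four (h₁ : Measurable k₁) (h₂ : Measurable k₂) (h₃ : Measurable k₃)
    (h₄ : Measurable k₄) (hk : ∀ᵐ x, |h x| ≤ n * (|k₁ x| + |k₂ x| + |k₃ x| + |k₄ x|)) :
    l2 h ≤ n * (l2 k₁ + l2 k₂ + l2 k₃ + l2 k₄) := by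
  have h1 : l2 h ≤ n * (l2 (fun x => |k₁ x| + |k₂ x|) + l2 fun x => |k₃ x| + |k₄ x|) := by
    refine l2_le_two (by fun_prop) (by fun_prop) ?_
    filter_upwards [hk] with x hx
    refine hx.trans ?_
    rw [add_assoc]
    gcongr <;> exact le_abs_self _
  refine h1.trans ?_
  rw [add_assoc (_ + _)]
  have aux {k₁ k₂ : Space → ℝ} (h₁ : Measurable k₁) (h₂ : Measurable k₂) :
      l2 (fun x => |k₁ x| + |k₂ x|) ≤ l2 k₁ + l2 k₂ := by
    have := l2_le_two (n := 1) (h := fun x => |k₁ x| + |k₂ x|) h₁ h₂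
      (Filter.Eventually.of_forall fun x => by
        rw [abs_of_nonneg (by positivity)]; simp)
    simpa using this
  gcongr <;> exact aux ‹_› ‹_›

lemma l2_const_mul {c : ℝ} (hc : 0 ≤ c) (k : Space → ℝ) :
    l2 (fun x => c * k x) = ENNReal.ofReal c * l2 k := by
  have := eLpNorm_const_smul c k 2 (volume : Measure Space)
  rw [Real.enorm_of_nonneg hc] at this
  exact this

end

/-! ### The standard energy and `E_W`. -/

section

variable {f g : ℝ × ℝ → ℝ} {U : Spacetime → ℝ} {z : Spacetime} {s s₀ s₁ : ℝ} {K : Set Space}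

/-- The energy norm of `U` at time `s`. -/
def energyNorm (f g : ℝ × ℝ → ℝ) (U : Spacetime → ℝ) (s : ℝ) : ℝ≥0∞ :=
  l2 fun x => √(energyDensity f g U (s, x))

lemma Regular.measurable (hU : Regular U s₀ s₁ K) (hs : s ∈ Icc s₀ s₁) :
    Measurable fun x => U (s, x) := (hU.continuous hs).measurable

lemma Regular.measurable_dt (hU : Regular U s₀ s₁ K) (hs : s ∈ Icc s₀ s₁) :
    Measurable fun x => dt U (s, x) := (hU.continuous_dt hs).measurable

lemma Regular.measurable_euler (hU : Regular U s₀ s₁ K) (hs : s ∈ Icc s₀ s₁) :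
    Measurable fun x => euler U (s, x) := (hU.continuous_euler hs).measurable

lemma Regular.measurable_norm_grad (hU : Regular U s₀ s₁ K) (hs : s ∈ Icc s₀ s₁) :
    Measurable fun x => ‖grad U (s, x)‖ := (hU.continuous_grad hs).norm.measurable

lemma measurable_radius (s : ℝ) : Measurable fun x : Space => radius (s, x) :=
  measurable_norm

lemma measurable_hypTime (s : ℝ) : Measurable fun x : Space => hypTime (s, x) := by
  unfold hypTime; fun_prop

lemma Regular.measurable_angSq (hU : Regular U s₀ s₁ K) (hs : s ∈ Icc s₀ s₁) :
    Measurable fun x => angSq U (s, x) := by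
  have h1 := hU.measurable_euler hs
  have h2 := hU.measurable_norm_grad hs
  have h3 := measurable_radius s
  unfold angSq
  fun_prop

lemma measurable_jap : Measurable jap := by unfold jap; fun_prop

lemma measurable_jap_nullCoord (s : ℝ) : Measurable (fun x : Space => jap (nullCoord (s, x)).1) ∧
    Measurable fun x : Space => jap (nullCoord (s, x)).2 := by
  have h1 := measurable_hypTime s
  have h2 := measurable_radius s
  have h3 := measurable_jap
  simp only [nullCoord]
  constructor <;> fun_prop

lemma angSq_nonneg (U : Spacetime → ℝ) (z : Spacetime) : 0 ≤ angSq U z := angular_nonneg U z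

/-- The standard energy controls the derivatives. -/
lemma Regular.le_energyNorm_one (hU : Regular U s₀ s₁ K) (hs : s ∈ Icc s₀ s₁) :
    (l2 fun x => dt U (s, x)) ≤ energyNorm (fun _ => 1) (fun _ => 1) U s ∧
    (l2 fun x => (euler U (s, x) + U (s, x)) / radius (s, x)) ≤
      energyNorm (fun _ => 1) (fun _ => 1) U s ∧
    (l2 fun x => √(angSq U (s, x))) ≤ energyNorm (fun _ => 1) (fun _ => 1) U s ∧
    (l2 fun x => euler U (s, x) / radius (s, x)) ≤ energyNorm (fun _ => 1) (fun _ => 1) U s := by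
  have h1 : 1 ≤ s := hU.one_le.trans hs.1
  have key (k : Space → ℝ) (hk : ∀ x, k x ^ 2 ≤ energyDensity (fun _ => 1) (fun _ => 1) U (s, x)) :
      l2 k ≤ energyNorm (fun _ => 1) (fun _ => 1) U s :=
    l2_mono (Filter.Eventually.of_forall fun x => by
      rw [abs_of_nonneg (Real.sqrt_nonneg _)]
      exact Real.abs_le_sqrt (hk x))
  have e (x : Space) := energyDensity_one (U := U) (z := (s, x)) h1
  have hA (x : Space) := angSq_nonneg U (s, x)
  have hR := key (fun x => (euler U (s, x) + U (s, x)) / radius (s, x)) fun x => by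
    rw [e]; nlinarith [hA x, sq_nonneg (dt U (s, x))]
  refine ⟨key _ fun x => ?_, hR, key _ fun x => ?_, ?_⟩
  · rw [e]
    nlinarith [hA x, sq_nonneg ((euler U (s, x) + U (s, x)) / radius (s, x))]
  · rw [Real.sq_sqrt (hA x), e]
    nlinarith [sq_nonneg (dt U (s, x)), sq_nonneg ((euler U (s, x) + U (s, x)) / radius (s, x))]
  · exact (hU.eLpNorm_radial hs).symm.le.trans hR

lemma Regular.energyNorm_one_le (hU : Regular U s₀ s₁ K) (hs : s ∈ Icc s₀ s₁) :
    energyNorm (fun _ => 1) (fun _ => 1) U s ≤ (l2 fun x => dt U (s, x)) +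
      (l2 fun x => euler U (s, x) / radius (s, x)) + l2 fun x => √(angSq U (s, x)) := by
  have h1 : 1 ≤ s := hU.one_le.trans hs.1
  have m1 := hU.measurable hs
  have m2 := hU.measurable_dt hs
  have m3 := hU.measurable_euler hs
  have m4 := hU.measurable_angSq hs
  have m5 := measurable_radius s
  have := l2_le_four (h := fun x => √(energyDensity (fun _ => 1) (fun _ => 1) U (s, x))) (n := 1)
    m2 (k₂ := fun x => (euler U (s, x) + U (s, x)) / radius (s, x))
    (k₃ := fun x => √(angSq U (s, x))) (k₄ := fun _ => 0) ((m3.add m1).div m5)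
    (by fun_prop) (by fun_prop) (Filter.Eventually.of_forall fun x => by
      rw [energyDensity_one (z := (s, x)) h1, abs_of_nonneg (Real.sqrt_nonneg _),
        abs_of_nonneg (Real.sqrt_nonneg (angSq U (s, x)))]
      have hA := angSq_nonneg U (s, x)
      refine (sqrt_add_le (by positivity) hA).trans ?_
      have := sqrt_add_le (sq_nonneg (dt U (s, x)))
        (sq_nonneg ((euler U (s, x) + U (s, x)) / radius (s, x)))
      rw [Real.sqrt_sq_eq_abs, Real.sqrt_sq_eq_abs] at this
      simp only [Nat.cast_one, one_mul, abs_zero, add_zero]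
      linarith)
  have e : (l2 fun x => (euler U (s, x) + U (s, x)) / radius (s, x)) =
    l2 fun x => euler U (s, x) / radius (s, x) := hU.eLpNorm_radial hs
  rw [e] at this
  simpa [energyNorm] using this

/-- Since `|∇U|² = (x·∇U/r)² + A`, the only discrepancy between the two norms is the summand `U/r`
in the radial derivative, which `eLpNorm_radial` removes. -/
lemma Regular.energyW_bounds (hU : Regular U s₀ s₁ K) (hs : s ∈ Icc s₀ s₁) :
    ((l2 fun x => dt U (s, x)) + l2 fun x => ‖grad U (s, x)‖) ≤
      3 * energyNorm (fun _ => 1) (fun _ => 1) U s ∧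
    energyNorm (fun _ => 1) (fun _ => 1) U s ≤
      2 * ((l2 fun x => dt U (s, x)) + l2 fun x => ‖grad U (s, x)‖) := by
  have hA (x : Space) := angSq_nonneg U (s, x)
  have e (x : Space) : ‖grad U (s, x)‖ ^ 2 =
      (euler U (s, x) / radius (s, x)) ^ 2 + angSq U (s, x) := by
    rw [angSq]; ring
  have m3 := hU.measurable_euler hs
  have m4 := hU.measurable_angSq hs
  have m5 := measurable_radius s
  obtain ⟨b1, -, b3, b4⟩ := hU.le_energyNorm_one hs
  constructor
  · have := l2_le_two (n := 1) (h := fun x => ‖grad U (s, x)‖)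
      (k₁ := fun x => euler U (s, x) / radius (s, x)) (k₂ := fun x => √(angSq U (s, x)))
      (by fun_prop) (by fun_prop) (Filter.Eventually.of_forall fun x => by
        rw [abs_of_nonneg (norm_nonneg _), abs_of_nonneg (Real.sqrt_nonneg (angSq U (s, x))),
          ← Real.sqrt_sq (norm_nonneg (grad U (s, x))), e]
        refine (sqrt_add_le (by positivity) (hA x)).trans ?_
        rw [Real.sqrt_sq_eq_abs]; simp)
    rw [Nat.cast_one, one_mul] at this
    calc _ ≤ energyNorm (fun _ => 1) (fun _ => 1) U s + (energyNorm (fun _ => 1) (fun _ => 1) U s +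
          energyNorm (fun _ => 1) (fun _ => 1) U s) := by
            gcongr; exact this.trans (by gcongr)
      _ = _ := by ring
  · have g1 : (l2 fun x => euler U (s, x) / radius (s, x)) ≤ l2 fun x => ‖grad U (s, x)‖ :=
      l2_mono (Filter.Eventually.of_forall fun x => by
        rw [abs_norm]
        refine abs_le_of_sq_le_sq ?_ (norm_nonneg _)
        rw [e]; linarith [hA x])
    have g2 : (l2 fun x => √(angSq U (s, x))) ≤ l2 fun x => ‖grad U (s, x)‖ :=
      l2_mono (Filter.Eventually.of_forall fun x => by
        rw [abs_norm, abs_of_nonneg (Real.sqrt_nonneg _)]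
        refine Real.sqrt_le_iff.2 ⟨norm_nonneg _, ?_⟩
        rw [e]; nlinarith [sq_nonneg (euler U (s, x) / radius (s, x))])
    calc _ ≤ _ := hU.energyNorm_one_le hs
      _ ≤ (l2 fun x => dt U (s, x)) + (l2 fun x => ‖grad U (s, x)‖) +
          l2 fun x => ‖grad U (s, x)‖ := by gcongr
      _ ≤ (l2 fun x => dt U (s, x)) + (l2 fun x => ‖grad U (s, x)‖) +
          ((l2 fun x => dt U (s, x)) + l2 fun x => ‖grad U (s, x)‖) := by
            gcongr; exact le_add_self
      _ = _ := by ring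

end

/-! ### Pointwise comparisons for the conformal energies. -/

section

variable {f g : ℝ × ℝ → ℝ} {U : Spacetime → ℝ} {s s₀ s₁ a : ℝ} {K : Set Space}

lemma abs_mul_sqrt_le {w e k c : ℝ} (hw : 0 ≤ w) (hc : 0 ≤ c) (h : w ^ 2 * k ≤ c ^ 2 * e) :
    |w * √k| ≤ c * |√e| := by
  rw [abs_of_nonneg (mul_nonneg hw (Real.sqrt_nonneg k)), abs_of_nonneg (Real.sqrt_nonneg e),
    ← Real.sqrt_sq hw, ← Real.sqrt_mul (sq_nonneg w)]
  conv_rhs => rw [← Real.sqrt_sq hc, ← Real.sqrt_mul (sq_nonneg c)]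
  exact Real.sqrt_le_sqrt h

lemma Regular.measurable_conjR (hU : Regular U s₀ s₁ K) (hs : s ∈ Icc s₀ s₁) :
    Measurable fun x => conjR U (s, x) :=
  ((((measurable_hypTime s).sub (measurable_radius s)).div_const s).mul (hU.measurable_dt hs)).add
    (((hU.measurable_euler hs).add (hU.measurable hs)).div (measurable_radius s))

/-- The two parts of the conformal energy of `r φ` are comparable with the energy of an admissible
pair of weights. -/
lemma Regular.energyR_bounds (hU : Regular U s₀ s₁ K) (hs : s ∈ Icc s₀ s₁) (hfg : Admissible f g)
    {w₁ w₂ : Space → ℝ} (hw₁ : ∀ x, 0 ≤ w₁ x) (hw₂ : ∀ x, 0 ≤ w₂ x) (m₁ : Measurable w₁)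
    (m₂ : Measurable w₂)
    (hf : ∀ x, f (nullCoord (s, x)) ≤ 3 * w₂ x ^ 2) (hf' : ∀ x, w₂ x ^ 2 ≤ f (nullCoord (s, x)))
    (hg : ∀ x, g (nullCoord (s, x)) ≤ 4 * w₁ x ^ 2)
    (hg' : ∀ x, w₁ x ^ 2 ≤ 4 * g (nullCoord (s, x))) :
    ((l2 fun x => w₁ x * √(dt U (s, x) ^ 2 + angSq U (s, x))) +
      l2 fun x => w₂ x * √(conjR U (s, x) ^ 2 + (s / hypTime (s, x)) ^ 2 * angSq U (s, x))) ≤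
        5 * energyNorm f g U s ∧
    energyNorm f g U s ≤ 4 * ((l2 fun x => w₁ x * √(dt U (s, x) ^ 2 + angSq U (s, x))) +
      l2 fun x => w₂ x * √(conjR U (s, x) ^ 2 + (s / hypTime (s, x)) ^ 2 * angSq U (s, x))) := by
  have h1 : 1 ≤ s := hU.one_le.trans hs.1
  have m2 := hU.measurable_dt hs
  have m3 := hU.measurable_conjR hs
  have m4 := hU.measurable_angSq hs
  have m5 := measurable_hypTime s
  have hA (x : Space) := angSq_nonneg U (s, x)
  have key (x : Space) := hfg.energyDensity_bounds (U := U) (z := (s, x)) h1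
  have k1 (x : Space) : 0 ≤ dt U (s, x) ^ 2 + angSq U (s, x) := by have := hA x; positivity
  have k2 (x : Space) :
      0 ≤ conjR U (s, x) ^ 2 + (s / hypTime (s, x)) ^ 2 * angSq U (s, x) := by
    have := hA x; positivity
  constructor
  · have i1 : (l2 fun x => w₁ x * √(dt U (s, x) ^ 2 + angSq U (s, x))) ≤
        (3 : ℕ) * energyNorm f g U s :=
      l2_le_one (Filter.Eventually.of_forall fun x => abs_mul_sqrt_le (hw₁ x) (by positivity) (by
        have := mul_le_mul_of_nonneg_right (hg' x) (k1 x)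
        have e := hfg.energyDensity_nonneg (U := U) (z := (s, x)) h1
        have := (key x).1
        push_cast
        linarith))
    have i2 : (l2 fun x => w₂ x *
        √(conjR U (s, x) ^ 2 + (s / hypTime (s, x)) ^ 2 * angSq U (s, x))) ≤
        (2 : ℕ) * energyNorm f g U s :=
      l2_le_one (Filter.Eventually.of_forall fun x => abs_mul_sqrt_le (hw₂ x) (by positivity) (by
        have := mul_le_mul_of_nonneg_right (hf' x) (k2 x)
        have := (key x).2.1
        push_cast
        linarith))
    calc _ ≤ (3 : ℕ) * energyNorm f g U s + (2 : ℕ) * energyNorm f g U s := by gcongr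
      _ = _ := by push_cast; ring
  · refine le_of_le_of_eq (l2_le_two (n := 4)
      (k₁ := fun x => w₁ x * √(dt U (s, x) ^ 2 + angSq U (s, x)))
      (k₂ := fun x => w₂ x *
        √(conjR U (s, x) ^ 2 + (s / hypTime (s, x)) ^ 2 * angSq U (s, x)))
      ?_ ?_ (Filter.Eventually.of_forall fun x => ?_)) (by norm_num)
    · fun_prop
    · fun_prop
    · have j1 := mul_le_mul_of_nonneg_right (hg x) (k1 x)
      have j2 := mul_le_mul_of_nonneg_right (hf x) (k2 x)
      have j3 := (key x).2.2
      have n1 := mul_nonneg (hw₁ x) (Real.sqrt_nonneg (dt U (s, x) ^ 2 + angSq U (s, x)))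
      have n2 := mul_nonneg (hw₂ x) (Real.sqrt_nonneg
        (conjR U (s, x) ^ 2 + (s / hypTime (s, x)) ^ 2 * angSq U (s, x)))
      rw [abs_of_nonneg (Real.sqrt_nonneg _), abs_of_nonneg n1, abs_of_nonneg n2]
      refine Real.sqrt_le_iff.2 ⟨by push_cast; positivity, ?_⟩
      have e1 := congrArg (w₁ x ^ 2 * ·) (Real.sq_sqrt (k1 x))
      have e2 := congrArg (w₂ x ^ 2 * ·) (Real.sq_sqrt (k2 x))
      simp only [← mul_pow] at e1 e2
      rw [mul_assoc, ← e1] at j1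
      rw [mul_assoc, ← e2] at j2
      have n3 := mul_nonneg n1 n2
      push_cast
      nlinarith [sq_nonneg (w₂ x * √(conjR U (s, x) ^ 2 +
        (s / hypTime (s, x)) ^ 2 * angSq U (s, x)))]

/-- Pointwise control of the conformal energy of `s² φ` by the inverted energy. -/
lemma conformal_le {s p q T r X Q D v u w a b τm τp e₁ e₂ : ℝ} (hs : 1 ≤ s) (hp : 0 < p)
    (hT : 2 * T = q + p) (hr : 2 * r = q - p) (hpq : p * q = s ^ 2) (hr0 : 0 ≤ r) (hb : 0 ≤ b)
    (hb1 : b ≤ 1) (hm' : τm ≤ 1 + p) (hτ' : τp ≤ 2 * q)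
    (hX : X = v + 2 * u) (hQ : Q = p / s * X + D) (hw : w = s * X + 2 * r * D) (ha : 0 ≤ a)
    (hv : |v| ≤ e₁) (ha₁ : a ≤ e₁) (hwe : |w| ≤ e₂) (ha₂ : s * a ≤ e₂) :
    (1 + b * τm) * √(X ^ 2 + a ^ 2) ≤ 4 * (e₁ + |u| + b * e₂ + b * (s * |D|)) ∧
    b * τp * √(Q ^ 2 + (s / T) ^ 2 * a ^ 2) ≤ 6 * (e₁ + |u| + b * e₂ + b * (s * |D|)) := by
  have hq : 0 < q := by nlinarith
  have hs0 : 0 < s := by linarith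
  have hT0 : 0 < T := by linarith
  have hps : p ≤ s := by nlinarith
  have hrp : 2 * r * p ≤ 2 * s ^ 2 := by nlinarith
  have h₁ : √(X ^ 2 + a ^ 2) ≤ |X| + a := by
    have := sqrt_add_le (sq_nonneg X) (sq_nonneg a)
    rwa [Real.sqrt_sq_eq_abs, Real.sqrt_sq ha] at this
  have h₂ : √(Q ^ 2 + (s / T) ^ 2 * a ^ 2) ≤ |Q| + s / T * a := by
    have := sqrt_add_le (sq_nonneg Q) (sq_nonneg (s / T * a))
    rwa [Real.sqrt_sq_eq_abs, Real.sqrt_sq (by positivity), mul_pow] at this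
  have e0 : 0 ≤ e₁ := (abs_nonneg v).trans hv
  have e0' : 0 ≤ e₂ := (abs_nonneg w).trans hwe
  have x1 : |X| ≤ e₁ + 2 * |u| := by
    rw [hX]
    refine (abs_add_le _ _).trans ?_
    rw [abs_mul, abs_two]
    linarith
  -- From `s X = w - 2 r D`, with `p ≤ s` and `r p ≤ s²` because `r ≤ q` and `pq = s²`.
  have x2 : p * |X| ≤ e₂ + 2 * (s * |D|) := by
    have h3 : s * |X| ≤ |w| + 2 * r * |D| := by
      have : s * X = w - 2 * r * D := by rw [hw]; ring
      calc s * |X| = |s * X| := by rw [abs_mul, abs_of_pos hs0]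
        _ = |w - 2 * r * D| := by rw [this]
        _ ≤ |w| + |2 * r * D| := abs_sub _ _
        _ = _ := by rw [abs_mul, abs_of_nonneg (by positivity : 0 ≤ 2 * r)]
    have h4 : s * (p * |X|) ≤ s * (e₂ + 2 * (s * |D|)) := by
      calc s * (p * |X|) = p * (s * |X|) := by ring
        _ ≤ p * (e₂ + 2 * r * |D|) := by gcongr; linarith
        _ = p * e₂ + 2 * r * p * |D| := by ring
        _ ≤ s * e₂ + 2 * s ^ 2 * |D| := by gcongr
        _ = _ := by ring
    exact le_of_mul_le_mul_left h4 hs0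
  -- The identity `q Q = w + p D` shows that the outgoing derivative gains the large weight `q` from
  -- the conformal energy.
  have x3 : q * |Q| ≤ e₂ + s * |D| := by
    have : q * Q = w + p * D := by
      rw [hQ, hw, show 2 * r = q - p from hr]
      field_simp
      linear_combination X * hpq
    calc q * |Q| = |q * Q| := by rw [abs_mul, abs_of_pos hq]
      _ = |w + p * D| := by rw [this]
      _ ≤ |w| + |p * D| := abs_add_le _ _
      _ = |w| + p * |D| := by rw [abs_mul, abs_of_pos hp]
      _ ≤ _ := by gcongr
  have x4 : q * (s / T * a) ≤ 2 * e₂ := by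
    calc q * (s / T * a) = q / T * (s * a) := by ring
      _ ≤ 2 * (s * a) := by
        gcongr
        rw [div_le_iff₀ hT0]; linarith
      _ ≤ 2 * e₂ := by gcongr
  have hD : 0 ≤ s * |D| := by positivity
  constructor
  · calc (1 + b * τm) * √(X ^ 2 + a ^ 2) ≤ (1 + b * (1 + p)) * (|X| + a) := by gcongr
      _ ≤ (2 + b * p) * (|X| + a) :=
        mul_le_mul_of_nonneg_right (by linarith) (by positivity)
      _ = 2 * |X| + 2 * a + b * (p * |X|) + b * (p * a) := by ring
      _ ≤ 2 * (e₁ + 2 * |u|) + 2 * e₁ + b * (e₂ + 2 * (s * |D|)) + b * (s * a) := by gcongr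
      _ ≤ 2 * (e₁ + 2 * |u|) + 2 * e₁ + b * (e₂ + 2 * (s * |D|)) + b * e₂ := by gcongr
      _ ≤ _ := by nlinarith [mul_nonneg hb e0', mul_nonneg hb hD]
  · calc b * τp * √(Q ^ 2 + (s / T) ^ 2 * a ^ 2) ≤ b * (2 * q) * (|Q| + s / T * a) := by gcongr
      _ = 2 * b * (q * |Q| + q * (s / T * a)) := by ring
      _ ≤ 2 * b * (e₂ + s * |D| + 2 * e₂) := by gcongr
      _ ≤ _ := by nlinarith [mul_nonneg hb e0', mul_nonneg hb hD, abs_nonneg u]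

/-- Pointwise control by the conformal energy of `s² φ`. -/
lemma le_conformal {s p q T r X Q D v u w a b τm τp H₁ H₂ : ℝ} (hs : 1 ≤ s) (hp : 0 < p)
    (hT : 2 * T = q + p) (hr : 2 * r = q - p) (hpq : p * q = s ^ 2) (hr0 : 0 ≤ r) (hb : 0 ≤ b)
    (hb1 : 1 ≤ b * s) (hm' : p ≤ τm) (hτ' : q ≤ τp)
    (hX : X = v + 2 * u) (hQ : Q = p / s * X + D) (hw : w = s * X + 2 * r * D) (ha : 0 ≤ a)
    (hH₁ : (1 + b * τm) * √(X ^ 2 + a ^ 2) ≤ H₁)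
    (hH₂ : b * τp * √(Q ^ 2 + (s / T) ^ 2 * a ^ 2) ≤ H₂) :
    a ≤ H₁ + H₂ ∧ |D| ≤ H₁ + H₂ ∧ b * (s * |D|) ≤ H₁ + H₂ ∧ r * |D| / s ≤ H₁ + H₂ ∧
    |v| ≤ H₁ + H₂ + 2 * |u| ∧ b * |w| ≤ 2 * (H₁ + H₂) ∧ b * (s * a) ≤ H₁ + H₂ := by
  have hs0 : 0 < s := by linarith
  have hq : 0 < q := by nlinarith
  have hT0 : 0 < T := by linarith
  have hps : p ≤ s := by nlinarith
  have hsq : s ≤ q := by nlinarith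
  have hb0 : 0 < b := pos_of_mul_pos_left (by linarith) hs0.le
  have y1 : |X| ≤ √(X ^ 2 + a ^ 2) := Real.abs_le_sqrt (by linarith [sq_nonneg a])
  have y2 : a ≤ √(X ^ 2 + a ^ 2) := Real.le_sqrt_of_sq_le (by linarith [sq_nonneg X])
  have y3 : |Q| ≤ √(Q ^ 2 + (s / T) ^ 2 * a ^ 2) := Real.abs_le_sqrt (by
    have := sq_nonneg (s / T * a); rw [mul_pow] at this; linarith)
  have y4 : s / T * a ≤ √(Q ^ 2 + (s / T) ^ 2 * a ^ 2) :=
    Real.le_sqrt_of_sq_le (by rw [mul_pow]; linarith [sq_nonneg Q])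
  have i1 : (1 + b * p) * √(X ^ 2 + a ^ 2) ≤ H₁ := by
    refine le_trans ?_ hH₁; gcongr
  have i2 : b * q * √(Q ^ 2 + (s / T) ^ 2 * a ^ 2) ≤ H₂ := by
    refine le_trans ?_ hH₂; gcongr
  have hbp : 0 < b * p := by positivity
  have S0 := Real.sqrt_nonneg (X ^ 2 + a ^ 2)
  have i3 : √(X ^ 2 + a ^ 2) ≤ H₁ := by linarith [mul_nonneg hbp.le S0]
  have z1 : |X| ≤ H₁ := y1.trans i3
  have z2 : a ≤ H₁ := y2.trans i3
  have z3 : b * p * |X| ≤ H₁ := by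
    linarith [mul_le_mul_of_nonneg_left y1 hbp.le]
  have z4 : b * q * |Q| ≤ H₂ := (mul_le_mul_of_nonneg_left y3 (by positivity)).trans i2
  -- Since `t ≤ q`, the weight `q s/t` is at least `s`.
  have z5 : b * (s * a) ≤ H₂ := by
    refine le_trans ?_ ((mul_le_mul_of_nonneg_left y4 (by positivity)).trans i2)
    calc b * (s * a) = b * (s * a) * 1 := by ring
      _ ≤ b * (s * a) * (q / T) := by
        gcongr
        rw [le_div_iff₀ hT0]; linarith
      _ = _ := by ring
  have H1 : 0 ≤ H₁ := (abs_nonneg X).trans z1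
  have H2 : 0 ≤ H₂ := le_trans (by positivity) z4
  have hD : |D| ≤ |Q| + p / s * |X| := by
    have : D = Q - p / s * X := by rw [hQ]; ring
    calc |D| = |Q - p / s * X| := by rw [this]
      _ ≤ |Q| + |p / s * X| := abs_sub _ _
      _ = _ := by rw [abs_mul, abs_of_pos (div_pos hp hs0)]
  have hsD : s * |D| ≤ s * |Q| + p * |X| := by
    have := mul_le_mul_of_nonneg_left hD hs0.le
    rw [mul_add, ← mul_assoc, mul_div_cancel₀ _ hs0.ne'] at this
    exact this
  have w1 : b * (s * |D|) ≤ H₁ + H₂ := by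
    have h1 := mul_le_mul_of_nonneg_left hsD hb
    have h2 : b * (s * |Q|) ≤ b * (q * |Q|) := by gcongr
    linarith
  refine ⟨by linarith, ?_, w1, ?_, ?_, ?_, by linarith⟩
  · have h1 : 1 * |D| ≤ b * s * |D| := by gcongr
    linarith
  -- This bound feeds the Hardy inequality for `U/s`. The part of `D` with `X` is handled by `r p ≤
  -- s²`, the part with `Q` by `r ≤ q` and `1 ≤ b s`.
  · rw [div_le_iff₀ hs0]
    have h1 := mul_le_mul_of_nonneg_left hsD hr0
    have h2 : r * (p * |X|) ≤ s ^ 2 * |X| := by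
      rw [← mul_assoc, ← hpq, mul_comm p q]
      gcongr
      linarith
    have h3 : r * (s * |Q|) ≤ s * (s * H₂) := by
      have : r ≤ q := by linarith
      calc r * (s * |Q|) ≤ q * (s * |Q|) := by gcongr
        _ = 1 * (s * (q * |Q|)) := by ring
        _ ≤ b * s * (s * (q * |Q|)) := by gcongr
        _ = s * (s * (b * q * |Q|)) := by ring
        _ ≤ _ := by gcongr
    have h4 : s ^ 2 * |X| ≤ s * (s * H₁) := by
      rw [pow_two, mul_assoc]; gcongr
    refine le_of_mul_le_mul_left ?_ hs0
    linarith
  · have : v = X - 2 * u := by rw [hX]; ring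
    calc |v| = |X - 2 * u| := by rw [this]
      _ ≤ |X| + |2 * u| := abs_sub _ _
      _ = |X| + 2 * |u| := by rw [abs_mul, abs_two]
      _ ≤ _ := by linarith
  · have e : w = q * Q - p * D := by
      rw [hQ, hw, show 2 * r = q - p from hr]
      field_simp
      linear_combination -X * hpq
    have h1 : |w| ≤ q * |Q| + p * |D| := by
      rw [e]
      refine (abs_sub _ _).trans ?_
      rw [abs_mul, abs_mul, abs_of_pos hq, abs_of_pos hp]
    have h2 : p * |D| ≤ s * |D| := by gcongr
    have h3 : b * |w| ≤ b * (q * |Q| + s * |D|) := by gcongr; linarith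
    linarith

end

/-! ### The conformal energy of `s² φ` as a sum of three norms. -/

section

variable {f g : ℝ × ℝ → ℝ} {U : Spacetime → ℝ} {s s₀ s₁ a b : ℝ} {K : Set Space}

/-- The energy norm of `U` at time `s` for the inverted time translation. -/
abbrev invertedNorm (U : Spacetime → ℝ) (s : ℝ) : ℝ≥0∞ :=
  energyNorm (fun y => y.2 ^ 2) (fun y => y.1 ^ 2) U s

/-- The conformal energy of `s² φ` with a free parameter. -/
def conformalNorm (b : ℝ) (U : Spacetime → ℝ) (s : ℝ) : ℝ≥0∞ :=
  (l2 fun x => (1 + b * jap (nullCoord (s, x)).1) *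
    √(conjSU U (s, x) ^ 2 + angSq U (s, x))) +
  l2 fun x => (b * jap (nullCoord (s, x)).2) *
    √(conjSR U (s, x) ^ 2 + (s / hypTime (s, x)) ^ 2 * angSq U (s, x))

lemma Regular.measurable_conjSU (hU : Regular U s₀ s₁ K) (hs : s ∈ Icc s₀ s₁) :
    Measurable fun x => conjSU U (s, x) :=
  (hU.measurable_dt hs).add (((hU.measurable hs).const_mul 2).div_const s)

lemma Regular.measurable_conjSR (hU : Regular U s₀ s₁ K) (hs : s ∈ Icc s₀ s₁) :
    Measurable fun x => conjSR U (s, x) :=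
  ((((measurable_hypTime s).sub (measurable_radius s)).div_const s).mul
    (hU.measurable_conjSU hs)).add ((hU.measurable_euler hs).div (measurable_radius s))

lemma measurable_energyDensity_of_eq {k : Space → ℝ} (hk : Measurable k)
    (h : ∀ x, energyDensity f g U (s, x) = k x) :
    Measurable fun x => energyDensity f g U (s, x) := by
  rwa [show (fun x => energyDensity f g U (s, x)) = k from funext h]

lemma Regular.measurable_energyDensity_one (hU : Regular U s₀ s₁ K) (hs : s ∈ Icc s₀ s₁) :
    Measurable fun x => energyDensity (fun _ => 1) (fun _ => 1) U (s, x) := by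
  have m1 := ((hU.measurable_euler hs).add (hU.measurable hs)).div (measurable_radius s)
  exact measurable_energyDensity_of_eq ((((hU.measurable_dt hs).pow_const 2).add
    (m1.pow_const 2)).add (hU.measurable_angSq hs))
    fun x => energyDensity_one (z := (s, x)) (hU.one_le.trans hs.1)

lemma Regular.measurable_energyDensity_sq (hU : Regular U s₀ s₁ K) (hs : s ∈ Icc s₀ s₁) :
    Measurable fun x => energyDensity (fun y => y.2 ^ 2) (fun y => y.1 ^ 2) U (s, x) := by
  have m1 := ((hU.measurable_euler hs).add (hU.measurable hs)).div (measurable_radius s)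
  exact measurable_energyDensity_of_eq ((((((hU.measurable_dt hs).const_mul s).add
    (((measurable_radius s).const_mul 2).mul m1)).pow_const 2).add
    ((m1.pow_const 2).const_mul (s ^ 2))).add ((hU.measurable_angSq hs).const_mul (s ^ 2)))
    fun x => energyDensity_sq (z := (s, x)) (hU.one_le.trans hs.1)

lemma null_facts {s : ℝ} (h1 : 1 ≤ s) (x : Space) :
    0 < hypTime (s, x) - radius (s, x) ∧
    (hypTime (s, x) - radius (s, x)) * (hypTime (s, x) + radius (s, x)) = s ^ 2 ∧
    0 ≤ radius (s, x) ∧ 1 ≤ hypTime (s, x) + radius (s, x) :=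
  have h := nullCoord_mem (z := (s, x)) h1
  ⟨h.1, nullCoord_mul (s, x), norm_nonneg _, one_le_snd_of_mem h⟩

/-- The derivative of `s² φ` differs from that of `φ` by `2U/s`, which is why `‖U/s‖` appears. It is
needed only without the weight: under the weight `b τ₋`, the combination `s ∂_s U + 2U` is recovered
from the conformal density. -/
lemma Regular.conformalNorm_le (hU : Regular U s₀ s₁ K) (hs : s ∈ Icc s₀ s₁) (hb : 0 ≤ b)
    (hb1 : b ≤ 1) : conformalNorm b U s ≤
      20 * (energyNorm (fun _ => 1) (fun _ => 1) U s + (l2 fun x => U (s, x) / s) +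
        ENNReal.ofReal b * invertedNorm U s) := by
  have h1 : 1 ≤ s := hU.one_le.trans hs.1
  have hs0 : 0 < s := by linarith
  have m1 := hU.measurable hs
  have m2 := (hU.measurable_energyDensity_one hs).sqrt
  have m3 := (hU.measurable_energyDensity_sq hs).sqrt
  have m4 := (hU.measurable_euler hs).div (measurable_radius s)
  have hA (x : Space) := angSq_nonneg U (s, x)
  have key (x : Space) (hx : x ≠ 0) := by
    obtain ⟨hp, hpq, hr, hq⟩ := null_facts h1 x
    have hr0 : radius (s, x) ≠ 0 := norm_ne_zero_iff.2 hx
    exact conformal_le (s := s) (p := hypTime (s, x) - radius (s, x))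
      (q := hypTime (s, x) + radius (s, x)) (T := hypTime (s, x)) (r := radius (s, x))
      (X := conjSU U (s, x)) (Q := conjSR U (s, x)) (D := euler U (s, x) / radius (s, x))
      (v := dt U (s, x)) (u := U (s, x) / s)
      (w := s * dt U (s, x) + 2 * radius (s, x) * ((euler U (s, x) + U (s, x)) / radius (s, x)))
      (a := √(angSq U (s, x))) (b := b) (τm := jap (nullCoord (s, x)).1)
      (τp := jap (nullCoord (s, x)).2)
      (e₁ := √(energyDensity (fun _ => 1) (fun _ => 1) U (s, x)))
      (e₂ := √(energyDensity (fun y => y.2 ^ 2) (fun y => y.1 ^ 2) U (s, x)))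
      h1 hp (by ring) (by ring) hpq hr hb hb1 (jap_le_one_add hp.le) (jap_le_two_mul hq)
      (by simp only [conjSU]; ring) rfl (by simp only [conjSU]; field_simp; ring)
      (Real.sqrt_nonneg _)
      (Real.abs_le_sqrt (by
        rw [energyDensity_one (z := (s, x)) h1]
        nlinarith [hA x, sq_nonneg ((euler U (s, x) + U (s, x)) / radius (s, x))]))
      (Real.sqrt_le_sqrt (by
        rw [energyDensity_one (z := (s, x)) h1]
        nlinarith [sq_nonneg (dt U (s, x)),
          sq_nonneg ((euler U (s, x) + U (s, x)) / radius (s, x))]))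
      (Real.abs_le_sqrt (by
        rw [energyDensity_sq (z := (s, x)) h1]
        have := hA x
        rw [add_assoc]
        exact le_add_of_nonneg_right (by positivity)))
      (Real.le_sqrt_of_sq_le (by
        rw [energyDensity_sq (z := (s, x)) h1, mul_pow, Real.sq_sqrt (hA x)]
        exact le_add_of_nonneg_left (by positivity)))
  simp only [Real.sq_sqrt (hA _)] at key
  have aux {n : ℕ} {h : Space → ℝ} (hh : ∀ x : Space, x ≠ 0 → 0 ≤ h x ∧ h x ≤
      n * (√(energyDensity (fun _ => 1) (fun _ => 1) U (s, x)) + |U (s, x) / s| +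
        b * √(energyDensity (fun y => y.2 ^ 2) (fun y => y.1 ^ 2) U (s, x)) +
          b * (s * |euler U (s, x) / radius (s, x)|))) :
      l2 h ≤ n * (energyNorm (fun _ => 1) (fun _ => 1) U s + (l2 fun x => U (s, x) / s) +
        ENNReal.ofReal b * invertedNorm U s + ENNReal.ofReal b * (ENNReal.ofReal s *
          l2 fun x => euler U (s, x) / radius (s, x))) := by
    have := l2_le_four (n := n) (h := h) m2 (m1.div_const s) (m3.const_mul b)
      ((m4.const_mul s).const_mul b) (by
        filter_upwards [ae_ne_zero] with x hx
        obtain ⟨h1, h2⟩ := hh x hx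
        rw [abs_of_nonneg h1]
        refine h2.trans_eq ?_
        simp only [Pi.div_apply]
        rw [abs_of_nonneg (Real.sqrt_nonneg _), abs_mul, abs_mul, abs_mul, abs_of_nonneg hb,
          abs_of_pos hs0, abs_of_nonneg (Real.sqrt_nonneg _)])
    rw [l2_const_mul hb, l2_const_mul hb, l2_const_mul hs0.le] at this
    exact this
  -- The conformal density contains the radial derivative of `rU`; by `eLpNorm_radial` it controls
  -- that of `U` with the same norm.
  have i3 : (ENNReal.ofReal s * l2 fun x => euler U (s, x) / radius (s, x)) ≤ invertedNorm U s := by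
    have e : (l2 fun x => (euler U (s, x) + U (s, x)) / radius (s, x)) =
      l2 fun x => euler U (s, x) / radius (s, x) := hU.eLpNorm_radial hs
    rw [← e, ← l2_const_mul hs0.le]
    refine l2_mono (Filter.Eventually.of_forall fun x => ?_)
    rw [abs_of_nonneg (Real.sqrt_nonneg _)]
    refine Real.abs_le_sqrt ?_
    rw [energyDensity_sq (z := (s, x)) h1, mul_pow]
    have := hA x
    rw [add_right_comm]
    exact le_add_of_nonneg_left (by positivity)
  have i1 := aux (n := 4) (h := fun x => (1 + b * jap (nullCoord (s, x)).1) *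
    √(conjSU U (s, x) ^ 2 + angSq U (s, x))) fun x hx =>
      ⟨by have := (jap_pos (nullCoord (s, x)).1).le; positivity, (key x hx).1⟩
  have i2 := aux (n := 6) (h := fun x => (b * jap (nullCoord (s, x)).2) *
    √(conjSR U (s, x) ^ 2 + (s / hypTime (s, x)) ^ 2 * angSq U (s, x))) fun x hx =>
      ⟨by have := (jap_pos (nullCoord (s, x)).2).le; positivity, (key x hx).2⟩
  unfold conformalNorm
  generalize energyNorm (fun _ => 1) (fun _ => 1) U s = E at *
  generalize (l2 fun x => U (s, x) / s) = V at *
  generalize invertedNorm U s = W at *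
  calc _ ≤ (4 : ℕ) * (E + V + ENNReal.ofReal b * W + ENNReal.ofReal b * W) +
        (6 : ℕ) * (E + V + ENNReal.ofReal b * W + ENNReal.ofReal b * W) := by
          refine add_le_add (i1.trans ?_) (i2.trans ?_) <;> gcongr
    _ = 10 * (E + V) + 20 * (ENNReal.ofReal b * W) := by push_cast; ring
    _ ≤ 20 * (E + V) + 20 * (ENNReal.ofReal b * W) := by gcongr; norm_num
    _ = _ := by ring

/-- The converse rests on the Hardy inequality `‖U‖ ≤ ‖x·∇U‖`, since `U/s` is not controlled
pointwise. The constant is `10 = 5 + 1 + 4`, from the standard energy, `U/s` and the conformal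
energy. -/
lemma Regular.le_conformalNorm (hU : Regular U s₀ s₁ K) (hs : s ∈ Icc s₀ s₁) (hb : 0 ≤ b)
    (hb1 : 1 ≤ b * s) :
    energyNorm (fun _ => 1) (fun _ => 1) U s + (l2 fun x => U (s, x) / s) +
      ENNReal.ofReal b * invertedNorm U s ≤ 10 * conformalNorm b U s := by
  have h1 : 1 ≤ s := hU.one_le.trans hs.1
  have hs0 : 0 < s := by linarith
  have m1 := hU.measurable hs
  have m2 := hU.measurable_dt hs
  have m3 := hU.measurable_euler hs
  have m4 := hU.measurable_angSq hs
  have m5 := measurable_radius s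
  have m6 := measurable_hypTime s
  have m7 := hU.measurable_conjSU hs
  have m8 := hU.measurable_conjSR hs
  have m9 := (m3.add m1).div m5
  obtain ⟨m10, m11⟩ := measurable_jap_nullCoord s
  have hA (x : Space) := angSq_nonneg U (s, x)
  set H₁ : Space → ℝ := fun x => (1 + b * jap (nullCoord (s, x)).1) *
    √(conjSU U (s, x) ^ 2 + angSq U (s, x)) with hH₁
  set H₂ : Space → ℝ := fun x => (b * jap (nullCoord (s, x)).2) *
    √(conjSR U (s, x) ^ 2 + (s / hypTime (s, x)) ^ 2 * angSq U (s, x)) with hH₂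
  have mH₁ : Measurable H₁ := by fun_prop
  have mH₂ : Measurable H₂ := by fun_prop
  have n1 (x : Space) : 0 ≤ H₁ x := by
    have := (jap_pos (nullCoord (s, x)).1).le
    simp only [hH₁]; positivity
  have n2 (x : Space) : 0 ≤ H₂ x := by
    have := (jap_pos (nullCoord (s, x)).2).le
    simp only [hH₂]; positivity
  have key (x : Space) (hx : x ≠ 0) := by
    obtain ⟨hp, hpq, hr, hq⟩ := null_facts h1 x
    have hr0 : radius (s, x) ≠ 0 := norm_ne_zero_iff.2 hx
    exact le_conformal (s := s) (p := hypTime (s, x) - radius (s, x))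
      (q := hypTime (s, x) + radius (s, x)) (T := hypTime (s, x)) (r := radius (s, x))
      (X := conjSU U (s, x)) (Q := conjSR U (s, x)) (D := euler U (s, x) / radius (s, x))
      (v := dt U (s, x)) (u := U (s, x) / s)
      (w := s * dt U (s, x) + 2 * radius (s, x) * ((euler U (s, x) + U (s, x)) / radius (s, x)))
      (a := √(angSq U (s, x))) (b := b) (τm := jap (nullCoord (s, x)).1)
      (τp := jap (nullCoord (s, x)).2) (H₁ := H₁ x) (H₂ := H₂ x)
      h1 hp (by ring) (by ring) hpq hr hb hb1 le_jap le_jap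
      (by simp only [conjSU]; ring) rfl (by simp only [conjSU]; field_simp; ring)
      (Real.sqrt_nonneg _) (by rw [Real.sq_sqrt (hA x)]) (by rw [Real.sq_sqrt (hA x)])
  have e : conformalNorm b U s = l2 H₁ + l2 H₂ := rfl
  have aux {n : ℕ} {h : Space → ℝ} (hh : ∀ x : Space, x ≠ 0 → |h x| ≤ n * (H₁ x + H₂ x)) :
      l2 h ≤ n * conformalNorm b U s := by
    rw [e]
    refine l2_le_two mH₁ mH₂ ?_
    filter_upwards [ae_ne_zero] with x hx
    rw [abs_of_nonneg (n1 x), abs_of_nonneg (n2 x)]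
    exact hh x hx
  have er : (l2 fun x => (euler U (s, x) + U (s, x)) / radius (s, x)) =
      l2 fun x => euler U (s, x) / radius (s, x) := hU.eLpNorm_radial hs
  have g1 : (l2 fun x => U (s, x) / s) ≤ conformalNorm b U s := by
    have h2 : (l2 fun x => euler U (s, x) / s) ≤ (1 : ℕ) * conformalNorm b U s := by
      refine aux fun x hx => ?_
      have hr0 : 0 < radius (s, x) := norm_pos_iff.2 hx
      have := (key x hx).2.2.2.1
      rw [abs_div, abs_of_pos hr0, mul_div_cancel₀ _ hr0.ne'] at this
      rw [abs_div, abs_of_pos hs0, Nat.cast_one, one_mul]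
      exact this
    rw [Nat.cast_one, one_mul] at h2
    refine le_trans ?_ h2
    simp only [div_eq_inv_mul]
    rw [l2_const_mul (by positivity), l2_const_mul (by positivity)]
    gcongr
    exact hU.eLpNorm_le_euler hs
  have g2 : (l2 fun x => dt U (s, x)) ≤ 3 * conformalNorm b U s := by
    have h2 := l2_le_four (n := 1) (h := fun x => dt U (s, x)) (k₁ := H₁) (k₂ := H₂)
      (k₃ := fun x => U (s, x) / s) (k₄ := fun x => U (s, x) / s) mH₁ mH₂ (m1.div_const s)
      (m1.div_const s) (by
        filter_upwards [ae_ne_zero] with x hx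
        rw [abs_of_nonneg (n1 x), abs_of_nonneg (n2 x)]
        have := (key x hx).2.2.2.2.1
        push_cast
        linarith)
    rw [← e, Nat.cast_one, one_mul] at h2
    calc _ ≤ _ := h2
      _ ≤ conformalNorm b U s + conformalNorm b U s + conformalNorm b U s := by gcongr
      _ = _ := by ring
  have g3 : (l2 fun x => euler U (s, x) / radius (s, x)) ≤ (1 : ℕ) * conformalNorm b U s :=
    aux fun x hx => by simpa using (key x hx).2.1
  have g4 : (l2 fun x => √(angSq U (s, x))) ≤ (1 : ℕ) * conformalNorm b U s :=
    aux fun x hx => by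
      rw [abs_of_nonneg (Real.sqrt_nonneg _)]
      simpa using (key x hx).1
  have g5 : ENNReal.ofReal b * invertedNorm U s ≤ 4 * conformalNorm b U s := by
    have h2 := l2_le_four (n := 1)
      (h := fun x => b * √(energyDensity (fun y => y.2 ^ 2) (fun y => y.1 ^ 2) U (s, x)))
      (k₁ := fun x => b * (s * dt U (s, x) +
        2 * radius (s, x) * ((euler U (s, x) + U (s, x)) / radius (s, x))))
      (k₂ := fun x => b * (s * ((euler U (s, x) + U (s, x)) / radius (s, x))))
      (k₃ := fun x => b * (s * √(angSq U (s, x)))) (k₄ := fun _ => 0)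
      (((m2.const_mul s).add ((m5.const_mul 2).mul m9)).const_mul b)
      ((m9.const_mul s).const_mul b) (by fun_prop) (by fun_prop)
      (Filter.Eventually.of_forall fun x => by
        rw [energyDensity_sq (z := (s, x)) h1]
        simp only [abs_mul, abs_of_nonneg hb, Nat.cast_one, one_mul, abs_zero, add_zero]
        rw [← mul_add, ← mul_add]
        gcongr
        rw [← mul_pow, abs_of_nonneg (Real.sqrt_nonneg _)]
        have hA' : 0 ≤ s ^ 2 * angSq U (s, x) := by have := hA x; positivity
        refine (sqrt_add_le (by positivity) hA').trans ?_
        have h3 := sqrt_add_le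
          (sq_nonneg (s * dt U (s, x) +
            2 * radius (s, x) * ((euler U (s, x) + U (s, x)) / radius (s, x))))
          (sq_nonneg (s * ((euler U (s, x) + U (s, x)) / radius (s, x))))
        rw [Real.sqrt_sq_eq_abs, Real.sqrt_sq_eq_abs, abs_mul s] at h3
        rw [Real.sqrt_mul (sq_nonneg s), Real.sqrt_sq_eq_abs,
          abs_of_nonneg (Real.sqrt_nonneg (angSq U (s, x)))]
        gcongr)
    have j1 : (l2 fun x => b * (s * dt U (s, x) +
        2 * radius (s, x) * ((euler U (s, x) + U (s, x)) / radius (s, x)))) ≤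
        (2 : ℕ) * conformalNorm b U s := aux fun x hx => by
      rw [abs_mul, abs_of_nonneg hb]
      exact (key x hx).2.2.2.2.2.1
    have j2 : (l2 fun x => b * (s * ((euler U (s, x) + U (s, x)) / radius (s, x)))) ≤
        (1 : ℕ) * conformalNorm b U s := by
      -- The summand `U/r` is removed at the level of norms, not pointwise, before the pointwise
      -- bound on `x·∇U/r` applies.
      rw [l2_const_mul hb, l2_const_mul hs0.le, er, ← l2_const_mul hs0.le, ← l2_const_mul hb]
      refine aux fun x hx => ?_
      rw [abs_mul, abs_mul, abs_of_nonneg hb, abs_of_pos hs0]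
      simpa using (key x hx).2.2.1
    have j3 : (l2 fun x => b * (s * √(angSq U (s, x)))) ≤ (1 : ℕ) * conformalNorm b U s :=
      aux fun x hx => by
        rw [abs_mul, abs_mul, abs_of_nonneg hb, abs_of_pos hs0,
          abs_of_nonneg (Real.sqrt_nonneg _)]
        simpa using (key x hx).2.2.2.2.2.2
    rw [l2_const_mul hb] at h2
    calc _ ≤ _ := h2
      _ ≤ (1 : ℕ) * ((2 : ℕ) * conformalNorm b U s + (1 : ℕ) * conformalNorm b U s +
          (1 : ℕ) * conformalNorm b U s + 0) := by
            gcongr; simp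
      _ = _ := by push_cast; ring
  have g0 := hU.energyNorm_one_le hs
  calc _ ≤ (3 * conformalNorm b U s + (1 : ℕ) * conformalNorm b U s +
        (1 : ℕ) * conformalNorm b U s) + conformalNorm b U s + 4 * conformalNorm b U s := by
          gcongr; exact g0.trans (by gcongr)
    _ = _ := by push_cast; ring

end

/-! ### The estimates -/

section

variable {f g : ℝ × ℝ → ℝ} {U : Spacetime → ℝ} {s s₀ s₁ a : ℝ} {K : Set Space}

/-- The source norm of `U` in hyperboloidal coordinates. -/
def hypSource (a : ℝ) (U : Spacetime → ℝ) (s₀ s₁ : ℝ) : ℝ≥0∞ :=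
  ∫⁻ s in Icc s₀ s₁, l2 fun x => jap (nullCoord (s, x)).2 ^ a * hypBox U (s, x)

lemma hypSource_mono {s₁' : ℝ} (h : s₁' ≤ s₁) : hypSource a U s₀ s₁' ≤ hypSource a U s₀ s₁ :=
  lintegral_mono_set (Icc_subset_Icc_right h)

lemma lintegral_l2_le {h : ℝ → Space → ℝ} {n : ℕ} (hh : ∀ s ∈ Icc s₀ s₁, ∀ x,
    |h s x| ≤ n * |jap (nullCoord (s, x)).2 ^ a * hypBox U (s, x)|) :
    ∫⁻ s in Icc s₀ s₁, l2 (h s) ≤ n * hypSource a U s₀ s₁ := by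
  rw [hypSource, ← lintegral_const_mul' _ _ (ENNReal.natCast_ne_top n)]
  exact setLIntegral_mono' measurableSet_Icc fun s hs =>
    l2_le_one (Filter.Eventually.of_forall (hh s hs))

lemma hypSource_zero_le (ha : 0 ≤ a) : hypSource 0 U s₀ s₁ ≤ hypSource a U s₀ s₁ := by
  have := lintegral_l2_le (s₀ := s₀) (s₁ := s₁) (U := U) (a := a) (n := 1)
    (h := fun s x => jap (nullCoord (s, x)).2 ^ (0 : ℝ) * hypBox U (s, x)) fun s _ x => by
      rw [Real.rpow_zero, one_mul, Nat.cast_one, one_mul, abs_mul]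
      refine le_mul_of_one_le_left (abs_nonneg _) ?_
      exact (Real.one_le_rpow (one_le_jap _) ha).trans (le_abs_self _)
  simpa [hypSource] using this

lemma Regular.energyNorm_one_growth (hU : Regular U s₀ s₁ K) (h01 : s₀ ≤ s₁) :
    energyNorm (fun _ => 1) (fun _ => 1) U s₁ ≤
      energyNorm (fun _ => 1) (fun _ => 1) U s₀ + 2 * hypSource 0 U s₀ s₁ := by
  refine (admissible_one.energy_estimate hU h01).trans ?_
  rw [energyNorm]
  gcongr
  refine (lintegral_l2_le (a := 0) (U := U) (n := 1) fun s hs x => ?_).trans_eq (by simp)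
  rw [sourceWeight_one (z := (s, x)) (by linarith [hU.one_le, hs.1] : 0 < s)]
  simp

/-- The source weight is at most `f ≤ 3 τ₊^(2a)`, so its root is at most `2 τ₊^a`; the energy
estimate contributes the other factor `2`. -/
lemma Regular.energyR_growth (hU : Regular U s₀ s₁ K) (h01 : s₀ ≤ s₁) (hfg : Admissible f g)
    (hf : ∀ y ∈ nullRegion, f y ≤ 3 * (jap y.2 ^ a) ^ 2) :
    energyNorm f g U s₁ ≤ energyNorm f g U s₀ + 4 * hypSource a U s₀ s₁ := by
  refine (hfg.energy_estimate hU h01).trans ?_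
  rw [energyNorm, show (4 : ℝ≥0∞) = 2 * 2 by norm_num, mul_assoc 2 2]
  gcongr
  refine (lintegral_l2_le (a := a) (U := U) (n := 2) fun s hs x => ?_).trans_eq (by simp)
  have h1 : 1 ≤ s := hU.one_le.trans hs.1
  have hw : 0 ≤ jap (nullCoord (s, x)).2 ^ a := Real.rpow_nonneg (jap_pos _).le _
  rw [abs_mul, abs_mul, abs_abs, ← mul_assoc, abs_of_nonneg (Real.sqrt_nonneg _), abs_of_nonneg hw]
  gcongr
  refine Real.sqrt_le_iff.2 ⟨by positivity, ?_⟩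
  have i1 := hfg.sourceWeight_le (z := (s, x)) h1
  have i2 := hf _ (nullCoord_mem (z := (s, x)) h1)
  push_cast
  nlinarith [sq_nonneg (jap (nullCoord (s, x)).2 ^ a)]

/-- The conformal energy has the source `s ‖□φ‖`. As `s^(a-1)` is nonincreasing in `s`, the
prefactor at `s₁` may be moved inside the integral, where `s^(a-1) s = s^a ≤ τ₊^a`. -/
lemma Regular.invertedNorm_growth (hU : Regular U s₀ s₁ K) (h01 : s₀ ≤ s₁) (ha : 0 ≤ a)
    (ha1 : a ≤ 1) :
    ENNReal.ofReal (s₁ ^ (a - 1)) * invertedNorm U s₁ ≤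
      ENNReal.ofReal (s₀ ^ (a - 1)) * invertedNorm U s₀ + 2 * hypSource a U s₀ s₁ := by
  have h0 : 0 < s₀ := by linarith [hU.one_le]
  have h1 : 0 < s₁ := by linarith
  have hb (s : ℝ) (hs : s ∈ Icc s₀ s₁) : s₁ ^ (a - 1) ≤ s ^ (a - 1) :=
    Real.rpow_le_rpow_of_nonpos (h0.trans_le hs.1) hs.2 (by linarith)
  have key := mul_le_mul_right (admissible_sq.energy_estimate hU h01)
    (ENNReal.ofReal (s₁ ^ (a - 1)))
  refine key.trans ?_
  rw [mul_add, mul_left_comm _ 2]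
  refine add_le_add (mul_le_mul' (ENNReal.ofReal_le_ofReal (hb _ (left_mem_Icc.2 h01))) le_rfl)
    (mul_le_mul' le_rfl ?_)
  · rw [← lintegral_const_mul' _ _ ENNReal.ofReal_ne_top]
    simp only [← l2_const_mul (Real.rpow_nonneg h1.le (a - 1))]
    refine (lintegral_l2_le (a := a) (U := U) (n := 1) fun s hs x => ?_).trans_eq (by simp)
    have hs0 : 0 < s := h0.trans_le hs.1
    have hs1 : 1 ≤ s := hU.one_le.trans hs.1
    rw [sourceWeight_sq (z := (s, x)) hs0, Real.sqrt_sq hs0.le, Nat.cast_one, one_mul, abs_mul,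
      abs_mul, abs_abs, abs_mul, ← mul_assoc, abs_of_nonneg (Real.rpow_nonneg h1.le _),
      abs_of_pos hs0, abs_of_nonneg (Real.rpow_nonneg (jap_pos _).le a)]
    gcongr
    obtain ⟨hp, hpq, hr, hq⟩ := null_facts hs1 x
    calc s₁ ^ (a - 1) * s ≤ s ^ (a - 1) * s := mul_le_mul_of_nonneg_right (hb s hs) hs0.le
      _ = s ^ a := by rw [Real.rpow_sub_one hs0.ne', div_mul_cancel₀ _ hs0.ne']
      _ ≤ _ := by
        refine Real.rpow_le_rpow hs0.le (le_trans ?_ le_jap) ha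
        simp only [nullCoord]
        nlinarith

/-- The norm of `U` grows at most by `2 ∫ ‖∂_s U‖ ds`, and the integrand is bounded by the standard
energy. Division by `s₁` compensates the length of the interval. -/
lemma Regular.div_growth (hU : Regular U s₀ s₁ K) (h01 : s₀ ≤ s₁) :
    (l2 fun x => U (s₁, x) / s₁) ≤ (l2 fun x => U (s₀, x) / s₀) +
      2 * (energyNorm (fun _ => 1) (fun _ => 1) U s₀ + 2 * hypSource 0 U s₀ s₁) := by
  have h0 : 0 < s₀ := by linarith [hU.one_le]
  have h1 : 0 < s₁ := by linarith
  set M := energyNorm (fun _ => 1) (fun _ => 1) U s₀ + 2 * hypSource 0 U s₀ s₁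
  have hM (s : ℝ) (hs : s ∈ Icc s₀ s₁) : (l2 fun x => dt U (s, x)) ≤ M := by
    refine (hU.le_energyNorm_one hs).1.trans (((hU.mono hs.2).energyNorm_one_growth hs.1).trans ?_)
    simp only [M]
    gcongr
    exact hypSource_mono hs.2
  have hI : ∫⁻ s in Icc s₀ s₁, (l2 fun x => dt U (s, x)) ≤ M * ENNReal.ofReal s₁ := by
    refine (setLIntegral_mono' measurableSet_Icc hM).trans ?_
    rw [setLIntegral_const, Real.volume_Icc]
    gcongr
    linarith
  have hc : ENNReal.ofReal s₁⁻¹ * ENNReal.ofReal s₁ = 1 := by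
    rw [← ENNReal.ofReal_mul (by positivity), inv_mul_cancel₀ h1.ne', ENNReal.ofReal_one]
  simp only [div_eq_inv_mul]
  rw [l2_const_mul (by positivity), l2_const_mul (by positivity)]
  calc _ ≤ ENNReal.ofReal s₁⁻¹ * ((l2 fun x => U (s₀, x)) + 2 * (M * ENNReal.ofReal s₁)) := by
        gcongr
        exact (hU.eLpNorm_growth h01).trans (by gcongr)
    _ = ENNReal.ofReal s₁⁻¹ * (l2 fun x => U (s₀, x)) +
        2 * M * (ENNReal.ofReal s₁⁻¹ * ENNReal.ofReal s₁) := by ring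
    _ ≤ _ := by
      rw [hc, mul_one]
      gcongr

lemma Regular.energyW_growth (hU : Regular U s₀ s₁ K) (h01 : s₀ ≤ s₁) :
    ((l2 fun x => dt U (s₁, x)) + l2 fun x => ‖grad U (s₁, x)‖) ≤
      6 * (((l2 fun x => dt U (s₀, x)) + l2 fun x => ‖grad U (s₀, x)‖) +
        hypSource 0 U s₀ s₁) := by
  calc _ ≤ _ := (hU.energyW_bounds (right_mem_Icc.2 h01)).1
    _ ≤ 3 * (energyNorm (fun _ => 1) (fun _ => 1) U s₀ + 2 * hypSource 0 U s₀ s₁) := by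
      gcongr; exact hU.energyNorm_one_growth h01
    _ ≤ 3 * (2 * ((l2 fun x => dt U (s₀, x)) + l2 fun x => ‖grad U (s₀, x)‖) +
        2 * hypSource 0 U s₀ s₁) := by
      gcongr; exact (hU.energyW_bounds (left_mem_Icc.2 h01)).2
    _ = _ := by ring

/-- The conformal energy of `r φ` in hyperboloidal coordinates. -/
def conformalNormR (a : ℝ) (U : Spacetime → ℝ) (s : ℝ) : ℝ≥0∞ :=
  (l2 fun x => (1 + a * jap (nullCoord (s, x)).2 ^ a *
    (jap (nullCoord (s, x)).1 / jap (nullCoord (s, x)).2) ^ max a (1 / 2)) *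
      √(dt U (s, x) ^ 2 + angSq U (s, x))) +
  l2 fun x => jap (nullCoord (s, x)).2 ^ a *
    √(conjR U (s, x) ^ 2 + (s / hypTime (s, x)) ^ 2 * angSq U (s, x))

lemma Regular.conformalNormR_growth (hU : Regular U s₀ s₁ K) (h01 : s₀ ≤ s₁) (ha : 0 ≤ a)
    (ha1 : a ≤ 1) :
    conformalNormR a U s₁ ≤ 20 * (conformalNormR a U s₀ + hypSource a U s₀ s₁) := by
  obtain ⟨f, g, hfg, hw⟩ := exists_admissible ha ha1
  have key (s : ℝ) (hs : s ∈ Icc s₀ s₁) := by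
    have hy (x : Space) := nullCoord_mem (z := (s, x)) (hU.one_le.trans hs.1)
    obtain ⟨m1, m2⟩ := measurable_jap_nullCoord s
    exact hU.energyR_bounds hs hfg
      (w₁ := fun x => 1 + a * jap (nullCoord (s, x)).2 ^ a *
        (jap (nullCoord (s, x)).1 / jap (nullCoord (s, x)).2) ^ max a (1 / 2))
      (w₂ := fun x => jap (nullCoord (s, x)).2 ^ a)
      (fun x => by
        have h1 := (jap_pos (nullCoord (s, x)).1).le
        have h2 := (jap_pos (nullCoord (s, x)).2).le
        positivity)
      (fun x => Real.rpow_nonneg (jap_pos _).le _)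
      (((m2.pow_const a).const_mul a).mul ((m1.div m2).pow_const _) |>.const_add 1)
      (m2.pow_const a) (fun x => (hw _ (hy x)).1) (fun x => (hw _ (hy x)).2.1)
      (fun x => (hw _ (hy x)).2.2.1) (fun x => (hw _ (hy x)).2.2.2)
  calc conformalNormR a U s₁ ≤ 5 * energyNorm f g U s₁ := (key s₁ (right_mem_Icc.2 h01)).1
    _ ≤ 5 * (energyNorm f g U s₀ + 4 * hypSource a U s₀ s₁) := by
      gcongr; exact hU.energyR_growth h01 hfg fun y hy => (hw y hy).1
    _ ≤ 5 * (4 * conformalNormR a U s₀ + 4 * hypSource a U s₀ s₁) := by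
      gcongr; exact (key s₀ (left_mem_Icc.2 h01)).2
    _ = _ := by ring

/-- The three constituents are propagated separately: the standard energy by `f = g = 1`, then
`‖U/s‖` by means of that bound, and the conformal energy by `f = q²`, `g = p²`. The parameter `b =
s^(a-1)` satisfies `b ≤ 1` at `s₁` and `b s ≥ 1` at `s₀`, as the two comparisons require. -/
lemma Regular.conformalNorm_growth (hU : Regular U s₀ s₁ K) (h01 : s₀ ≤ s₁) (ha : 0 ≤ a)
    (ha1 : a ≤ 1) :
    conformalNorm (s₁ ^ (a - 1)) U s₁ ≤
      600 * (conformalNorm (s₀ ^ (a - 1)) U s₀ + hypSource a U s₀ s₁) := by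
  have h0 : 1 ≤ s₀ := hU.one_le
  have h00 : 0 < s₀ := by linarith
  have h1 : 1 ≤ s₁ := h0.trans h01
  have hb : s₁ ^ (a - 1) ≤ 1 := Real.rpow_le_one_of_one_le_of_nonpos h1 (by linarith)
  have hb0 : 1 ≤ s₀ ^ (a - 1) * s₀ := by
    rw [Real.rpow_sub_one h00.ne', div_mul_cancel₀ _ h00.ne']
    exact Real.one_le_rpow h0 ha
  have i1 := hU.energyNorm_one_growth h01
  have i2 := hU.div_growth h01
  have i3 := hU.invertedNorm_growth h01 ha ha1
  have i4 := hU.le_conformalNorm (left_mem_Icc.2 h01) (Real.rpow_nonneg h00.le (a - 1)) hb0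
  have i5 : hypSource 0 U s₀ s₁ ≤ hypSource a U s₀ s₁ := hypSource_zero_le ha
  refine (hU.conformalNorm_le (right_mem_Icc.2 h01) (by positivity) hb).trans ?_
  generalize conformalNorm (s₀ ^ (a - 1)) U s₀ = N at *
  generalize hypSource 0 U s₀ s₁ = I at *
  generalize hypSource a U s₀ s₁ = J at *
  generalize energyNorm (fun _ => 1) (fun _ => 1) U s₀ = E at *
  generalize (l2 fun x => U (s₀, x) / s₀) = V at *
  generalize ENNReal.ofReal (s₀ ^ (a - 1)) * invertedNorm U s₀ = W at *
  calc _ ≤ 20 * ((E + 2 * J) + (V + 2 * (E + 2 * J)) + (W + 2 * J)) := by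
        gcongr
        · exact i1.trans (by gcongr)
        · exact i2.trans (by gcongr)
    _ = 60 * E + 20 * V + 20 * W + 160 * J := by ring
    _ ≤ 60 * E + 60 * V + 60 * W + 600 * J := by gcongr <;> norm_num
    _ = 60 * (E + V + W) + 600 * J := by ring
    _ ≤ 60 * (10 * N) + 600 * J := by gcongr
    _ = _ := by ring

end

end Hyperboloidal

end

open Hyperboloidal
theorem proposition5p3 :
    ∃ C : ℝ≥0, ∀ (s₀ s₁ a : ℝ), 1 < s₀ → s₀ ≤ s₁ → 0 ≤ a → a ≤ 1 →
      ∀ φ F : Spacetime → ℝ,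
        (∀ p ∈ slab s₀ s₁, ContDiffAt ℝ 2 φ p) →
        (∃ S : Set Spacetime, IsCompact S ∧ ∀ p ∈ slab s₀ s₁, φ p ≠ 0 → p ∈ S) →
        (∀ p ∈ slab s₀ s₁, box φ p = F p) →
        (⨆ s ∈ Icc s₀ s₁, energyW s φ) ≤ C * (energyW s₀ φ + sourceNorm 0 s₀ s₁ F) ∧
        (⨆ s ∈ Icc s₀ s₁, energyR a s φ) ≤ C * (energyR a s₀ φ + sourceNorm a s₀ s₁ F) ∧
        (⨆ s ∈ Icc s₀ s₁, energyS a s φ) ≤ C * (energyS a s₀ φ + sourceNorm a s₀ s₁ F) := by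
  -- The constant is that of `conformalNorm_growth`; the other two estimates need only `6` and `20`.
  refine ⟨600, fun s₀ s₁ a h0 h01 ha ha1 φ F hφ hS hF => ?_⟩
  have h00 : 0 < s₀ := by linarith
  have hC (A B : ℝ≥0∞) : A ≤ ((600 : ℝ≥0) : ℝ≥0∞) * (A + B) := by
    refine le_self_add.trans (le_mul_of_one_le_left' ?_)
    norm_num
  -- If `s₀ = s₁` the slab is a single hyperboloid and compact support says nothing about
  -- transversal derivatives, but the supremum is then the initial value.
  rcases h01.eq_or_lt with rfl | hlt
  · simp only [Icc_self, mem_singleton_iff, iSup_iSup_eq_left]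
    exact ⟨hC _ _, hC _ _, hC _ _⟩
  obtain ⟨K, hU⟩ := exists_regular h0.le hlt hφ hS
  have hd (s : ℝ) (hs : s ∈ Icc s₀ s₁) (x : Space) : DifferentiableAt ℝ φ (hypMap (s, x)) :=
    (hφ _ (hypMap_mem_slab h00 hs x)).differentiableAt (by norm_num)
  have e₀ := left_mem_Icc.2 h01
  have eF (b : ℝ) : sourceNorm b s₀ s₁ F = hypSource b (hypPull φ) s₀ s₁ := sourceNorm_eq h00 hφ hF
  have eR (s : ℝ) (hs : s ∈ Icc s₀ s₁) : energyR a s φ = conformalNormR a (hypPull φ) s :=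
    energyR_eq ha (h00.trans_le hs.1) (hd s hs)
  have eS (s : ℝ) (hs : s ∈ Icc s₀ s₁) :
      energyS a s φ = conformalNorm (s ^ (a - 1)) (hypPull φ) s :=
    energyS_eq (h00.trans_le hs.1) (hd s hs)
  refine ⟨iSup₂_le fun s hs => ?_, iSup₂_le fun s hs => ?_, iSup₂_le fun s hs => ?_⟩
  · rw [energyW_eq (h00.trans_le hs.1) (hd s hs), energyW_eq h00 (hd s₀ e₀), eF]
    -- The growth estimate is applied on `[s₀, s]`, and the source norm increases with the interval.
    refine ((hU.mono hs.2).energyW_growth hs.1).trans ?_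
    gcongr
    · norm_num
    · exact hypSource_mono hs.2
  · rw [eR s hs, eR s₀ e₀, eF]
    refine ((hU.mono hs.2).conformalNormR_growth hs.1 ha ha1).trans ?_
    gcongr
    · norm_num
    · exact hypSource_mono hs.2
  · rw [eS s hs, eS s₀ e₀, eF]
    refine ((hU.mono hs.2).conformalNorm_growth hs.1 ha ha1).trans ?_
    gcongr
    · norm_num
    · exact hypSource_mono hs.2
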